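/- Let $X$ be a compact Kähler surface with Kähler form $\omega$, and let $Z$ be the polynomial central charge given by $\omega$, a stability vector $(\rho_0,\rho_1,\rho_2)\in(\mathbb{C}^*)^3$ with $\operatorname{Im}(\rho_j/\rho_{j+1})>0$ for $j=0,1$, and a unipotent class $U=1+U_1+U_2$ with $U_j\in H^{j,j}(X,\mathbb{R})$. By a curve $V\subset X$ we mean an irreducible (reduced, possibly singular) one-dimensional analytic subvariety. For a coherent sheaf $Q$ on a curve $V$ put $\deg_V(Q)=\chi(V,Q)-\operatorname{rk}(Q)\,\chi(V,\mathcal{O}_V)$ and $$Z_V(Q)=\rho_1\,([\omega].[V])\,\operatorname{rk}(Q)+\rho_0\,(U_1.[V])\,\operatorname{rk}(Q)+\rho_0\deg_V(Q).$$ Let $E$ be a holomorphic vector bundle on $X$. Then the following are equivalent. 1. $E$ is $Z$-stable over subvarieties: for every curve $V\subset X$ and every short exact sequence $0\to S\to E|_V\to Q\to 0$ of coherent sheaves on $V$ with $S\neq 0$ and $Q\neq 0$, $$\operatorname{Im}\left(\frac{Z_V(Q)}{Z_V(E|_V)}\right)>0.$$ 2. For every curve $V\subset X$ the restriction $E|_V$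 is Mumford stable, i.e. $\deg_V(Q)/\operatorname{rk}(Q)>\deg_V(E|_V)/\operatorname{rk}(E)$ for every coherent quotient $Q$ of $E|_V$ with $0<\operatorname{rk}(Q)<\operatorname{rk}(E)$. -/

import Mathlib

open CategoryTheory TopologicalSpace Opposite
open scoped Manifold ContDiff ENNReal

universe u

namespace ZStability

/-- The model space `ℂ²` of a complex surface. -/
abbrev C2 : Type := EuclideanSpace ℂ (Fin 2)

/-! ### Differential forms on a complex surface -/

section Forms

variable (X : Type u) [TopologicalSpace X] [ChartedSpace C2 X]

/-- The expression, in the holomorphic chart `e`, of a field `η` of real alternating `k`-forms on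
the (real) tangent spaces of `X`: the pullback of `η` under `e⁻¹`. -/
noncomputable def formInChart {X : Type u} [TopologicalSpace X] [ChartedSpace C2 X] {k : ℕ}
    (η : ∀ x : X, TangentSpace 𝓘(ℂ, C2) x [⋀^Fin k]→L[ℝ] ℝ)
    (e : OpenPartialHomeomorph X C2) (z : C2) : C2 [⋀^Fin k]→L[ℝ] ℝ :=
  (η (e.symm z)).compContinuousLinearMap
    ((mfderiv 𝓘(ℂ, C2) 𝓘(ℂ, C2) e.symm z).restrictScalars ℝ)

/-- A closed smooth real differential `k`-form on `X`. -/
structure ClosedForm (k : ℕ) where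
  toFun : ∀ x : X, TangentSpace 𝓘(ℂ, C2) x [⋀^Fin k]→L[ℝ] ℝ
  smooth : ∀ e ∈ atlas C2 X, ContDiffOn ℝ ∞ (formInChart toFun e) e.target
  closed : ∀ e ∈ atlas C2 X, ∀ z ∈ e.target, extDeriv (formInChart toFun e) z = 0

variable {X}

/-- A real `2`-form is of type `(1,1)` if it is invariant under the complex structure. -/
def ClosedForm.IsOneOne (η : ClosedForm X 2) : Prop :=
  ∀ (x : X) (v w : TangentSpace 𝓘(ℂ, C2) x),
    η.toFun x ![Complex.I • v, Complex.I • w] = η.toFun x ![v, w]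

/-- A Kähler form: a closed real `(1,1)`-form which is positive. -/
structure ClosedForm.IsKahler (κ : ClosedForm X 2) : Prop where
  isOneOne : κ.IsOneOne
  pos : ∀ (x : X) (v : TangentSpace 𝓘(ℂ, C2) x), v ≠ 0 → 0 < κ.toFun x ![v, Complex.I • v]

end Forms

/-! ### Polynomial central charges -/

/-- The data, besides the Kähler form, of a polynomial central charge on a complex surface: a
stability vector `ρ = (ρ₀, ρ₁, ρ₂)` and a unipotent class `1 + U₁ + U₂` with
`U_j ∈ H^{j,j}(X, ℝ)`, given by closed forms `u₁`, `u₂` representing it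
(on a surface every `4`-form is of type `(2,2)`). -/
structure CentralCharge (X : Type u) [TopologicalSpace X] [ChartedSpace C2 X] where
  ρ : Fin 3 → ℂ
  ρ_ne_zero : ∀ j, ρ j ≠ 0
  im_pos : ∀ j : Fin 2, 0 < (ρ j.castSucc / ρ j.succ).im
  u₁ : ClosedForm X 2
  u₁_isOneOne : u₁.IsOneOne
  u₂ : ClosedForm X 4

/-! ### Curves -/

section Curves

variable {X : Type u} [TopologicalSpace X] [ChartedSpace C2 X]

/-- A closed analytic subset of `X`: closed, and near each of its points the common zero set of
finitely many holomorphic functions. -/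
def IsAnalyticSubset (V : Set X) : Prop :=
  IsClosed V ∧ ∀ p ∈ V, ∃ U : Set X, IsOpen U ∧ p ∈ U ∧ ∃ (n : ℕ) (f : Fin n → X → ℂ),
    (∀ i, MDifferentiableOn 𝓘(ℂ, C2) 𝓘(ℂ, ℂ) (f i) U) ∧ V ∩ U = {x ∈ U | ∀ i, f i x = 0}

/-- An irreducible analytic subset: nonempty, and not the union of two proper analytic subsets. -/
def IsIrreducibleAnalytic (V : Set X) : Prop :=
  IsAnalyticSubset V ∧ V.Nonempty ∧
    ∀ A B : Set X, IsAnalyticSubset A → IsAnalyticSubset B → V = A ∪ B → A = V ∨ B = V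

/-- The points near which `V` is a one-dimensional complex submanifold of the surface `X`, i.e. the
zero set of a holomorphic function with nonzero differential. -/
def regularLocus (V : Set X) : Set X :=
  {p ∈ V | ∃ U : Set X, IsOpen U ∧ p ∈ U ∧ ∃ f : X → ℂ,
    MDifferentiableOn 𝓘(ℂ, C2) 𝓘(ℂ, ℂ) f U ∧ mfderiv 𝓘(ℂ, C2) 𝓘(ℂ, ℂ) f p ≠ 0 ∧
      V ∩ U = {x ∈ U | f x = 0}}

/-- A curve in the surface `X`: an irreducible analytic subset of dimension one, with its reduced
structure. -/
def IsCurve (V : Set X) : Prop :=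
  IsIrreducibleAnalytic V ∧ V ⊆ closure (regularLocus V)

/-- A Borel piece of the regular locus of `V`, contained in the image of a local holomorphic
parametrization `γ : D → V_reg` (an injective holomorphic map between Riemann surfaces, that is,
the inverse of a holomorphic coordinate). -/
structure CoordinatePiece (V : Set X) where
  D : Set ℂ
  γ : ℂ → X
  A : Set ℂ
  isOpen_D : IsOpen D
  holomorphic : MDifferentiableOn 𝓘(ℂ, ℂ) 𝓘(ℂ, C2) γ D
  injOn : Set.InjOn γ D
  mapsTo : Set.MapsTo γ D (regularLocus V)
  measurableSet_A : MeasurableSet A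
  A_subset : A ⊆ D

/-- The function `f` with `γ^* η = f dx ∧ dy`. -/
noncomputable def pullbackDensity (η : ClosedForm X 2) (γ : ℂ → X) (z : ℂ) : ℝ :=
  η.toFun (γ z) ![mfderiv 𝓘(ℂ, ℂ) 𝓘(ℂ, C2) γ z (1 : ℂ), mfderiv 𝓘(ℂ, ℂ) 𝓘(ℂ, C2) γ z Complex.I]

/-- The integral over `V_reg` of the positive part (`ε = 1`) or of the negative part (`ε = -1`) of
the real `2`-form `η`, with respect to the complex orientation: the supremum, over the finite
families of pairwise disjoint coordinate pieces, of the sum of the integrals over the pieces. -/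
noncomputable def partIntegral (ε : ℝ) (η : ClosedForm X 2) (V : Set X) : ℝ≥0∞ :=
  ⨆ (n : ℕ) (P : Fin n → CoordinatePiece V)
    (_ : Pairwise fun i j => Disjoint ((P i).γ '' (P i).A) ((P j).γ '' (P j).A)),
    ∑ i, ∫⁻ z in (P i).A, ENNReal.ofReal (ε * pullbackDensity η (P i).γ z)

/-- The intersection number `[η].[V]`, i.e. the integral of `η` over the regular locus of `V`. -/
noncomputable def integralOver (η : ClosedForm X 2) (V : Set X) : ℝ :=
  (partIntegral 1 η V).toReal - (partIntegral (-1) η V).toReal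

end Curves

/-! ### The structure sheaf of a curve and the restriction of a vector bundle -/

section Sheaves

variable {X : Type u} [TopologicalSpace X] [ChartedSpace C2 X]

/-- Functions on open subsets of `V` that are locally restrictions of holomorphic functions on open
subsets of `X`; these are the sections of `𝒪_X / 𝓘_V`. -/
def holFunctionPredicate (V : Set X) :
    TopCat.LocalPredicate (X := TopCat.of V) (fun _ => ℂ) where
  pred {W} f := ∀ p : W, ∃ U : Set X, IsOpen U ∧ p.1.1 ∈ U ∧ ∃ g : X → ℂ,
    MDifferentiableOn 𝓘(ℂ, C2) 𝓘(ℂ, ℂ) g U ∧ ∀ q : W, q.1.1 ∈ U → f q = g q.1.1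
  res {W W'} i f h p := by
    obtain ⟨U, hU, hp, g, hg, hfg⟩ := h ⟨p.1, i.le p.2⟩
    exact ⟨U, hU, hp, g, hg, fun q hq => hfg ⟨q.1, i.le q.2⟩ hq⟩
  locality {W} f h p := by
    obtain ⟨W', hp', i, h'⟩ := h p
    obtain ⟨U, hU, hp, g, hg, hfg⟩ := h' ⟨p.1, hp'⟩
    obtain ⟨T, hT, hTW⟩ := isOpen_induced_iff.1 W'.isOpen
    have key : ∀ q : V, q ∈ W' ↔ q.1 ∈ T := fun q => by
      change q ∈ (W' : Set V) ↔ _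
      rw [← hTW]; rfl
    refine ⟨U ∩ T, hU.inter hT, ⟨hp, (key p.1).1 hp'⟩, g, hg.mono Set.inter_subset_left, ?_⟩
    intro q hq
    exact hfg ⟨q.1, (key q.1).2 hq.2⟩ hq.1

/-- The ring `𝒪_V(W)`. -/
def holFunctions (V : Set X) (W : Opens (TopCat.of V)) : Subring (W → ℂ) where
  carrier := {f | (holFunctionPredicate V).pred f}
  mul_mem' {a b} ha hb p := by
    obtain ⟨U, hU, hp, g, hg, h⟩ := ha p
    obtain ⟨U', hU', hp', g', hg', h'⟩ := hb p
    refine ⟨U ∩ U', hU.inter hU', ⟨hp, hp'⟩, g * g',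
      (hg.mono Set.inter_subset_left).mul (hg'.mono Set.inter_subset_right), fun q hq => ?_⟩
    simp [h q hq.1, h' q hq.2]
  one_mem' p := ⟨Set.univ, isOpen_univ, trivial, fun _ => 1, mdifferentiableOn_const,
    fun _ _ => rfl⟩
  add_mem' {a b} ha hb p := by
    obtain ⟨U, hU, hp, g, hg, h⟩ := ha p
    obtain ⟨U', hU', hp', g', hg', h'⟩ := hb p
    refine ⟨U ∩ U', hU.inter hU', ⟨hp, hp'⟩, g + g',
      (hg.mono Set.inter_subset_left).add (hg'.mono Set.inter_subset_right), fun q hq => ?_⟩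
    simp [h q hq.1, h' q hq.2]
  zero_mem' p := ⟨Set.univ, isOpen_univ, trivial, fun _ => 0, mdifferentiableOn_const,
    fun _ _ => rfl⟩
  neg_mem' {a} ha p := by
    obtain ⟨U, hU, hp, g, hg, h⟩ := ha p
    exact ⟨U, hU, hp, -g, hg.neg, fun q hq => by simp [h q hq]⟩

lemma const_mem_holFunctions (V : Set X) (W : Opens (TopCat.of V)) (c : ℂ) :
    (fun _ => c) ∈ holFunctions V W :=
  fun _ => ⟨Set.univ, isOpen_univ, trivial, fun _ => c, mdifferentiableOn_const, fun _ _ => rfl⟩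

/-- The structure sheaf `𝒪_V` of the reduced analytic space `V`. -/
def structureSheaf (V : Set X) :
    Sheaf (Opens.grothendieckTopology (TopCat.of V)) RingCat.{u} where
  obj :=
    { obj := fun W => RingCat.of (holFunctions V W.unop)
      map := fun i => RingCat.ofHom
        { toFun := fun f => ⟨fun p => f.1 ⟨p.1, i.unop.le p.2⟩, (holFunctionPredicate V).res i.unop f.1 f.2⟩
          map_one' := rfl
          map_mul' := fun _ _ => rfl
          map_zero' := rfl
          map_add' := fun _ _ => rfl }
      map_id := fun _ => rfl
      map_comp := fun _ _ => rfl }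
  property := by
    rw [CategoryTheory.Presheaf.isSheaf_iff_isSheaf_forget _ _ (CategoryTheory.forget RingCat)]
    exact TopCat.subpresheafToTypes.isSheaf (holFunctionPredicate V)

section Bundle

variable (F : Type*) [NormedAddCommGroup F] [NormedSpace ℂ F]
  (E : X → Type u) [TopologicalSpace (Bundle.TotalSpace F E)] [∀ x, AddCommGroup (E x)]
  [∀ x, Module ℂ (E x)] [∀ x, TopologicalSpace (E x)] [FiberBundle F E] [VectorBundle ℂ F E]

/-- Sections over open subsets of `V` of the bundle `E` that are locally restrictions of
holomorphic sections of `E` over open subsets of `X`. -/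
def holSectionPredicate (V : Set X) :
    TopCat.LocalPredicate (X := TopCat.of V) (fun p => E p.1) where
  pred {W} s := ∀ p : W, ∃ U : Set X, IsOpen U ∧ p.1.1 ∈ U ∧ ∃ t : (x : X) → E x,
    MDifferentiableOn 𝓘(ℂ, C2) (𝓘(ℂ, C2).prod 𝓘(ℂ, F))
      (fun x => Bundle.TotalSpace.mk' F x (t x)) U ∧ ∀ q : W, q.1.1 ∈ U → s q = t q.1.1
  res {W W'} i f h p := by
    obtain ⟨U, hU, hp, g, hg, hfg⟩ := h ⟨p.1, i.le p.2⟩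
    exact ⟨U, hU, hp, g, hg, fun q hq => hfg ⟨q.1, i.le q.2⟩ hq⟩
  locality {W} f h p := by
    obtain ⟨W', hp', i, h'⟩ := h p
    obtain ⟨U, hU, hp, g, hg, hfg⟩ := h' ⟨p.1, hp'⟩
    obtain ⟨T, hT, hTW⟩ := isOpen_induced_iff.1 W'.isOpen
    have key : ∀ q : V, q ∈ W' ↔ q.1 ∈ T := fun q => by
      change q ∈ (W' : Set V) ↔ _
      rw [← hTW]; rfl
    refine ⟨U ∩ T, hU.inter hT, ⟨hp, (key p.1).1 hp'⟩, g, hg.mono Set.inter_subset_left, ?_⟩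
    intro q hq
    exact hfg ⟨q.1, (key q.1).2 hq.2⟩ hq.1

/-- The `𝒪_V(W)`-module of sections of `E|_V` over `W`, first as an additive group. -/
def holSections (V : Set X) (W : Opens (TopCat.of V)) : AddSubgroup ((p : W) → E p.1.1) where
  carrier := {s | (holSectionPredicate F E V).pred s}
  add_mem' {a b} ha hb p := by
    obtain ⟨U, hU, hp, g, hg, h⟩ := ha p
    obtain ⟨U', hU', hp', g', hg', h'⟩ := hb p
    refine ⟨U ∩ U', hU.inter hU', ⟨hp, hp'⟩, g + g',
      mdifferentiableOn_add_section (hg.mono Set.inter_subset_left)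
        (hg'.mono Set.inter_subset_right), fun q hq => ?_⟩
    simp [h q hq.1, h' q hq.2]
  zero_mem' p := ⟨Set.univ, isOpen_univ, trivial, 0,
    Bundle.mdifferentiableOn_zeroSection ℂ E, fun _ _ => rfl⟩
  neg_mem' {a} ha p := by
    obtain ⟨U, hU, hp, g, hg, h⟩ := ha p
    exact ⟨U, hU, hp, -g, mdifferentiableOn_neg_section hg, fun q hq => by simp [h q hq]⟩

lemma smul_mem_holSections (V : Set X) (W : Opens (TopCat.of V)) {f : W → ℂ}
    (hf : f ∈ holFunctions V W) {s : (p : W) → E p.1.1} (hs : s ∈ holSections F E V W) :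
    (fun p => f p • s p) ∈ holSections F E V W := by
  intro p
  obtain ⟨U, hU, hp, g, hg, h⟩ := hf p
  obtain ⟨U', hU', hp', t, ht, h'⟩ := hs p
  refine ⟨U ∩ U', hU.inter hU', ⟨hp, hp'⟩, fun x => g x • t x,
    MDifferentiableOn.smul_section (hg.mono Set.inter_subset_left)
        (ht.mono Set.inter_subset_right), fun q hq => ?_⟩
  simp [h q hq.1, h' q hq.2]

/-- Pointwise multiplication makes the sections of `E|_V` over `W` a module over `𝒪_V(W)`. -/
instance holSectionsModule (V : Set X) (W : Opens (TopCat.of V)) :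
    Module (holFunctions V W) (holSections F E V W) where
  smul f s := ⟨fun p => f.1 p • s.1 p, smul_mem_holSections F E V W f.2 s.2⟩
  one_smul s := Subtype.ext (funext fun p => one_smul ℂ (s.1 p))
  mul_smul f g s := Subtype.ext (funext fun p => mul_smul (f.1 p) (g.1 p) (s.1 p))
  smul_zero f := Subtype.ext (funext fun p => smul_zero (f.1 p))
  smul_add f s t := Subtype.ext (funext fun p => smul_add (f.1 p) (s.1 p) (t.1 p))
  add_smul f g s := Subtype.ext (funext fun p => add_smul (f.1 p) (g.1 p) (s.1 p))
  zero_smul s := Subtype.ext (funext fun p => zero_smul ℂ (s.1 p))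

/-- The presheaf of abelian groups underlying `E|_V`. -/
def restrictBundlePresheaf (V : Set X) : (Opens (TopCat.of V))ᵒᵖ ⥤ AddCommGrpCat.{u} where
  obj W := AddCommGrpCat.of (holSections F E V W.unop)
  map i := AddCommGrpCat.ofHom
    { toFun := fun s => ⟨fun p => s.1 ⟨p.1, i.unop.le p.2⟩, (holSectionPredicate F E V).res i.unop s.1 s.2⟩
      map_zero' := rfl
      map_add' := fun _ _ => rfl }
  map_id _ := rfl
  map_comp _ _ := rfl

instance restrictBundlePresheafModule (V : Set X) (W : (Opens (TopCat.of V))ᵒᵖ) :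
    Module ((structureSheaf V).obj.obj W) ((restrictBundlePresheaf F E V).obj W) :=
  inferInstanceAs (Module (holFunctions V W.unop) (holSections F E V W.unop))

/-- The restriction `E|_V`, as a sheaf of `𝒪_V`-modules. -/
noncomputable def restrictBundle (V : Set X) : SheafOfModules.{u} (structureSheaf V) where
  val := PresheafOfModules.ofPresheaf (restrictBundlePresheaf F E V) (fun _ _ _ _ _ => rfl)
  isSheaf := by
    rw [CategoryTheory.Presheaf.isSheaf_iff_isSheaf_forget _ _
      (CategoryTheory.forget AddCommGrpCat)]
    exact TopCat.subpresheafToTypes.isSheaf (holSectionPredicate F E V)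

end Bundle

end Sheaves

/-! ### Coherent sheaves on a curve: rank, Euler characteristic, degree -/

section Coherent

variable {X : Type u} [TopologicalSpace X] [ChartedSpace C2 X] {V : Set X}

/-- The restriction of a section `s ∈ 𝓕(W)` to `W' ⊆ W`. -/
noncomputable def restrictSection (𝓕 : SheafOfModules.{u} (structureSheaf V))
    {W W' : Opens (TopCat.of V)} (h : W' ≤ W) (s : 𝓕.val.obj (op W)) : 𝓕.val.obj (op W') :=
  𝓕.val.map (homOfLE h).op s

/-- The restriction of a function `f ∈ 𝒪_V(W)` to `W' ⊆ W`. -/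
def restrictFunction {W W' : Opens (TopCat.of V)} (h : W' ≤ W)
    (f : (structureSheaf V).obj.obj (op W)) : (structureSheaf V).obj.obj (op W') :=
  (structureSheaf V).obj.map (homOfLE h).op f

/-- The section `∑ᵢ cᵢ sᵢ|_{W'}` defined by sections `sᵢ` over `W` and functions `cᵢ` over
`W' ⊆ W`. -/
noncomputable def combination (𝓕 : SheafOfModules.{u} (structureSheaf V))
    {W W' : Opens (TopCat.of V)} (h : W' ≤ W) {n : ℕ} (s : Fin n → 𝓕.val.obj (op W))
    (c : Fin n → (structureSheaf V).obj.obj (op W')) : 𝓕.val.obj (op W') :=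
  ∑ i, c i • restrictSection 𝓕 h (s i)

/-- `𝓕` is of finite type: near every point it is generated by finitely many sections. -/
def IsFiniteType (𝓕 : SheafOfModules.{u} (structureSheaf V)) : Prop :=
  ∀ p : V, ∃ W : Opens (TopCat.of V), p ∈ W ∧ ∃ (n : ℕ) (s : Fin n → 𝓕.val.obj (op W)),
    ∀ (W₁ : Opens (TopCat.of V)) (h₁ : W₁ ≤ W) (t : 𝓕.val.obj (op W₁)), ∀ q ∈ W₁,
      ∃ (W₂ : Opens (TopCat.of V)) (h₂ : W₂ ≤ W₁), q ∈ W₂ ∧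
        ∃ c : Fin n → (structureSheaf V).obj.obj (op W₂),
          restrictSection 𝓕 h₂ t = combination 𝓕 (h₂.trans h₁) s c

/-- `𝓕` is coherent: it is of finite type and, for all sections `s₁, …, sₙ` over an open set `W`,
the sheaf of relations `ker (𝒪ⁿ|_W → 𝓕|_W)` is of finite type. -/
def IsCoherent (𝓕 : SheafOfModules.{u} (structureSheaf V)) : Prop :=
  IsFiniteType 𝓕 ∧
  ∀ (W : Opens (TopCat.of V)) (n : ℕ) (s : Fin n → 𝓕.val.obj (op W)), ∀ p ∈ W,
    ∃ (W₀ : Opens (TopCat.of V)) (h₀ : W₀ ≤ W), p ∈ W₀ ∧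
    ∃ (m : ℕ) (r : Fin m → Fin n → (structureSheaf V).obj.obj (op W₀)),
      (∀ j, combination 𝓕 h₀ s (r j) = 0) ∧
      ∀ (W₁ : Opens (TopCat.of V)) (h₁ : W₁ ≤ W₀)
        (c : Fin n → (structureSheaf V).obj.obj (op W₁)),
        combination 𝓕 (h₁.trans h₀) s c = 0 → ∀ q ∈ W₁,
        ∃ (W₂ : Opens (TopCat.of V)) (h₂ : W₂ ≤ W₁), q ∈ W₂ ∧
          ∃ d : Fin m → (structureSheaf V).obj.obj (op W₂),
            ∀ i, restrictFunction h₂ (c i) =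
              ∑ j, d j * restrictFunction (h₂.trans h₁) (r j i)

/-- The restriction of `𝓕` to `W` is isomorphic to `𝒪ʳ|_W`. -/
def IsFreeOn (𝓕 : SheafOfModules.{u} (structureSheaf V)) (W : Opens (TopCat.of V)) (r : ℕ) :
    Prop :=
  ∃ s : Fin r → 𝓕.val.obj (op W), ∀ (W' : Opens (TopCat.of V)) (h : W' ≤ W),
    Function.Bijective (combination 𝓕 h s)

/-- The (generic) rank: a coherent sheaf on an irreducible curve is free outside a discrete set,
of a rank `r` which is the same everywhere; so there is exactly one `r` such that the sheaf is free
of rank `r` on some nonempty open set. -/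
noncomputable def rank (𝓕 : SheafOfModules.{u} (structureSheaf V)) : ℕ :=
  sInf {r | ∃ W : Opens (TopCat.of V), (W : Set V).Nonempty ∧ IsFreeOn 𝓕 W r}

/-- The constant function `c`, as an element of `𝒪_V(W)`. -/
def constFunction (V : Set X) (c : ℂ) (W : (Opens (TopCat.of V))ᵒᵖ) :
    (structureSheaf V).obj.obj W :=
  (⟨fun _ => c, const_mem_holFunctions V W.unop c⟩ : holFunctions V W.unop)

/-- Multiplication by the constant `c`, as an endomorphism of the abelian sheaf `𝓕`. -/
noncomputable def scalarEnd (𝓕 : SheafOfModules.{u} (structureSheaf V)) (c : ℂ) :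
    (SheafOfModules.toSheaf _).obj 𝓕 ⟶ (SheafOfModules.toSheaf _).obj 𝓕 where
  hom :=
    { app := fun W => AddCommGrpCat.ofHom
        (DistribSMul.toAddMonoidHom (𝓕.val.obj W) (constFunction V c W))
      naturality := fun W W' i => by
        ext s
        exact (𝓕.val.map_smul i (constFunction V c W) s).symm }

lemma scalarEnd_one (𝓕 : SheafOfModules.{u} (structureSheaf V)) : scalarEnd 𝓕 1 = 𝟙 _ := by
  ext W s
  exact one_smul (M := (structureSheaf V).obj.obj W) (α := 𝓕.val.obj W) s

lemma scalarEnd_zero (𝓕 : SheafOfModules.{u} (structureSheaf V)) : scalarEnd 𝓕 0 = 0 := by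
  ext W s
  exact zero_smul (M₀ := (structureSheaf V).obj.obj W) (A := 𝓕.val.obj W) s

lemma scalarEnd_add (𝓕 : SheafOfModules.{u} (structureSheaf V)) (a b : ℂ) :
    scalarEnd 𝓕 (a + b) = scalarEnd 𝓕 a + scalarEnd 𝓕 b := by
  ext W s
  exact add_smul (R := (structureSheaf V).obj.obj W) (M := 𝓕.val.obj W)
    (constFunction V a W) (constFunction V b W) s

lemma scalarEnd_mul (𝓕 : SheafOfModules.{u} (structureSheaf V)) (a b : ℂ) :
    scalarEnd 𝓕 (a * b) = scalarEnd 𝓕 b ≫ scalarEnd 𝓕 a := by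
  ext W s
  exact mul_smul (α := (structureSheaf V).obj.obj W) (β := 𝓕.val.obj W)
    (constFunction V a W) (constFunction V b W) s

/-- The sheaf cohomology group `Hⁱ(V, 𝓕)`. -/
abbrev Cohomology (𝓕 : SheafOfModules.{u} (structureSheaf V)) (i : ℕ) : Type u :=
  Sheaf.H ((SheafOfModules.toSheaf _).obj 𝓕) i

/-- The complex vector space structure of `Hⁱ(V, 𝓕)`, induced by that of `𝓕`. -/
@[reducible]
noncomputable def cohomologyModule (𝓕 : SheafOfModules.{u} (structureSheaf V)) (i : ℕ) :
    Module ℂ (Cohomology 𝓕 i) where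
  smul c x := Sheaf.H.map (scalarEnd 𝓕 c) i x
  one_smul x := by
    change Sheaf.H.map (scalarEnd 𝓕 1) i x = x
    rw [scalarEnd_one, Sheaf.H.map_id_apply]
  mul_smul a b x := by
    change Sheaf.H.map (scalarEnd 𝓕 (a * b)) i x =
      Sheaf.H.map (scalarEnd 𝓕 a) i (Sheaf.H.map (scalarEnd 𝓕 b) i x)
    rw [scalarEnd_mul, Sheaf.H.map_comp_apply]
  smul_zero c := map_zero (Sheaf.H.map (scalarEnd 𝓕 c) i)
  smul_add c := map_add (Sheaf.H.map (scalarEnd 𝓕 c) i)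
  add_smul a b x := by
    change Sheaf.H.map (scalarEnd 𝓕 (a + b)) i x =
      Sheaf.H.map (scalarEnd 𝓕 a) i x + Sheaf.H.map (scalarEnd 𝓕 b) i x
    rw [scalarEnd_add, Sheaf.H.map_add_apply]
  zero_smul x := by
    change Sheaf.H.map (scalarEnd 𝓕 0) i x = 0
    rw [scalarEnd_zero, Sheaf.H.map_apply, Abelian.Ext.mk₀_zero, Abelian.Ext.comp_zero]

/-- `hⁱ(V, 𝓕) = dim_ℂ Hⁱ(V, 𝓕)`. -/
noncomputable def hdim (𝓕 : SheafOfModules.{u} (structureSheaf V)) (i : ℕ) : ℕ :=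
  letI := cohomologyModule 𝓕 i
  Module.finrank ℂ (Cohomology 𝓕 i)

/-- The Euler characteristic `χ(V, 𝓕)` of a coherent sheaf on a compact curve (the cohomology in
degrees greater than the dimension `1` vanishes). -/
noncomputable def eulerChar (𝓕 : SheafOfModules.{u} (structureSheaf V)) : ℤ :=
  (hdim 𝓕 0 : ℤ) - hdim 𝓕 1

/-- The degree `deg_V(𝓕) = χ(V, 𝓕) - rk(𝓕) χ(V, 𝒪_V)`. -/
noncomputable def degree (𝓕 : SheafOfModules.{u} (structureSheaf V)) : ℤ :=
  eulerChar 𝓕 - rank 𝓕 * eulerChar (SheafOfModules.unit (structureSheaf V))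

/-- The slope `μ_V(𝓕) = deg_V(𝓕) / rk(𝓕)`, for sheaves of positive rank. -/
noncomputable def slope (𝓕 : SheafOfModules.{u} (structureSheaf V)) : ℝ :=
  degree 𝓕 / rank 𝓕

/-- The central charge
`Z_V(𝓕) = ρ₁ [κ].V rk(𝓕) + ρ₀ U₁.V rk(𝓕) + ρ₀ deg_V(𝓕)` of a coherent sheaf on a curve `V`. -/
noncomputable def charge (κ : ClosedForm X 2) (Z : CentralCharge X)
    (𝓕 : SheafOfModules.{u} (structureSheaf V)) : ℂ :=
  Z.ρ 1 * integralOver κ V * rank 𝓕 + Z.ρ 0 * integralOver Z.u₁ V * rank 𝓕 + Z.ρ 0 * degree 𝓕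

/-- A coherent sheaf `𝓔` on a curve is Mumford (slope) stable if `μ(𝓠) > μ(𝓔)` for every coherent
quotient `𝓠` of `𝓔` with `0 < rk(𝓠) < rk(𝓔)`. -/
def IsMumfordStable (𝓔 : SheafOfModules.{u} (structureSheaf V)) : Prop :=
  ∀ (𝓠 : SheafOfModules.{u} (structureSheaf V)) (q : 𝓔 ⟶ 𝓠), Epi q → IsCoherent 𝓠 →
    0 < rank 𝓠 → rank 𝓠 < rank 𝓔 → slope 𝓔 < slope 𝓠

end Coherent

/-! ### Stability over subvarieties -/

section Stability

variable {X : Type u} [TopologicalSpace X] [ChartedSpace C2 X]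
  (F : Type*) [NormedAddCommGroup F] [NormedSpace ℂ F]
  (E : X → Type u) [TopologicalSpace (Bundle.TotalSpace F E)] [∀ x, AddCommGroup (E x)]
  [∀ x, Module ℂ (E x)] [∀ x, TopologicalSpace (E x)] [FiberBundle F E] [VectorBundle ℂ F E]

/-- `E` is `Z`-stable over subvarieties (with respect to the Kähler form `κ`): for every curve
`V ⊂ X` and every short exact sequence `0 → 𝓢 → E|_V → 𝓠 → 0` of coherent sheaves on `V` with
`𝓢` and `𝓠` nonzero, `Im (Z_V(𝓠) / Z_V(E|_V)) > 0`. (The kernel `𝓢` of a morphism of coherent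
sheaves is coherent, so this need not be required separately.) -/
def IsZStableOverSubvarieties (κ : ClosedForm X 2) (Z : CentralCharge X) : Prop :=
  ∀ V : Set X, IsCurve V →
    ∀ (𝓢 𝓠 : SheafOfModules.{u} (structureSheaf V)) (i : 𝓢 ⟶ restrictBundle F E V)
      (q : restrictBundle F E V ⟶ 𝓠) (w : i ≫ q = 0),
      (ShortComplex.mk i q w).ShortExact → IsCoherent 𝓠 →
      ¬ Limits.IsZero 𝓢 → ¬ Limits.IsZero 𝓠 →
      0 < (charge κ Z 𝓠 / charge κ Z (restrictBundle F E V)).im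

end Stability

end ZStability

/-!
Write `r`, `d` for the rank and degree of a quotient `Q` of `E|_V`, `R`, `D` for those of `E|_V`,
and `A` for the area `[κ].V`. Dividing by `ρ₁` and using that the class `U₁` contributes the same
slope to both sheaves, the imaginary part of `Z(Q) / Z(E|_V)` is a positive multiple of
`A (d R - r D)` (`ZStability.im_charge_div_pos_iff`). Once `0 < A` is known, the condition on `Q` is
`r D < d R`. For `0 < r < R` this is the slope inequality of Mumford stability; the content of the
theorem is that nothing else is tested.

* If `r = R`, the subsheaf vanishes (`ZStability.eq_zero_of_rank_eq`). Near a general point `Q` is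
  free of rank `R`, and a surjection between free modules of the same finite rank over a commutative
  ring is injective. A section of the kernel thus vanishes on a nonempty open subset of the curve.
  The common zeros of the sections of the kernel form an analytic subset, because `Q` is finitely
  presented, and an analytic subset of an irreducible curve that contains an open part of it is the
  whole curve (`PlaneCurve.eq_of_isAnalyticSubset_of_interior`).
* If `r = 0` and `Q ≠ 0`, then `0 < d` (`ZStability.degree_pos_of_rank_eq_zero`). The support of `Q`
  is cut out by the maximal minors of its relations and is a proper analytic subset, hence finite
  (`PlaneCurve.finite_of_isAnalyticSubset`). A sheaf with finite support is flasque, so `h¹`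
  vanishes, and `h⁰` is positive as soon as it is finite. It is finite because the functions near a
  point, modulo functions without common zeros other than that point, are spanned by finitely many
  monomials (`PlaneCurve.IsLocalCurve.exists_polynomial_mod`), so that no form of the
  Nullstellensatz beyond Weierstrass polynomials is needed.

The local theory rests on the fact that a curve is, in suitable coordinates, an unramified covering
of a punctured disc together with the origin (`PlaneCurve.exists_isLocalCurve`). The power sums of
the zeros of `f (z, ·)` are contour integrals, hence holomorphic in `z`, and the number of distinct
zeros is read off from the Hankel determinants of these power sums; it is therefore constant off a
discrete set, and there each zero is a holomorphic function of `z`. Symmetric functions of the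
values on the sheets then give Weierstrass polynomials and norms.

The area `A` is positive and finite (`PlaneCurve.integralOver_pos`). Positivity is seen on one
sheet. For finiteness the Kähler form is bounded near a point by the sum of the pullbacks of the
Euclidean area under the two coordinate projections, and each projection has fibres of bounded
cardinality.
-/

namespace PlaneCurve

/-! ### Holomorphic functions of two variables -/

section TwoVariables

open Set Filter Topology Metric MeasureTheory

lemma continuousOn_circleIntegral_param {α : Type*} [TopologicalSpace α] {s : Set α}
    {F : α → ℂ → ℂ} {c : ℂ} {R : ℝ} (hR : 0 ≤ R)
    (hF : ContinuousOn (fun p : α × ℂ => F p.1 p.2) (s ×ˢ sphere c R)) :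
    ContinuousOn (fun x => ∮ ζ in C(c, R), F x ζ) s := by
  rw [continuousOn_iff_continuous_domRestrict]
  have h : Continuous (fun p : s × ℝ => deriv (circleMap c R) p.2 • F p.1 (circleMap c R p.2)) := by
    have h1 : Continuous (fun p : s × ℝ => F p.1 (circleMap c R p.2)) := by
      have h2 : Continuous (fun p : s × ℝ => ((p.1 : α), circleMap c R p.2)) := by fun_prop
      exact hF.comp_continuous h2 (fun p => ⟨p.1.2, circleMap_mem_sphere c hR p.2⟩)
    simp only [deriv_circleMap]
    have h3 : Continuous (fun p : s × ℝ => circleMap 0 R p.2 * Complex.I) := by fun_prop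
    exact h3.smul h1
  exact intervalIntegral.continuous_parametric_intervalIntegral_of_continuous' h 0 (2 * Real.pi)

lemma hasDerivAt_norm_le_of_bound {f : ℂ → ℂ} {z : ℂ} {r M : ℝ} (hr : 0 < r)
    (hf : DifferentiableOn ℂ f (closedBall z r)) (hM : ∀ w ∈ sphere z r, ‖f w‖ ≤ M) :
    ‖deriv f z‖ ≤ M / r := by
  refine Complex.norm_deriv_le_of_forall_mem_sphere_norm_le hr ?_ hM
  exact DifferentiableOn.diffContOnCl (by rwa [closure_ball z hr.ne'])

/-- A circle integral depending holomorphically on a parameter is holomorphic in the parameter. -/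
lemma differentiableOn_circleIntegral_param {D : Set ℂ} (hD : IsOpen D) {F : ℂ → ℂ → ℂ} {c : ℂ}
    {R : ℝ} (hR : 0 ≤ R) (hF : ContinuousOn (fun p : ℂ × ℂ => F p.1 p.2) (D ×ˢ sphere c R))
    (hd : ∀ ζ ∈ sphere c R, DifferentiableOn ℂ (fun z => F z ζ) D) :
    DifferentiableOn ℂ (fun z => ∮ ζ in C(c, R), F z ζ) D := by
  intro z₀ hz₀
  obtain ⟨ε, hε, hεD⟩ := Metric.isOpen_iff.1 hD z₀ hz₀
  have hK : IsCompact (closedBall z₀ (ε / 2) ×ˢ sphere c R) :=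
    (isCompact_closedBall _ _).prod (isCompact_sphere _ _)
  have hsub : closedBall z₀ (ε / 2) ⊆ D := (closedBall_subset_ball (by linarith)).trans hεD
  obtain ⟨M, hM⟩ := hK.exists_bound_of_continuousOn (hF.mono (prod_mono_left hsub))
  have hball : ∀ z ∈ ball z₀ (ε / 4), closedBall z (ε / 4) ⊆ closedBall z₀ (ε / 2) := by
    intro z hz w hw
    rw [mem_closedBall] at *
    rw [mem_ball] at hz
    linarith [dist_triangle w z z₀]
  have hmem : ∀ θ, circleMap c R θ ∈ sphere c R := circleMap_mem_sphere c hR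
  have hcont : ∀ z ∈ D,
      Continuous (fun θ : ℝ => deriv (circleMap c R) θ • F z (circleMap c R θ)) := by
    intro z hz
    have h2 : Continuous (fun θ : ℝ => (z, circleMap c R θ)) := by fun_prop
    have h1 := hF.comp_continuous h2 (fun θ => ⟨hz, hmem θ⟩)
    simp only [deriv_circleMap]
    have h3 : Continuous (fun θ : ℝ => circleMap 0 R θ * Complex.I) := by fun_prop
    exact h3.smul h1
  have hder : ∀ θ, ∀ z ∈ D, HasDerivAt
      (fun z => deriv (circleMap c R) θ • F z (circleMap c R θ))
      (deriv (circleMap c R) θ • deriv (fun z => F z (circleMap c R θ)) z) z := by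
    intro θ z hz
    exact (((hd _ (hmem θ)).differentiableAt (hD.mem_nhds hz)).hasDerivAt).fun_const_smul _
  have key := (intervalIntegral.hasDerivAt_integral_of_dominated_loc_of_deriv_le
    (μ := volume) (a := 0) (b := 2 * Real.pi)
    (F := fun z θ => deriv (circleMap c R) θ • F z (circleMap c R θ))
    (F' := fun z θ => deriv (circleMap c R) θ • deriv (fun z => F z (circleMap c R θ)) z)
    (x₀ := z₀) (s := ball z₀ (ε / 4)) (bound := fun _ => |R| * (M / (ε / 4)))
    (ball_mem_nhds _ (by positivity)) ?_ ?_ ?_ ?_ ?_ ?_).2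
  · exact key.differentiableAt.differentiableWithinAt
  · filter_upwards [hD.mem_nhds hz₀] with z hz
    exact (hcont z hz).aestronglyMeasurable
  · exact (hcont z₀ hz₀).intervalIntegrable _ _
  · have hu : Tendsto (fun n : ℕ => z₀ + (1 / ((n : ℂ) + 1))) atTop (𝓝[≠] z₀) := by
      refine tendsto_nhdsWithin_iff.2 ⟨?_, Eventually.of_forall fun n => ?_⟩
      · simpa using (tendsto_const_nhds (x := z₀)).add
          (tendsto_one_div_add_atTop_nhds_zero_nat (𝕜 := ℂ))
      · have : (1 / ((n : ℂ) + 1)) ≠ 0 := by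
          have : (n : ℂ) + 1 ≠ 0 := by exact_mod_cast Nat.succ_ne_zero n
          simpa using this
        simpa using this
    have hev : ∀ᶠ n : ℕ in atTop, z₀ + (1 / ((n : ℂ) + 1)) ∈ D :=
      (tendsto_nhdsWithin_iff.1 hu).1.eventually (hD.mem_nhds hz₀)
    obtain ⟨N, hN⟩ := eventually_atTop.1 hev
    refine aestronglyMeasurable_of_tendsto_ae (u := atTop) (f := fun n : ℕ => fun θ =>
      slope (fun z => deriv (circleMap c R) θ • F z (circleMap c R θ)) z₀
        (z₀ + (1 / (((n + N : ℕ) : ℂ) + 1)))) (fun n => ?_) (Eventually.of_forall fun θ => ?_)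
    · simp only [slope_def_module]
      exact (((hcont _ (hN (n + N) (by lia))).sub (hcont z₀ hz₀)).const_smul
        ((z₀ + 1 / (((n + N : ℕ) : ℂ) + 1) - z₀)⁻¹ : ℂ)).aestronglyMeasurable
    · have := (hasDerivAt_iff_tendsto_slope.1 (hder θ z₀ hz₀)).comp hu
      exact (this.comp (tendsto_add_atTop_nat N))
  · refine Eventually.of_forall fun θ _ z hz => ?_
    rw [norm_smul]
    have h1 : ‖deriv (circleMap c R) θ‖ = |R| := by simp [deriv_circleMap]
    rw [h1]
    gcongr
    refine hasDerivAt_norm_le_of_bound (by positivity)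
      ((hd _ (hmem θ)).mono ((hball z hz).trans hsub)) ?_
    intro w hw
    exact hM (w, circleMap c R θ) ⟨hball z hz (sphere_subset_closedBall hw), hmem θ⟩
  · exact intervalIntegrable_const
  · refine Eventually.of_forall fun θ _ z hz => ?_
    exact hder θ z (hsub (hball z hz (mem_closedBall_self (by positivity))))

/-- Separately holomorphic functions on a subset of `ℂ × ℂ`. -/
def SeparatelyHolomorphicOn (f : ℂ × ℂ → ℂ) (U : Set (ℂ × ℂ)) : Prop :=
  ∀ p ∈ U, DifferentiableAt ℂ (fun z => f (z, p.2)) p.1 ∧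
    DifferentiableAt ℂ (fun w => f (p.1, w)) p.2

lemma _root_.DifferentiableOn.separatelyHolomorphicOn {f : ℂ × ℂ → ℂ} {U : Set (ℂ × ℂ)}
    (hU : IsOpen U) (hf : DifferentiableOn ℂ f U) : SeparatelyHolomorphicOn f U := by
  intro p hp
  have h : DifferentiableAt ℂ f (p.1, p.2) := hf.differentiableAt (hU.mem_nhds hp)
  exact ⟨DifferentiableAt.comp (f := fun z => (z, p.2)) p.1 h (by fun_prop),
    DifferentiableAt.comp (f := fun w => (p.1, w)) p.2 h (by fun_prop)⟩

lemma exists_closedBall_prod_subset {U : Set (ℂ × ℂ)} (hU : IsOpen U) {p : ℂ × ℂ} (hp : p ∈ U) :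
    ∃ ε > 0, closedBall p.1 ε ×ˢ closedBall p.2 ε ⊆ U := by
  obtain ⟨ε, hε, h⟩ := Metric.isOpen_iff.1 hU p hp
  refine ⟨ε / 2, by positivity, ?_⟩
  rw [closedBall_prod_same]
  exact (closedBall_subset_ball (by linarith)).trans h

lemma deriv_snd_eq_circleIntegral {f : ℂ × ℂ → ℂ} {U : Set (ℂ × ℂ)} (hU : IsOpen U)
    (hs : SeparatelyHolomorphicOn f U) {z c : ℂ} {R : ℝ} (h : ∀ w ∈ closedBall c R, (z, w) ∈ U)
    {w : ℂ} (hw : w ∈ ball c R) :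
    deriv (fun w => f (z, w)) w =
      (2 * Real.pi * Complex.I : ℂ)⁻¹ • ∮ ζ in C(c, R), ((ζ - w) ^ 2)⁻¹ • f (z, ζ) := by
  have hV : IsOpen {w | (z, w) ∈ U} := hU.preimage (by fun_prop)
  exact (Complex.two_pi_I_inv_smul_circleIntegral_sub_sq_inv_smul_of_differentiable hV
    (fun w hw => h w hw) (f := fun w => f (z, w))
    (fun w hw => (hs (z, w) hw).2.differentiableWithinAt) hw).symm

lemma continuousOn_deriv_snd {f : ℂ × ℂ → ℂ} {U : Set (ℂ × ℂ)} (hU : IsOpen U)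
    (hc : ContinuousOn f U) (hs : SeparatelyHolomorphicOn f U) :
    ContinuousOn (fun p : ℂ × ℂ => deriv (fun w => f (p.1, w)) p.2) U := by
  intro p hp
  obtain ⟨ε, hε, h⟩ := exists_closedBall_prod_subset hU hp
  have hN : ball p.1 ε ×ˢ ball p.2 ε ∈ 𝓝 p :=
    prod_mem_nhds (ball_mem_nhds _ hε) (ball_mem_nhds _ hε)
  refine ContinuousAt.continuousWithinAt ?_
  have h1 : ContinuousOn (fun q : ℂ × ℂ => ∮ ζ in C(p.2, ε), ((ζ - q.2) ^ 2)⁻¹ • f (q.1, ζ))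
      (ball p.1 ε ×ˢ ball p.2 ε) := by
    refine continuousOn_circleIntegral_param hε.le ?_
    refine ContinuousOn.fun_smul
      (ContinuousOn.fun_inv₀ (Continuous.continuousOn (by fun_prop)) ?_) ?_
    · rintro ⟨⟨a, b⟩, ζ⟩ ⟨hq, hζ⟩
      refine pow_ne_zero _ (sub_ne_zero.2 fun h0 => ?_)
      obtain rfl : ζ = b := h0
      have h3 := hq.2
      simp only [mem_ball] at h3
      exact absurd (mem_sphere.1 hζ) h3.ne
    · refine hc.comp (by fun_prop) ?_
      rintro ⟨q, ζ⟩ ⟨hq, hζ⟩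
      exact h ⟨ball_subset_closedBall hq.1, sphere_subset_closedBall hζ⟩
  refine ContinuousAt.congr (((h1.const_smul (2 * Real.pi * Complex.I : ℂ)⁻¹).continuousAt hN)) ?_
  filter_upwards [hN] with q hq
  exact (deriv_snd_eq_circleIntegral hU hs (fun w hw => h ⟨ball_subset_closedBall hq.1, hw⟩)
    hq.2).symm

lemma SeparatelyHolomorphicOn.deriv_snd {f : ℂ × ℂ → ℂ} {U : Set (ℂ × ℂ)} (hU : IsOpen U)
    (hc : ContinuousOn f U) (hs : SeparatelyHolomorphicOn f U) :
    SeparatelyHolomorphicOn (fun p : ℂ × ℂ => deriv (fun w => f (p.1, w)) p.2) U := by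
  intro p hp
  obtain ⟨ε, hε, h⟩ := exists_closedBall_prod_subset hU hp
  constructor
  · have h1 : DifferentiableOn ℂ (fun z => ∮ ζ in C(p.2, ε), ((ζ - p.2) ^ 2)⁻¹ • f (z, ζ))
        (ball p.1 ε) := by
      refine differentiableOn_circleIntegral_param isOpen_ball hε.le ?_ ?_
      · refine ContinuousOn.fun_smul
          (ContinuousOn.fun_inv₀ (Continuous.continuousOn (by fun_prop)) ?_) ?_
        · rintro ⟨q, ζ⟩ ⟨hq, hζ⟩
          refine pow_ne_zero _ (sub_ne_zero.2 ?_)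
          rintro rfl
          simp at hζ
          exact hε.ne hζ
        · refine hc.comp (by fun_prop) ?_
          rintro ⟨q, ζ⟩ ⟨hq, hζ⟩
          exact h ⟨ball_subset_closedBall hq, sphere_subset_closedBall hζ⟩
      · intro ζ hζ z hz
        exact ((hs (z, ζ) (h ⟨ball_subset_closedBall hz,
          sphere_subset_closedBall hζ⟩)).1.fun_const_smul _).differentiableWithinAt
    have h2 := (h1.const_smul (2 * Real.pi * Complex.I : ℂ)⁻¹).differentiableAt (ball_mem_nhds _ hε)
    refine h2.congr_of_eventuallyEq ?_
    filter_upwards [ball_mem_nhds p.1 hε] with z hz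
    exact deriv_snd_eq_circleIntegral hU hs (fun w hw => h ⟨ball_subset_closedBall hz, hw⟩)
      (mem_ball_self hε)
  · have hV : IsOpen {w | (p.1, w) ∈ U} := hU.preimage (by fun_prop)
    have h1 : DifferentiableOn ℂ (fun w => f (p.1, w)) {w | (p.1, w) ∈ U} :=
      fun w hw => (hs (p.1, w) hw).2.differentiableWithinAt
    exact (h1.deriv hV).differentiableAt (hV.mem_nhds hp)

lemma SeparatelyHolomorphicOn.swap {f : ℂ × ℂ → ℂ} {U : Set (ℂ × ℂ)}
    (hs : SeparatelyHolomorphicOn f U) :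
    SeparatelyHolomorphicOn (f ∘ Prod.swap) (Prod.swap ⁻¹' U) :=
  fun p hp => ⟨(hs p.swap hp).2, (hs p.swap hp).1⟩

/-- **Osgood's lemma**: a continuous separately holomorphic function is holomorphic. -/
lemma SeparatelyHolomorphicOn.differentiableOn {f : ℂ × ℂ → ℂ} {U : Set (ℂ × ℂ)} (hU : IsOpen U)
    (hc : ContinuousOn f U) (hs : SeparatelyHolomorphicOn f U) : DifferentiableOn ℂ f U := by
  intro p hp
  have hU' : IsOpen (Prod.swap ⁻¹' U : Set (ℂ × ℂ)) := hU.preimage continuous_swap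
  have h2 := continuousOn_deriv_snd hU hc hs
  have h1 : ContinuousOn (fun p : ℂ × ℂ => deriv (fun z => f (z, p.2)) p.1) U := by
    have := continuousOn_deriv_snd hU' (hc.comp continuous_swap.continuousOn (fun _ h => h)) hs.swap
    exact this.comp (continuous_swap.continuousOn (s := U)) (fun q hq => by simpa using hq)
  have key := hasStrictFDerivAt_uncurry_coprod (𝕜 := ℂ) (u := p) (f := fun z w => f (z, w))
    (f₁ := fun z w => ContinuousLinearMap.toSpanSingleton ℂ (deriv (fun z => f (z, w)) z))
    (f₂ := fun z w => ContinuousLinearMap.toSpanSingleton ℂ (deriv (fun w => f (z, w)) w))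
    (by filter_upwards [hU.mem_nhds hp] with v hv using (hs v hv).1.hasDerivAt.hasFDerivAt)
    (by filter_upwards [hU.mem_nhds hp] with v hv using (hs v hv).2.hasDerivAt.hasFDerivAt)
    ((ContinuousLinearMap.toSpanSingletonCLE (𝕜 := ℂ) (E := ℂ)).continuous.continuousAt.comp
      (h1.continuousAt (hU.mem_nhds hp)))
    ((ContinuousLinearMap.toSpanSingletonCLE (𝕜 := ℂ) (E := ℂ)).continuous.continuousAt.comp
      (h2.continuousAt (hU.mem_nhds hp)))
  exact key.hasFDerivAt.differentiableAt.differentiableWithinAt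

lemma differentiableOn_deriv_snd {f : ℂ × ℂ → ℂ} {U : Set (ℂ × ℂ)} (hU : IsOpen U)
    (hf : DifferentiableOn ℂ f U) :
    DifferentiableOn ℂ (fun p : ℂ × ℂ => deriv (fun w => f (p.1, w)) p.2) U :=
  have hs := hf.separatelyHolomorphicOn hU
  (hs.deriv_snd hU hf.continuousOn).differentiableOn hU
    (continuousOn_deriv_snd hU hf.continuousOn hs)

/-- Division by the first coordinate: `f(z, w) = f(0, w) + z g(z, w)`. -/
lemma exists_eq_add_fst_mul {f : ℂ × ℂ → ℂ} {r : ℝ}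
    (hf : DifferentiableOn ℂ f (ball 0 r ×ˢ ball 0 r)) :
    ∃ g : ℂ × ℂ → ℂ, DifferentiableOn ℂ g (ball 0 r ×ˢ ball 0 r) ∧
      ∀ z w, f (z, w) = f (0, w) + z * g (z, w) := by
  have hO : IsOpen (ball (0 : ℂ) r ×ˢ ball (0 : ℂ) r) := isOpen_ball.prod isOpen_ball
  have hs := hf.separatelyHolomorphicOn hO
  let g : ℂ × ℂ → ℂ := fun p => dslope (fun z => f (z, p.2)) 0 p.1
  have hg1 : ∀ w ∈ ball (0 : ℂ) r, DifferentiableOn ℂ (fun z => g (z, w)) (ball 0 r) := by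
    intro w hw
    by_cases hr : 0 < r
    · refine (Complex.differentiableOn_dslope (f := fun z => f (z, w)) (ball_mem_nhds 0 hr)).2 ?_
      exact fun z hz => (hs (z, w) ⟨hz, hw⟩).1.differentiableWithinAt
    · rw [ball_eq_empty.2 (not_lt.1 hr)]
      exact fun _ h => h.elim
  have hcauchy : ∀ ρ, 0 < ρ → ρ < r → ∀ w ∈ ball (0 : ℂ) r, ∀ z ∈ ball (0 : ℂ) ρ,
      g (z, w) = (2 * Real.pi * Complex.I : ℂ)⁻¹ •
        ∮ ζ in C(0, ρ), (ζ - z)⁻¹ • (ζ⁻¹ • (f (ζ, w) - f (0, w))) := by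
    intro ρ h0 hρ w hw z hz
    rw [← Complex.two_pi_I_inv_smul_circleIntegral_sub_inv_smul_of_differentiable_on_off_countable
      (s := ∅) (f := fun z => g (z, w)) countable_empty hz
      ((hg1 w hw).continuousOn.mono (closedBall_subset_ball hρ))
      (fun x hx => (hg1 w hw).differentiableAt (isOpen_ball.mem_nhds
        (ball_subset_ball hρ.le hx.1)))]
    congr 1
    refine circleIntegral.integral_congr h0.le fun ζ hζ => ?_
    have : ζ ≠ 0 := by
      rintro rfl
      simp at hζ
      exact h0.ne hζ
    simp only [g]
    rw [dslope_of_ne _ this, slope_def_module, sub_zero]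
  have hcont : ContinuousOn g (ball 0 r ×ˢ ball 0 r) := by
    rintro ⟨z, w⟩ ⟨hz, hw⟩
    simp only [mem_ball_zero_iff] at hz hw
    obtain ⟨ρ, h1, h2⟩ := exists_between hz
    have h0 : 0 < ρ := (norm_nonneg _).trans_lt h1
    refine ContinuousAt.continuousWithinAt ?_
    have hN : ball (0 : ℂ) ρ ×ˢ ball (0 : ℂ) r ∈ 𝓝 (z, w) :=
      prod_mem_nhds (isOpen_ball.mem_nhds (by simpa using h1))
        (isOpen_ball.mem_nhds (by simpa using hw))
    have hc1 : ContinuousOn (fun q : ℂ × ℂ =>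
        ∮ ζ in C(0, ρ), (ζ - q.1)⁻¹ • (ζ⁻¹ • (f (ζ, q.2) - f (0, q.2))))
        (ball (0 : ℂ) ρ ×ˢ ball (0 : ℂ) r) := by
      refine continuousOn_circleIntegral_param h0.le ?_
      refine ContinuousOn.fun_smul (ContinuousOn.fun_inv₀ (Continuous.continuousOn (by fun_prop))
        ?_)
        (ContinuousOn.fun_smul (ContinuousOn.fun_inv₀ (by fun_prop) ?_) (ContinuousOn.sub ?_ ?_))
      · rintro ⟨⟨a, b⟩, ζ⟩ ⟨hq, hζ⟩
        refine sub_ne_zero.2 fun h0 => ?_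
        obtain rfl : ζ = a := h0
        have := hq.1
        simp only [mem_ball_zero_iff, mem_sphere_zero_iff_norm] at this hζ
        exact this.ne hζ
      · rintro ⟨q, ζ⟩ ⟨hq, hζ⟩ h
        simp only at h
        subst h
        simp at hζ
        exact h0.ne hζ
      · refine hf.continuousOn.comp (by fun_prop) ?_
        rintro ⟨q, ζ⟩ ⟨hq, hζ⟩
        exact ⟨by simp only [mem_sphere_zero_iff_norm] at hζ; simpa [hζ] using h2, hq.2⟩
      · refine hf.continuousOn.comp (by fun_prop) ?_
        rintro ⟨q, ζ⟩ ⟨hq, hζ⟩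
        exact ⟨mem_ball_self (h0.trans h2), hq.2⟩
    refine ContinuousAt.congr ((hc1.const_smul (2 * Real.pi * Complex.I : ℂ)⁻¹).continuousAt hN) ?_
    filter_upwards [hN] with q hq
    exact (hcauchy ρ h0 h2 q.2 hq.2 q.1 hq.1).symm
  refine ⟨g, SeparatelyHolomorphicOn.differentiableOn hO hcont ?_, fun z w => ?_⟩
  · rintro ⟨z, w⟩ ⟨hz, hw⟩
    refine ⟨(hg1 w hw).differentiableAt (isOpen_ball.mem_nhds hz), ?_⟩
    have h0 : (0 : ℂ) ∈ ball (0 : ℂ) r :=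
      mem_ball_self ((norm_nonneg _).trans_lt (mem_ball_zero_iff.1 hz))
    by_cases hz0 : z = 0
    · subst hz0
      have h3 := ((hs.swap.deriv_snd (hO.preimage continuous_swap)
        (hf.continuousOn.comp continuous_swap.continuousOn (fun _ h => h))) (w, 0) ⟨hz, hw⟩).1
      simpa only [g, dslope_same, Function.comp_apply, Prod.swap_prod_mk] using h3
    · simp only [g]
      simp only [dslope_of_ne _ hz0, slope_def_module]
      exact ((hs (z, w) ⟨hz, hw⟩).2.fun_sub (hs (0, w) ⟨h0, hw⟩).2).fun_const_smul _
  · have := sub_smul_dslope (fun z => f (z, w)) 0 z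
    simp only [sub_zero, smul_eq_mul] at this
    simp only [g, this]
    ring

end TwoVariables

end PlaneCurve

namespace PlaneCurve

/-! ### Zeros of a holomorphic function depending on a parameter -/

section Zeros

open Set Filter Topology Metric

/-- A zero of a holomorphic function splits off with its multiplicity, with a cofactor holomorphic
on the whole domain. -/
lemma exists_eq_pow_mul {g : ℂ → ℂ} {V : Set ℂ} (hV : IsOpen V) (hg : DifferentiableOn ℂ g V)
    {a : ℂ} (ha : a ∈ V) (hne : ¬ ∀ᶠ w in 𝓝 a, g w = 0) :
    ∃ (n : ℕ) (h : ℂ → ℂ), DifferentiableOn ℂ h V ∧ h a ≠ 0 ∧ ∀ w ∈ V, g w = (w - a) ^ n * h w := by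
  have han : AnalyticAt ℂ g a := hg.analyticAt (hV.mem_nhds ha)
  obtain ⟨n, h₀, hh₀, h0ne, heq⟩ := (han.exists_eventuallyEq_pow_smul_nonzero_iff).2 hne
  have heq' : ∀ᶠ w in 𝓝 a, Function.update (fun w => g w / (w - a) ^ n) a (h₀ a) w = h₀ w := by
    filter_upwards [heq] with w hw
    by_cases h : w = a
    · subst h; simp
    · rw [Function.update_of_ne h, hw, smul_eq_mul, mul_div_cancel_left₀]
      exact pow_ne_zero _ (sub_ne_zero.2 h)
  refine ⟨n, Function.update (fun w => g w / (w - a) ^ n) a (h₀ a), ?_, by simpa using h0ne, ?_⟩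
  · intro w hw
    by_cases h : w = a
    · subst h
      exact (hh₀.differentiableAt.congr_of_eventuallyEq heq').differentiableWithinAt
    · have h1 : DifferentiableAt ℂ (fun w => g w / (w - a) ^ n) w :=
        (hg.differentiableAt (hV.mem_nhds hw)).fun_div (by fun_prop)
          (pow_ne_zero _ (sub_ne_zero.2 h))
      refine (h1.congr_of_eventuallyEq ?_).differentiableWithinAt
      filter_upwards [isOpen_ne.mem_nhds h] with v hv
      exact Function.update_of_ne hv _ _
  · intro w hw
    by_cases h : w = a
    · subst h
      simpa using heq.self_of_nhds
    · rw [Function.update_of_ne h, mul_div_cancel₀]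
      exact pow_ne_zero _ (sub_ne_zero.2 h)

/-- All zeros in a closed disc split off, one after the other, by induction on their number. -/
lemma exists_eq_prod_mul_of_zeros {V : Set ℂ} (hV : IsOpen V) {c : ℂ} {ρ : ℝ}
    (hsub : closedBall c ρ ⊆ V) (Z : Finset ℂ) : ∀ g : ℂ → ℂ, DifferentiableOn ℂ g V →
    (∀ w ∈ closedBall c ρ, g w = 0 ↔ w ∈ Z) → (∀ w ∈ closedBall c ρ, ¬ ∀ᶠ v in 𝓝 w, g v = 0) →
    (∀ w ∈ Z, w ∈ closedBall c ρ) →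
    ∃ (s : Multiset ℂ) (h : ℂ → ℂ), DifferentiableOn ℂ h V ∧ (∀ w ∈ closedBall c ρ, h w ≠ 0) ∧
      (∀ a ∈ s, a ∈ Z) ∧ ∀ w ∈ V, g w = (s.map (w - ·)).prod * h w := by
  classical
  induction Z using Finset.induction_on with
  | empty =>
    intro g hg hz _ _
    exact ⟨0, g, hg, fun w hw h => by simpa using (hz w hw).1 h, by simp, by simp⟩
  | insert a Z haZ ih =>
    intro g hg hz hne hsubZ
    have hac : a ∈ closedBall c ρ := hsubZ a (Finset.mem_insert_self _ _)
    obtain ⟨n, h, hh, hha, heq⟩ := exists_eq_pow_mul hV hg (hsub hac) (hne a hac)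
    obtain ⟨s, k, hk, hk0, hs, hsk⟩ := ih h hh (fun w hw => by
        by_cases hwa : w = a
        · subst hwa; simp [hha, haZ]
        · have := hz w hw
          rw [heq w (hsub hw), mul_eq_zero, Finset.mem_insert] at this
          simp only [pow_eq_zero_iff', sub_eq_zero, hwa, false_and, false_or] at this
          exact this)
      (fun w hw hev => hne w hw (by
        filter_upwards [hev, hV.mem_nhds (hsub hw)] with v hv hvV
        rw [heq v hvV, hv, mul_zero]))
      (fun w hw => hsubZ w (Finset.mem_insert_of_mem hw))
    refine ⟨Multiset.replicate n a + s, k, hk, hk0, ?_, fun w hw => ?_⟩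
    · intro b hb
      rcases Multiset.mem_add.1 hb with hb | hb
      · rw [Multiset.eq_of_mem_replicate hb]; exact Finset.mem_insert_self _ _
      · exact Finset.mem_insert_of_mem (hs b hb)
    · rw [heq w hw, hsk w hw]
      simp [mul_assoc]

/-- A holomorphic function without zeros on a circle has finitely many zeros inside, which can be
split off with their multiplicities. -/
lemma exists_eq_prod_mul {V : Set ℂ} (hV : IsOpen V) {c : ℂ} {ρ : ℝ} (hρ : 0 < ρ)
    (hsub : closedBall c ρ ⊆ V) {g : ℂ → ℂ} (hg : DifferentiableOn ℂ g V)
    (hne : ∀ w ∈ sphere c ρ, g w ≠ 0) :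
    ∃ (s : Multiset ℂ) (h : ℂ → ℂ), DifferentiableOn ℂ h V ∧ (∀ w ∈ closedBall c ρ, h w ≠ 0) ∧
      (∀ a, a ∈ s ↔ a ∈ ball c ρ ∧ g a = 0) ∧ ∀ w ∈ V, g w = (s.map (w - ·)).prod * h w := by
  have han : AnalyticOnNhd ℂ g (closedBall c ρ) := fun w hw => hg.analyticAt (hV.mem_nhds (hsub hw))
  have hloc : ∀ w ∈ closedBall c ρ, ¬ ∀ᶠ v in 𝓝 w, g v = 0 := by
    intro w hw hev
    obtain ⟨x, hx⟩ : (sphere c ρ).Nonempty := NormedSpace.sphere_nonempty.2 hρ.le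
    exact hne x hx (han.eqOn_zero_of_preconnected_of_eventuallyEq_zero
      (convex_closedBall c ρ).isPreconnected hw hev (sphere_subset_closedBall hx))
  have hfin : (closedBall c ρ ∩ g ⁻¹' {0}).Finite := by
    by_contra hinf
    obtain ⟨x, hx, hacc⟩ := Set.Infinite.exists_accPt_of_subset_isCompact hinf
      (isCompact_closedBall c ρ) inter_subset_left
    rcases (han x hx).eventually_eq_zero_or_eventually_ne_zero with h | h
    · exact hloc x hx h
    · rw [accPt_iff_frequently_nhdsNE] at hacc
      exact hacc (h.mono fun y hy hy' => hy hy'.2)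
  obtain ⟨s, h, hh, hh0, hs, heq⟩ := exists_eq_prod_mul_of_zeros hV hsub hfin.toFinset g hg
    (fun w hw => by simp [mem_closedBall.1 hw]) hloc
    (fun w hw => by simp at hw; exact mem_closedBall.2 hw.1)
  refine ⟨s, h, hh, hh0, fun a => ⟨fun ha => ?_, fun ha => ?_⟩, heq⟩
  · have := hs a ha
    simp at this
    refine ⟨lt_of_le_of_ne this.1 fun h => hne a (mem_sphere.2 h) this.2, this.2⟩
  · have hac := ball_subset_closedBall ha.1
    have := heq a (hsub hac)
    rw [ha.2, eq_comm, mul_eq_zero] at this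
    rcases this with h1 | h1
    · rw [Multiset.prod_eq_zero_iff, Multiset.mem_map] at h1
      obtain ⟨b, hb, hb0⟩ := h1
      rwa [sub_eq_zero.1 hb0]
    · exact absurd h1 (hh0 a hac)

/-- The argument principle weighted with `w ^ k`: the logarithmic derivative computes the `k`-th
power sum of the zeros, counted with multiplicity. -/
lemma circleIntegral_pow_mul_logDeriv {V : Set ℂ} (hV : IsOpen V) {c : ℂ} {ρ : ℝ} (hρ : 0 < ρ)
    (hsub : closedBall c ρ ⊆ V) {h : ℂ → ℂ} (hh : DifferentiableOn ℂ h V)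
    (hh0 : ∀ w ∈ closedBall c ρ, h w ≠ 0) (k : ℕ) (s : Multiset ℂ) : ∀ g : ℂ → ℂ,
    (∀ a ∈ s, a ∈ ball c ρ) → (∀ w ∈ V, g w = (s.map (w - ·)).prod * h w) →
    (∮ w in C(c, ρ), w ^ k * (deriv g w / g w)) =
      (2 * Real.pi * Complex.I) * (s.map (· ^ k)).sum := by
  have hsp : ∀ w ∈ sphere c ρ, w ∈ V := fun w hw => hsub (sphere_subset_closedBall hw)
  induction s using Multiset.induction_on with
  | empty =>
    intro g _ hg
    have hgh : EqOn g h V := fun w hw => by simpa using hg w hw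
    have h1 : (∮ w in C(c, ρ), w ^ k * (deriv g w / g w)) =
        ∮ w in C(c, ρ), w ^ k * (deriv h w / h w) := by
      refine circleIntegral.integral_congr hρ.le fun w hw => ?_
      have : deriv g w = deriv h w :=
        (Filter.eventuallyEq_of_mem (hV.mem_nhds (hsp w hw)) hgh).deriv_eq
      simp only [this, hgh (hsp w hw)]
    rw [h1]
    simp only [Multiset.map_zero, Multiset.sum_zero, mul_zero]
    have hd := hh.deriv hV
    refine Complex.circleIntegral_eq_zero_of_differentiable_on_off_countable hρ.le countable_empty
      ?_ ?_
    · exact ContinuousOn.mul (by fun_prop) ((hd.continuousOn.mono hsub).div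
        (hh.continuousOn.mono hsub) hh0)
    · intro w hw
      have hw' := hsub (ball_subset_closedBall hw.1)
      exact DifferentiableAt.mul (by fun_prop) ((hd.differentiableAt (hV.mem_nhds hw')).fun_div
        (hh.differentiableAt (hV.mem_nhds hw')) (hh0 w (ball_subset_closedBall hw.1)))
  | cons a s ih =>
    intro g hs hg
    have ha := hs a (Multiset.mem_cons_self a s)
    let g₁ : ℂ → ℂ := fun w => (s.map (w - ·)).prod * h w
    have hg₁ : DifferentiableOn ℂ g₁ V := by
      refine DifferentiableOn.mul (Differentiable.differentiableOn ?_) hh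
      clear hs ih hg
      induction s using Multiset.induction_on with
      | empty => simp
      | cons b s ih => simp only [Multiset.map_cons, Multiset.prod_cons]; fun_prop
    have ih' := ih g₁ (fun b hb => hs b (Multiset.mem_cons_of_mem hb)) (fun w _ => rfl)
    have hg₁0 : ∀ w ∈ sphere c ρ, g₁ w ≠ 0 := by
      intro w hw
      refine mul_ne_zero ?_ (hh0 w (sphere_subset_closedBall hw))
      rw [Ne, Multiset.prod_eq_zero_iff, Multiset.mem_map]
      rintro ⟨b, hb, hb0⟩
      have := hs b (Multiset.mem_cons_of_mem hb)
      rw [← sub_eq_zero.1 hb0, mem_ball] at this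
      exact this.ne (mem_sphere.1 hw)
    have hwa : ∀ w ∈ sphere c ρ, w - a ≠ 0 := by
      intro w hw h0
      rw [← sub_eq_zero.1 h0, mem_ball] at ha
      exact ha.ne (mem_sphere.1 hw)
    have hgg : EqOn g (fun w => (w - a) * g₁ w) V := fun w hw => by
      rw [hg w hw]; simp [g₁, mul_assoc]
    have h1 : (∮ w in C(c, ρ), w ^ k * (deriv g w / g w)) =
        ∮ w in C(c, ρ), (w ^ k / (w - a) + w ^ k * (deriv g₁ w / g₁ w)) := by
      refine circleIntegral.integral_congr hρ.le fun w hw => ?_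
      have h2 : deriv g w = deriv (fun w => (w - a) * g₁ w) w :=
        (Filter.eventuallyEq_of_mem (hV.mem_nhds (hsp w hw)) hgg).deriv_eq
      have h3 : deriv (fun w => (w - a) * g₁ w) w = g₁ w + (w - a) * deriv g₁ w := by
        rw [deriv_fun_mul (by fun_prop) (hg₁.differentiableAt (hV.mem_nhds (hsp w hw)))]
        simp
      simp only [h2, h3, hgg (hsp w hw)]
      field_simp [hwa w hw, hg₁0 w hw]
    rw [h1, circleIntegral.integral_add, ih',
      Complex.circleIntegral_div_sub_of_differentiable_on_off_countable
      countable_empty ha (f := fun w => w ^ k) (by fun_prop) (fun _ _ => by fun_prop)]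
    · simp [mul_add]
    · refine ContinuousOn.circleIntegrable hρ.le (ContinuousOn.div (by fun_prop) (by fun_prop) hwa)
    · refine ContinuousOn.circleIntegrable hρ.le (ContinuousOn.mul (by fun_prop)
        (ContinuousOn.div ?_ ?_ hg₁0))
      · exact (hg₁.deriv hV).continuousOn.mono hsp
      · exact hg₁.continuousOn.mono hsp

/-- The contour integral computing the sum of the `k`-th powers of the zeros of `f(z, ·)` inside the
circle of centre `c` and radius `ρ`. -/
noncomputable def powerSum (f : ℂ × ℂ → ℂ) (c : ℂ) (ρ : ℝ) (k : ℕ) (z : ℂ) : ℂ :=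
  (2 * Real.pi * Complex.I : ℂ)⁻¹ *
    ∮ w in C(c, ρ), w ^ k * (deriv (fun w => f (z, w)) w / f (z, w))

/-- `f` is holomorphic near `D × closedBall c ρ` and has no zero on `D × sphere c ρ`. -/
structure ZeroFree (f : ℂ × ℂ → ℂ) (U : Set (ℂ × ℂ)) (D : Set ℂ) (c : ℂ) (ρ : ℝ) : Prop where
  isOpen_U : IsOpen U
  isOpen_D : IsOpen D
  pos : 0 < ρ
  diff : DifferentiableOn ℂ f U
  subset : D ×ˢ closedBall c ρ ⊆ U
  ne_zero : ∀ z ∈ D, ∀ w ∈ sphere c ρ, f (z, w) ≠ 0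

namespace ZeroFree

variable {f : ℂ × ℂ → ℂ} {U : Set (ℂ × ℂ)} {D : Set ℂ} {c : ℂ} {ρ : ℝ}

lemma mono (h : ZeroFree f U D c ρ) {D' : Set ℂ} (hD' : IsOpen D') (hsub : D' ⊆ D) :
    ZeroFree f U D' c ρ :=
  ⟨h.isOpen_U, hD', h.pos, h.diff, (prod_mono_left hsub).trans h.subset,
    fun z hz => h.ne_zero z (hsub hz)⟩

lemma exists_multiset (h : ZeroFree f U D c ρ) {z : ℂ} (hz : z ∈ D) :
    ∃ s : Multiset ℂ, (∀ a, a ∈ s ↔ a ∈ ball c ρ ∧ f (z, a) = 0) ∧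
      ∀ k, powerSum f c ρ k z = (s.map (· ^ k)).sum := by
  have hV : IsOpen {w | (z, w) ∈ U} := h.isOpen_U.preimage (by fun_prop)
  have hsub : closedBall c ρ ⊆ {w | (z, w) ∈ U} := fun w hw => h.subset ⟨hz, hw⟩
  have hg : DifferentiableOn ℂ (fun w => f (z, w)) {w | (z, w) ∈ U} :=
    fun w hw => ((h.diff.separatelyHolomorphicOn h.isOpen_U) (z, w) hw).2.differentiableWithinAt
  obtain ⟨s, k, hk, hk0, hs, heq⟩ := exists_eq_prod_mul hV h.pos hsub hg (h.ne_zero z hz)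
  refine ⟨s, hs, fun m => ?_⟩
  rw [powerSum, circleIntegral_pow_mul_logDeriv hV h.pos hsub hk hk0 m s (fun w => f (z, w))
    (fun a ha => ((hs a).1 ha).1) heq, ← mul_assoc, inv_mul_cancel₀ Complex.two_pi_I_ne_zero,
    one_mul]

lemma differentiableOn_powerSum (h : ZeroFree f U D c ρ) (k : ℕ) :
    DifferentiableOn ℂ (powerSum f c ρ k) D := by
  have hd := differentiableOn_deriv_snd h.isOpen_U h.diff
  have hs := h.diff.separatelyHolomorphicOn h.isOpen_U
  have hds := hd.separatelyHolomorphicOn h.isOpen_U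
  have hsub : D ×ˢ sphere c ρ ⊆ U := (prod_mono_right sphere_subset_closedBall).trans h.subset
  refine DifferentiableOn.const_mul (differentiableOn_circleIntegral_param h.isOpen_D h.pos.le
    (F := fun z w => w ^ k * (deriv (fun w => f (z, w)) w / f (z, w))) ?_ ?_) _
  · refine ContinuousOn.mul (by fun_prop) (ContinuousOn.div (hd.continuousOn.mono hsub)
      (h.diff.continuousOn.mono hsub) fun p hp => h.ne_zero p.1 hp.1 p.2 hp.2)
  · intro w hw z hz
    have hm : (z, w) ∈ U := hsub ⟨hz, hw⟩
    exact (((hds _ hm).1.fun_div (hs _ hm).1 (h.ne_zero z hz w hw)).const_mul _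
      ).differentiableWithinAt

/-- The number of zeros, counted with multiplicity, is locally constant. -/
lemma eventually_powerSum_zero_eq (h : ZeroFree f U D c ρ) {z₀ : ℂ} (hz₀ : z₀ ∈ D) :
    ∀ᶠ z in 𝓝 z₀, powerSum f c ρ 0 z = powerSum f c ρ 0 z₀ := by
  have hc : ContinuousAt (powerSum f c ρ 0) z₀ :=
    (h.differentiableOn_powerSum 0).continuousOn.continuousAt (h.isOpen_D.mem_nhds hz₀)
  obtain ⟨s₀, -, hs₀⟩ := h.exists_multiset hz₀
  filter_upwards [h.isOpen_D.mem_nhds hz₀, hc (ball_mem_nhds _ one_pos)] with z hz hz1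
  obtain ⟨s, -, hs⟩ := h.exists_multiset hz
  simp only [mem_preimage, hs, hs₀, pow_zero, Multiset.map_const', Multiset.sum_replicate,
    mem_ball, dist_eq_norm, nsmul_eq_mul, mul_one] at hz1 ⊢
  have h2 : ‖(((Multiset.card s : ℤ) - (Multiset.card s₀ : ℤ) : ℤ) : ℂ)‖ < 1 := by
    push_cast; exact hz1
  rw [Complex.norm_intCast] at h2
  have h3 : |((Multiset.card s : ℤ) - (Multiset.card s₀ : ℤ))| < 1 := by exact_mod_cast h2
  have h4 := Int.abs_lt_one_iff.1 h3
  have : (Multiset.card s) = Multiset.card s₀ := by lia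
  rw [this]

/-- The set of zeros of `f(z, ·)` inside the circle. -/
def zeros (f : ℂ × ℂ → ℂ) (c : ℂ) (ρ : ℝ) (z : ℂ) : Set ℂ := {w ∈ ball c ρ | f (z, w) = 0}

lemma finite_zeros (h : ZeroFree f U D c ρ) {z : ℂ} (hz : z ∈ D) : (zeros f c ρ z).Finite := by
  classical
  obtain ⟨s, hs, -⟩ := h.exists_multiset hz
  refine s.toFinset.finite_toSet.subset fun a ha => ?_
  simpa using (hs a).2 ha

lemma ncard_zeros_le (h : ZeroFree f U D c ρ) {z : ℂ} (hz : z ∈ D) :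
    ((zeros f c ρ z).ncard : ℝ) ≤ ‖powerSum f c ρ 0 z‖ := by
  classical
  obtain ⟨s, hs, hk⟩ := h.exists_multiset hz
  have : zeros f c ρ z = (s.toFinset : Set ℂ) := by
    ext a; simpa [zeros] using (hs a).symm
  rw [this, Set.ncard_coe_finset, hk]
  simpa using s.toFinset_card_le

lemma zeros_nonempty_iff (h : ZeroFree f U D c ρ) {z : ℂ} (hz : z ∈ D) :
    (zeros f c ρ z).Nonempty ↔ powerSum f c ρ 0 z ≠ 0 := by
  obtain ⟨s, hs, hk⟩ := h.exists_multiset hz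
  simp only [hk, pow_zero, Multiset.map_const', Multiset.sum_replicate, nsmul_eq_mul, mul_one,
    Ne, Nat.cast_eq_zero, Multiset.card_eq_zero]
  constructor
  · rintro ⟨a, ha⟩ rfl
    simpa using (hs a).2 ha
  · intro hne
    obtain ⟨a, ha⟩ := Multiset.exists_mem_of_ne_zero hne
    exact ⟨a, (hs a).1 ha⟩

end ZeroFree

end Zeros

end PlaneCurve

namespace PlaneCurve

/-! ### Counting zeros and splitting them into sheets -/

section Sheets

open Set Filter Topology Metric

/-- The Hankel matrix of power sums is `Aᵀ D A`, where `A` is the Vandermonde matrix of the distinct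
points and `D` the diagonal matrix of their multiplicities, so its size is at most the number of
distinct points if it is invertible. -/
lemma det_hankel_ne_zero_iff_of_le (s : Multiset ℂ) {n : ℕ} (hn : s.toFinset.card ≤ n) :
    (Matrix.of fun i j : Fin n => (s.map (· ^ (i + j : ℕ))).sum).det ≠ 0 ↔
      s.toFinset.card = n := by
  classical
  let A : Matrix s.toFinset (Fin n) ℂ := Matrix.of fun a i => (a : ℂ) ^ (i : ℕ)
  let d : s.toFinset → ℂ := fun a => (s.count (a : ℂ) : ℂ)
  have hH : (Matrix.of fun i j : Fin n => (s.map (· ^ (i + j : ℕ))).sum) =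
      A.transpose * (Matrix.diagonal d * A) := by
    ext i j
    rw [Matrix.mul_apply]
    simp only [Matrix.of_apply, Matrix.transpose_apply, Matrix.diagonal_mul, A, d]
    rw [Finset.sum_multiset_map_count, ← Finset.sum_coe_sort]
    refine Finset.sum_congr rfl fun a _ => ?_
    rw [nsmul_eq_mul, pow_add]; ring
  constructor
  · intro h
    refine le_antisymm hn ?_
    have h1 := Matrix.rank_of_isUnit _ ((Matrix.isUnit_iff_isUnit_det _).2 (isUnit_iff_ne_zero.2 h))
    rw [hH] at h1
    have h2 := (Matrix.rank_mul_le_left A.transpose (Matrix.diagonal d * A)).trans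
      (Matrix.rank_le_card_width A.transpose)
    rw [h1] at h2
    simpa only [Fintype.card_coe, Fintype.card_fin] using h2
  · intro h
    let e : Fin n ≃ s.toFinset := (Fintype.equivFinOfCardEq (by rw [Fintype.card_coe, h])).symm
    have h1 : (A.submatrix e id).det ≠ 0 := by
      have : A.submatrix e id = Matrix.vandermonde (fun i => ((e i : s.toFinset) : ℂ)) := by
        ext i j; rfl
      rw [this, Matrix.det_vandermonde_ne_zero_iff]
      exact Subtype.val_injective.comp e.injective
    have h2 : A.transpose * (Matrix.diagonal d * A) =
        (A.submatrix e id).transpose * (Matrix.diagonal (d ∘ e) * A.submatrix e id) := by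
      ext i j
      rw [Matrix.mul_apply, Matrix.mul_apply]
      simp only [Matrix.transpose_apply, Matrix.diagonal_mul,
        Matrix.submatrix_apply, id, Function.comp_apply]
      exact (e.sum_comp (fun a => A a i * (d a * A a j))).symm
    rw [hH, h2, Matrix.det_mul, Matrix.det_mul, Matrix.det_transpose, Matrix.det_diagonal]
    refine mul_ne_zero h1 (mul_ne_zero (Finset.prod_ne_zero_iff.2 fun i _ => ?_) h1)
    simp only [Function.comp_apply, d, ne_eq, Nat.cast_eq_zero, Multiset.count_eq_zero, not_not]
    exact Multiset.mem_toFinset.1 (e i).2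

namespace ZeroFree

variable {f : ℂ × ℂ → ℂ} {U : Set (ℂ × ℂ)} {D : Set ℂ} {c : ℂ} {ρ : ℝ}

/-- The Hankel determinant of the power sums of the zeros of `f(z, ·)`. By the Cauchy–Binet formula
it is the sum of the squared Vandermonde determinants of the `n`-tuples of zeros; so it detects,
without any reducedness of `f`, whether there are `n` distinct zeros. -/
noncomputable def hankelDet (f : ℂ × ℂ → ℂ) (c : ℂ) (ρ : ℝ) (n : ℕ) (z : ℂ) : ℂ :=
  (Matrix.of fun i j : Fin n => powerSum f c ρ (i + j) z).det

lemma differentiableOn_hankelDet (h : ZeroFree f U D c ρ) (n : ℕ) :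
    DifferentiableOn ℂ (hankelDet f c ρ n) D := by
  have : hankelDet f c ρ n = fun z => ∑ σ : Equiv.Perm (Fin n), ((Equiv.Perm.sign σ : ℤ) : ℂ) *
      ∏ i, powerSum f c ρ ((σ i : ℕ) + i) z := by
    ext z; rw [hankelDet, Matrix.det_apply']; rfl
  rw [this]
  refine DifferentiableOn.fun_sum fun σ _ => DifferentiableOn.const_mul ?_ _
  exact DifferentiableOn.fun_finsetProd fun i _ => h.differentiableOn_powerSum _

lemma hankelDet_ne_zero_iff (h : ZeroFree f U D c ρ) {z : ℂ} (hz : z ∈ D) {n : ℕ}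
    (hn : (zeros f c ρ z).ncard ≤ n) :
    hankelDet f c ρ n z ≠ 0 ↔ (zeros f c ρ z).ncard = n := by
  classical
  obtain ⟨s, hs, hk⟩ := h.exists_multiset hz
  have : zeros f c ρ z = (s.toFinset : Set ℂ) := by
    ext a; simpa [zeros] using (hs a).symm
  rw [this, Set.ncard_coe_finset] at hn ⊢
  rw [← det_hankel_ne_zero_iff_of_le s hn, hankelDet]
  simp only [hk]

/-- Sufficiently near a parameter, the function still has no zeros on the circle. -/
lemma of_sphere (hU : IsOpen U) (hf : DifferentiableOn ℂ f U) {z₀ : ℂ} (hρ : 0 < ρ)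
    (hsub : ∀ w ∈ closedBall c ρ, (z₀, w) ∈ U) (hne : ∀ w ∈ sphere c ρ, f (z₀, w) ≠ 0) :
    ∃ δ > 0, ZeroFree f U (ball z₀ δ) c ρ := by
  have h1 : ∀ᶠ z in 𝓝 z₀, ∀ w ∈ closedBall c ρ, (z, w) ∈ U := by
    refine (isCompact_closedBall c ρ).eventually_forall_of_forall_eventually fun w hw => ?_
    exact hU.mem_nhds (hsub w hw)
  have h2 : ∀ᶠ z in 𝓝 z₀, ∀ w ∈ sphere c ρ, f (z, w) ≠ 0 := by
    refine (isCompact_sphere c ρ).eventually_forall_of_forall_eventually fun w hw => ?_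
    have hc : ContinuousAt f (z₀, w) :=
      hf.continuousOn.continuousAt (hU.mem_nhds (hsub w (sphere_subset_closedBall hw)))
    exact hc.eventually_ne (hne w hw)
  obtain ⟨δ, hδ, h⟩ := Metric.eventually_nhds_iff_ball.1 (h1.and h2)
  exact ⟨δ, hδ, hU, isOpen_ball, hρ, hf, fun p hp => (h p.1 hp.1).1 p.2 hp.2,
    fun z hz w hw => (h z hz).2 w hw⟩

/-- Where the number of distinct zeros is locally constant, the zeros are holomorphic functions of
the parameter. -/
lemma exists_sheets (h : ZeroFree f U D c ρ) {z₀ : ℂ} (hz₀ : z₀ ∈ D) {n : ℕ}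
    (hn : ∀ᶠ z in 𝓝 z₀, (zeros f c ρ z).ncard = n) :
    ∃ ε > 0, ball z₀ ε ⊆ D ∧ ∃ b : Fin n → ℂ → ℂ,
      (∀ j, DifferentiableOn ℂ (b j) (ball z₀ ε)) ∧
      ∀ z ∈ ball z₀ ε, Function.Injective (b · z) ∧ zeros f c ρ z = range (b · z) := by
  classical
  -- enumerate the zeros at `z₀` and separate them by small discs
  have hfin := h.finite_zeros hz₀
  have hcard : (zeros f c ρ z₀).ncard = n := hn.self_of_nhds
  have hft : Fintype (zeros f c ρ z₀) := hfin.fintype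
  let e : Fin n ≃ zeros f c ρ z₀ := (Fintype.equivFinOfCardEq (by
    rw [← hcard, ← Nat.card_coe_set_eq, Nat.card_eq_fintype_card])).symm
  let a : Fin n → ℂ := fun j => (e j : ℂ)
  have ha_inj : Function.Injective a := Subtype.val_injective.comp e.injective
  have ha : ∀ j, a j ∈ ball c ρ ∧ f (z₀, a j) = 0 := fun j => (e j).2
  have hsep : ∃ η > 0, (∀ j, closedBall (a j) η ⊆ ball c ρ) ∧
      ∀ i j, i ≠ j → Disjoint (closedBall (a i) η) (closedBall (a j) η) := by
    have h1 : ∀ j, ∀ᶠ η in 𝓝[>] (0 : ℝ), closedBall (a j) η ⊆ ball c ρ := by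
      intro j
      obtain ⟨δ, hδ, hsub⟩ := Metric.isOpen_iff.1 isOpen_ball (a j) (ha j).1
      filter_upwards [Ioo_mem_nhdsGT hδ] with η hη
      exact (closedBall_subset_ball hη.2).trans hsub
    have h2 : ∀ i j, i ≠ j → ∀ᶠ η in 𝓝[>] (0 : ℝ),
        Disjoint (closedBall (a i) η) (closedBall (a j) η) := by
      intro i j hij
      have hd : 0 < dist (a i) (a j) := dist_pos.2 (ha_inj.ne hij)
      filter_upwards [Ioo_mem_nhdsGT (half_pos hd)] with η hη
      exact closedBall_disjoint_closedBall (by linarith [hη.2])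
    obtain ⟨η, ⟨hη1, hη2⟩, hη3⟩ := (((eventually_all.2 h1).and (eventually_all.2 fun i =>
      eventually_all.2 fun j => eventually_imp_distrib_left.2 (h2 i j))).and
        self_mem_nhdsWithin).exists
    exact ⟨η, hη3, hη1, hη2⟩
  obtain ⟨η, hη, hηsub, hηdisj⟩ := hsep
  have hsphere : ∀ j, ∀ w ∈ sphere (a j) η, f (z₀, w) ≠ 0 := by
    intro j w hw h0
    have hwz : w ∈ zeros f c ρ z₀ := ⟨hηsub j (sphere_subset_closedBall hw), h0⟩
    obtain ⟨i, hi⟩ := e.surjective ⟨w, hwz⟩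
    have hai : a i = w := congrArg Subtype.val hi
    by_cases hij : i = j
    · subst hij
      rw [← hai] at hw
      simp at hw
      exact hη.ne hw
    · exact Set.disjoint_left.1 (hηdisj i j hij) (hai ▸ mem_closedBall_self hη.le)
        (sphere_subset_closedBall hw)
  have hloc : ∀ j, ∃ δ > 0, ZeroFree f U (ball z₀ δ) (a j) η := fun j =>
    of_sphere h.isOpen_U h.diff hη
      (fun w hw => h.subset ⟨hz₀, ball_subset_closedBall (hηsub j hw)⟩) (hsphere j)
  choose δ hδ hZ using hloc
  have hcount : ∀ j, ∀ᶠ z in 𝓝 z₀, (zeros f (a j) η z).Nonempty := by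
    intro j
    filter_upwards [(hZ j).eventually_powerSum_zero_eq (mem_ball_self (hδ j)),
      ball_mem_nhds z₀ (hδ j)] with z hz hzb
    rw [(hZ j).zeros_nonempty_iff hzb, hz, ← (hZ j).zeros_nonempty_iff (mem_ball_self (hδ j))]
    exact ⟨a j, mem_ball_self hη, (ha j).2⟩
  obtain ⟨ε, hε, hev⟩ := Metric.eventually_nhds_iff_ball.1
    (((eventually_all.2 hcount).and hn).and (Filter.Eventually.and (h.isOpen_D.mem_nhds hz₀)
      (eventually_all.2 fun j => ball_mem_nhds z₀ (hδ j))))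
  -- a function picking one zero in each small disc is injective, hence exhausts the zeros
  have hpick : ∀ z ∈ ball z₀ ε, ∀ x : Fin n → ℂ, (∀ j, x j ∈ zeros f (a j) η z) →
      Function.Injective x ∧ zeros f c ρ z = range x := by
    intro z hz x hx
    have hinj : Function.Injective x := by
      intro i j hij
      by_contra hne
      exact Set.disjoint_left.1 (hηdisj i j hne) (ball_subset_closedBall (hx i).1)
        (hij ▸ ball_subset_closedBall (hx j).1)
    refine ⟨hinj, ?_⟩
    symm
    refine Set.eq_of_subset_of_ncard_le ?_ ?_ (h.finite_zeros (hev z hz).2.1)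
    · rintro _ ⟨j, rfl⟩
      exact ⟨hηsub j (ball_subset_closedBall (hx j).1), (hx j).2⟩
    · rw [(hev z hz).1.2, ← Set.image_univ, Set.ncard_image_of_injective _ hinj, Set.ncard_univ]
      simp
  have hmem : ∀ z ∈ ball z₀ ε, ∀ j,
      powerSum f (a j) η 1 z / powerSum f (a j) η 0 z ∈ zeros f (a j) η z := by
    intro z hz j
    choose x hx using fun j => (hev z hz).1.1 j
    obtain ⟨s, hs, hk⟩ := (hZ j).exists_multiset ((hev z hz).2.2 j)
    have huniq : ∀ y ∈ zeros f (a j) η z, y = x j := by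
      intro y hy
      have h1 := hpick z hz x hx
      have hy' : y ∈ zeros f c ρ z := ⟨hηsub j (ball_subset_closedBall hy.1), hy.2⟩
      rw [h1.2] at hy'
      obtain ⟨i, hi⟩ := hy'
      by_cases hij : i = j
      · rw [← hi, hij]
      · exact absurd (ball_subset_closedBall hy.1) (Set.disjoint_left.1 (hηdisj i j hij)
          (hi ▸ ball_subset_closedBall (hx i).1))
    have hsrep : s = Multiset.replicate (Multiset.card s) (x j) :=
      Multiset.eq_replicate_card.2 fun b hb => huniq b ((hs b).1 hb)
    have hspos : (Multiset.card s : ℂ) ≠ 0 := by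
      have : x j ∈ s := (hs _).2 (hx j)
      rw [Nat.cast_ne_zero, Ne, Multiset.card_eq_zero]
      rintro rfl
      simp at this
    have : powerSum f (a j) η 1 z / powerSum f (a j) η 0 z = x j := by
      rw [hk, hk]
      generalize Multiset.card s = m at *
      rw [hsrep]
      simp [hspos]
    rw [this]
    exact hx j
  refine ⟨ε, hε, fun z hz => (hev z hz).2.1,
    fun j z => powerSum f (a j) η 1 z / powerSum f (a j) η 0 z,
    fun j => ?_, fun z hz => hpick z hz _ (hmem z hz)⟩
  have hsub : ball z₀ ε ⊆ ball z₀ (δ j) := fun z hz => (hev z hz).2.2 j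
  refine (((hZ j).differentiableOn_powerSum 1).mono hsub).fun_div
    (((hZ j).differentiableOn_powerSum 0).mono hsub) fun z hz => ?_
  exact ((hZ j).zeros_nonempty_iff (hsub hz)).1 ((hev z hz).1.1 j)

/-- The number of distinct zeros is constant near `0`, apart possibly from `0` itself. -/
lemma exists_ncard_eq {r : ℝ} (h : ZeroFree f U (ball 0 r) c ρ) (hr : 0 < r) :
    ∃ n : ℕ, ∀ᶠ z in 𝓝[≠] (0 : ℂ), (zeros f c ρ z).ncard = n := by
  classical
  have h00 : (0 : ℂ) ∈ ball (0 : ℂ) r := mem_ball_self hr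
  obtain ⟨r₁, hr₁, hev⟩ := Metric.eventually_nhds_iff_ball.1
    ((h.eventually_powerSum_zero_eq h00).and (ball_mem_nhds 0 hr))
  have h' := h.mono isOpen_ball (fun z hz => (hev z hz).2)
  let P : ℕ → Prop := fun n => ∃ z ∈ ball (0 : ℂ) r₁, (zeros f c ρ z).ncard = n
  obtain ⟨N, hN⟩ := exists_nat_ge ‖powerSum f c ρ 0 0‖
  have hbd : ∀ z ∈ ball (0 : ℂ) r₁, (zeros f c ρ z).ncard ≤ N := by
    intro z hz
    have h1 := h'.ncard_zeros_le hz
    rw [(hev z hz).1] at h1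
    exact_mod_cast h1.trans hN
  let n := Nat.findGreatest P N
  have hPn : P n := Nat.findGreatest_spec (m := (zeros f c ρ 0).ncard)
    (hbd 0 (mem_ball_self hr₁)) ⟨0, mem_ball_self hr₁, rfl⟩
  obtain ⟨z₁, hz₁, hn₁⟩ := hPn
  have hle : ∀ z ∈ ball (0 : ℂ) r₁, (zeros f c ρ z).ncard ≤ n := fun z hz =>
    Nat.le_findGreatest (hbd z hz) ⟨z, hz, rfl⟩
  have han : AnalyticOnNhd ℂ (hankelDet f c ρ n) (ball 0 r₁) :=
    (h'.differentiableOn_hankelDet n).analyticOnNhd isOpen_ball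
  refine ⟨n, ?_⟩
  rcases (han 0 (mem_ball_self hr₁)).eventually_eq_zero_or_eventually_ne_zero with h0 | h0
  · have := han.eqOn_zero_of_preconnected_of_eventuallyEq_zero (convex_ball _ _).isPreconnected
      (mem_ball_self hr₁) h0 hz₁
    exact absurd this ((h'.hankelDet_ne_zero_iff hz₁ hn₁.le).2 hn₁)
  · filter_upwards [h0, mem_nhdsWithin_of_mem_nhds (ball_mem_nhds 0 hr₁)] with z hz hzb
    exact (h'.hankelDet_ne_zero_iff hzb (hle z hzb)).1 hz

end ZeroFree

end Sheets

end PlaneCurve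

namespace PlaneCurve

/-! ### The local structure of plane analytic curves -/

section LocalCurve

open Set Filter Topology Metric

/-- The points of `B` over `z` in the disc of radius `r'`. -/
def fiber (B : Set (ℂ × ℂ)) (r' : ℝ) (z : ℂ) : Set ℂ := {w ∈ ball 0 r' | (z, w) ∈ B}

/-- Over the punctured disc of radius `r`, the part of `B` with second coordinate in the disc of
radius `r'` is locally a finite disjoint union of graphs of holomorphic functions. -/
def IsSheeted (B : Set (ℂ × ℂ)) (r r' : ℝ) : Prop :=
  ∀ z₀ ∈ ball (0 : ℂ) r \ {0}, ∃ ε > 0, ball z₀ ε ⊆ ball (0 : ℂ) r \ {0} ∧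
    ∃ (ι : Type) (_ : Fintype ι) (b : ι → ℂ → ℂ), (∀ j, DifferentiableOn ℂ (b j) (ball z₀ ε)) ∧
      ∀ z ∈ ball z₀ ε, Function.Injective (b · z) ∧ fiber B r' z = range (b · z)

lemma isOpen_punctured (r : ℝ) : IsOpen (ball (0 : ℂ) r \ {0}) :=
  isOpen_ball.sdiff isClosed_singleton

/-- A subset of a sheeted set which contains or avoids each sheet is sheeted. -/
lemma IsSheeted.of_subset {B T : Set (ℂ × ℂ)} {r r' : ℝ} (hT : IsSheeted T r r')
    (hBT : ∀ z ∈ ball (0 : ℂ) r \ {0}, fiber B r' z ⊆ fiber T r' z)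
    (h : ∀ z₀ ε, 0 < ε → ball z₀ ε ⊆ ball (0 : ℂ) r \ {0} → ∀ b : ℂ → ℂ,
      DifferentiableOn ℂ b (ball z₀ ε) → (∀ z ∈ ball z₀ ε, b z ∈ fiber T r' z) →
      (∃ z ∈ ball z₀ ε, (z, b z) ∈ B) → ∀ z ∈ ball z₀ ε, (z, b z) ∈ B) :
    IsSheeted B r r' := by
  intro z₀ hz₀
  obtain ⟨ε, hε, hsub, ι, hι, b, hb, hfib⟩ := hT z₀ hz₀
  classical
  refine ⟨ε, hε, hsub, {j // (z₀, b j z₀) ∈ B}, inferInstance, fun j => b j.1, fun j => hb j.1,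
    fun z hz => ⟨fun i j hij => Subtype.ext ((hfib z hz).1 hij), ?_⟩⟩
  have hmemT : ∀ j, ∀ z ∈ ball z₀ ε, b j z ∈ fiber T r' z := fun j z hz => by
    rw [(hfib z hz).2]; exact ⟨j, rfl⟩
  ext w
  constructor
  · intro hw
    have hwT := hBT z (hsub hz) hw
    rw [(hfib z hz).2] at hwT
    obtain ⟨j, rfl⟩ := hwT
    exact ⟨⟨j, h z₀ ε hε hsub (b j) (hb j) (hmemT j) ⟨z, hz, hw.2⟩ z₀ (mem_ball_self hε)⟩, rfl⟩
  · rintro ⟨⟨j, hj⟩, rfl⟩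
    exact ⟨(hmemT j z hz).1, h z₀ ε hε hsub (b j) (hb j) (hmemT j) ⟨z₀, mem_ball_self hε, hj⟩ z hz⟩

/-- Near a point of a sheet, a sheeted set consists of this sheet only. -/
lemma IsSheeted.eventually_eq {T : Set (ℂ × ℂ)} {r r' : ℝ} (hT : IsSheeted T r r') {z₁ : ℂ}
    (hz₁ : z₁ ∈ ball (0 : ℂ) r \ {0}) {b : ℂ → ℂ} (hb : ContinuousAt b z₁)
    (hmem : ∀ᶠ z in 𝓝 z₁, b z ∈ fiber T r' z) :
    ∀ᶠ y in 𝓝[T] (z₁, b z₁), y.2 = b y.1 := by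
  obtain ⟨ε, hε, hsub, ι, hι, β, hβ, hfib⟩ := hT z₁ hz₁
  have h0 := hmem.self_of_nhds
  have h0' := h0
  rw [(hfib z₁ (mem_ball_self hε)).2] at h0
  obtain ⟨j, hj⟩ := h0
  simp only at hj
  have hβc : ∀ i, ContinuousAt (β i) z₁ := fun i =>
    (hβ i).continuousOn.continuousAt (ball_mem_nhds _ hε)
  have hne : ∀ i, i ≠ j → ∀ᶠ y : ℂ × ℂ in 𝓝 (z₁, b z₁), β i y.1 ≠ y.2 ∧ β i y.1 ≠ b y.1 := by
    intro i hij
    have hi : β i z₁ ≠ b z₁ := by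
      rw [← hj]; exact fun h => hij ((hfib z₁ (mem_ball_self hε)).1 h)
    have hc1 : ContinuousAt (fun y : ℂ × ℂ => β i y.1) (z₁, b z₁) :=
      ContinuousAt.comp (f := Prod.fst) (hβc i) continuousAt_fst
    have hc2 : ContinuousAt (fun y : ℂ × ℂ => b y.1) (z₁, b z₁) :=
      ContinuousAt.comp (f := Prod.fst) hb continuousAt_fst
    exact (hc1.ne_iff_eventually_ne continuousAt_snd |>.1 hi).and
      (hc1.ne_iff_eventually_ne hc2 |>.1 hi)
  have hall : ∀ᶠ y : ℂ × ℂ in 𝓝 (z₁, b z₁), ∀ i, i ≠ j → β i y.1 ≠ y.2 ∧ β i y.1 ≠ b y.1 :=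
    eventually_all.2 fun i => eventually_imp_distrib_left.2 (hne i)
  have hball : ∀ᶠ y : ℂ × ℂ in 𝓝 (z₁, b z₁), y.1 ∈ ball z₁ ε ∧ b y.1 ∈ fiber T r' y.1 :=
    (continuousAt_fst (p := (z₁, b z₁))).eventually
      (Filter.Eventually.and (ball_mem_nhds _ hε) hmem)
  have hbox : ∀ᶠ y : ℂ × ℂ in 𝓝 (z₁, b z₁), y.2 ∈ ball (0 : ℂ) r' :=
    (continuousAt_snd (p := (z₁, b z₁))).eventually (isOpen_ball.mem_nhds h0'.1)
  filter_upwards [self_mem_nhdsWithin, nhdsWithin_le_nhds hall, nhdsWithin_le_nhds hball,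
    nhdsWithin_le_nhds hbox] with y hyT hy1 hy2 hy3
  have h1 : y.2 ∈ fiber T r' y.1 := ⟨hy3, hyT⟩
  have h2 := hy2.2
  rw [(hfib y.1 hy2.1).2] at h1 h2
  obtain ⟨i, hi⟩ := h1
  obtain ⟨i', hi'⟩ := h2
  have e1 : i = j := by_contra fun h => (hy1 i h).1 hi
  have e2 : i' = j := by_contra fun h => (hy1 i' h).2 hi'
  rw [← hi, ← hi', e1, e2]

/-- The points of `T` near which the functions `F i` do not all vanish identically on `T`. -/
def nonvanishing {ι : Type*} (T : Set (ℂ × ℂ)) (F : ι → ℂ × ℂ → ℂ) : Set (ℂ × ℂ) :=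
  {x ∈ T | ¬ ∀ᶠ y in 𝓝[T] x, ∀ i, F i y = 0}

lemma tendsto_graph {b : ℂ → ℂ} {z₁ : ℂ} (hb : ContinuousAt b z₁) {T : Set (ℂ × ℂ)}
    (hmem : ∀ᶠ z in 𝓝 z₁, (z, b z) ∈ T) :
    Tendsto (fun z => (z, b z)) (𝓝 z₁) (𝓝[T] (z₁, b z₁)) :=
  tendsto_nhdsWithin_iff.2 ⟨continuousAt_id.prodMk hb, hmem⟩

lemma differentiableOn_comp_graph {O : Set (ℂ × ℂ)} {F : ℂ × ℂ → ℂ} (hO : IsOpen O)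
    (hF : DifferentiableOn ℂ F O) {b : ℂ → ℂ} {s : Set ℂ} (hs : IsOpen s)
    (hb : DifferentiableOn ℂ b s) (hm : ∀ z ∈ s, (z, b z) ∈ O) :
    DifferentiableOn ℂ (fun z => F (z, b z)) s := by
  intro z hz
  have h1 : DifferentiableAt ℂ (fun z => (z, b z)) z :=
    differentiableAt_id.prodMk (hb.differentiableAt (hs.mem_nhds hz))
  exact (DifferentiableAt.comp (f := fun z => (z, b z)) z
    (hF.differentiableAt (hO.mem_nhds (hm z hz))) h1).differentiableWithinAt

/-- By the identity theorem, functions that vanish near one point of a sheet vanish on the whole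
sheet, so the points near which they do not all vanish on `T` form a union of sheets. -/
lemma isSheeted_nonvanishing {ι : Type*} {T O : Set (ℂ × ℂ)} {r r' : ℝ} (hT : IsSheeted T r r')
    (hO : IsOpen O) (hbox : ball (0 : ℂ) r ×ˢ ball (0 : ℂ) r' ⊆ O) {F : ι → ℂ × ℂ → ℂ}
    (hF : ∀ i, DifferentiableOn ℂ (F i) O) : IsSheeted (nonvanishing T F) r r' := by
  refine hT.of_subset (fun z _ w hw => ⟨hw.1, hw.2.1⟩) ?_
  rintro z₀ ε hε hsub b hb hbT ⟨z₁, hz₁, hB⟩ z₂ hz₂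
  refine ⟨(hbT z₂ hz₂).2, fun hev => hB.2 ?_⟩
  have hcont : ∀ z ∈ ball z₀ ε, ContinuousAt b z := fun z hz =>
    hb.continuousOn.continuousAt (isOpen_ball.mem_nhds hz)
  have hmem : ∀ z ∈ ball z₀ ε, ∀ᶠ z' in 𝓝 z, b z' ∈ fiber T r' z' := fun z hz => by
    filter_upwards [isOpen_ball.mem_nhds hz] with z' hz' using hbT z' hz'
  have hzero : ∀ i, ∀ z ∈ ball z₀ ε, F i (z, b z) = 0 := by
    intro i
    have hd := (differentiableOn_comp_graph hO (hF i) isOpen_ball hb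
      (fun z hz => hbox ⟨(hsub hz).1, (hbT z hz).1⟩)).analyticOnNhd isOpen_ball
    refine hd.eqOn_zero_of_preconnected_of_eventuallyEq_zero (convex_ball _ _).isPreconnected hz₂ ?_
    have := (tendsto_graph (hcont z₂ hz₂) ((hmem z₂ hz₂).mono fun _ h => h.2)).eventually hev
    exact this.mono fun z hz => hz i
  have hloc := hT.eventually_eq (hsub hz₁) (hcont z₁ hz₁) (hmem z₁ hz₁)
  filter_upwards [hloc, nhdsWithin_le_nhds ((continuousAt_fst (p := (z₁, b z₁))).eventually
    (isOpen_ball.mem_nhds hz₁))] with y hy hy1 i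
  have := hzero i y.1 hy1
  rwa [← hy] at this

/-- `T` is an analytic curve in the box of radii `r`, `r'`, meeting the axis `z = 0` in the origin
only, and an unramified covering of the punctured disc `0 < |z| < r`. -/
structure IsLocalCurve (T : Set (ℂ × ℂ)) (r r' : ℝ) : Prop where
  pos : 0 < r
  pos' : 0 < r'
  sheeted : IsSheeted T r r'
  fiber_zero : fiber T r' 0 = {0}
  small : ∀ ε > 0, ∃ δ > 0, ∀ z ∈ ball (0 : ℂ) δ, ∀ w ∈ fiber T r' z, ‖w‖ < ε
  notIsolated : (0 : ℂ × ℂ) ∈ closure (T \ {0})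

/-- A holomorphic function not vanishing identically on the axis `z = 0` is zero free on arbitrarily
small circles `z = 0`, `|w| = r'`. -/
lemma exists_zeroFree {O : Set (ℂ × ℂ)} (hO : IsOpen O) (h0 : (0, 0) ∈ O) {f : ℂ × ℂ → ℂ}
    (hf : DifferentiableOn ℂ f O) (hne : ¬ ∀ᶠ w in 𝓝 (0 : ℂ), f (0, w) = 0) {R : ℝ} (hR : 0 < R) :
    ∃ r' > 0, r' < R ∧ (∀ w ∈ closedBall (0 : ℂ) r', f (0, w) = 0 → w = 0) ∧
      ∃ r > 0, r < R ∧ ZeroFree f O (ball 0 r) 0 r' := by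
  have han : AnalyticAt ℂ (fun w => f (0, w)) 0 := by
    have hV : IsOpen {w | ((0 : ℂ), w) ∈ O} := hO.preimage (by fun_prop)
    have hg : DifferentiableOn ℂ (fun w => f (0, w)) {w | ((0 : ℂ), w) ∈ O} :=
      fun w hw => ((hf.separatelyHolomorphicOn hO) (0, w) hw).2.differentiableWithinAt
    exact hg.analyticAt (hV.mem_nhds h0)
  have hev := han.eventually_eq_zero_or_eventually_ne_zero.resolve_left hne
  rw [eventually_nhdsWithin_iff] at hev
  have hO' : ∀ᶠ w in 𝓝 (0 : ℂ), ((0 : ℂ), w) ∈ O := by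
    have : ContinuousAt (fun w : ℂ => ((0 : ℂ), w)) 0 := by fun_prop
    exact this (hO.mem_nhds h0)
  obtain ⟨ρ, hρ, hball⟩ := Metric.eventually_nhds_iff_ball.1 (hev.and hO')
  have hr' : 0 < min ρ R / 2 := by positivity
  have hsub : closedBall (0 : ℂ) (min ρ R / 2) ⊆ ball 0 ρ :=
    closedBall_subset_ball (by linarith [min_le_left ρ R, lt_min hρ hR])
  refine ⟨min ρ R / 2, hr', by linarith [min_le_right ρ R, lt_min hρ hR],
    fun w hw hw0 => by_contra fun h => (hball w (hsub hw)).1 h hw0, ?_⟩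
  obtain ⟨δ, hδ, hZ⟩ := ZeroFree.of_sphere (z₀ := 0) (c := 0) hO hf hr'
    (fun w hw => (hball w (hsub hw)).2)
    (fun w hw => (hball w (hsub (sphere_subset_closedBall hw))).1 (by
      rintro rfl
      simp at hw
      exact hr'.ne hw))
  have h2 : 0 < min δ R / 2 := by positivity
  exact ⟨min δ R / 2, h2, by linarith [min_le_right δ R, lt_min hδ hR], hZ.mono isOpen_ball
    (ball_subset_ball (by linarith [min_le_left δ R, lt_min hδ hR]))⟩

/-- **Local structure of a plane analytic curve without isolated points**, in coordinates in which
one of its equations does not vanish identically on the axis `z = 0`. -/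
theorem exists_isLocalCurve {T O : Set (ℂ × ℂ)} (hO : IsOpen O) (h0 : (0 : ℂ × ℂ) ∈ O) {ι : Type*}
    {F : ι → ℂ × ℂ → ℂ} (hF : ∀ i, DifferentiableOn ℂ (F i) O)
    (hT : T ∩ O = {x ∈ O | ∀ i, F i x = 0}) (h0T : (0 : ℂ × ℂ) ∈ T)
    (hacc : ∀ x ∈ T ∩ O, x ∈ closure (T \ {x})) {i₀ : ι}
    (hne : ¬ ∀ᶠ w in 𝓝 (0 : ℂ), F i₀ (0, w) = 0) {R : ℝ} (hR : 0 < R) :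
    ∃ r r', r < R ∧ r' < R ∧ closedBall (0 : ℂ) r ×ˢ closedBall (0 : ℂ) r' ⊆ O ∧
      IsLocalCurve T r r' := by
  obtain ⟨ρ, hρ, hρO⟩ := exists_closedBall_prod_subset hO h0
  obtain ⟨r', hr', hr'R, hcenter, r₁, hr₁, hr₁R, hZ⟩ :=
    exists_zeroFree hO h0 (hF i₀) hne (lt_min hR hρ)
  obtain ⟨n, hn⟩ := hZ.exists_ncard_eq hr₁
  obtain ⟨r, hr, hball⟩ := Metric.eventually_nhds_iff_ball.1
    ((eventually_nhdsWithin_iff.1 hn).and (ball_mem_nhds 0 hr₁))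
  let f := F i₀
  let S : Set (ℂ × ℂ) := {x | f x = 0}
  have hfib : ∀ z, fiber S r' z = ZeroFree.zeros f 0 r' z := fun z => rfl
  let s := min r (r₁ / 2)
  have hs : 0 < s := lt_min hr (half_pos hr₁)
  have hsr₁ : ball (0 : ℂ) s ⊆ ball 0 r₁ :=
    ball_subset_ball ((min_le_right _ _).trans (by linarith))
  have hsr : ball (0 : ℂ) s ⊆ ball 0 r := ball_subset_ball (min_le_left _ _)
  have hboxO : closedBall (0 : ℂ) s ×ˢ closedBall (0 : ℂ) r' ⊆ O := by
    refine (Set.prod_mono (closedBall_subset_closedBall ?_)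
      (closedBall_subset_closedBall ?_)).trans hρO
    · exact (min_le_right _ _).trans (by linarith [min_le_right R ρ])
    · linarith [min_le_right R ρ]
  have hbox : ball (0 : ℂ) s ×ˢ ball (0 : ℂ) r' ⊆ O :=
    (Set.prod_mono ball_subset_closedBall ball_subset_closedBall).trans hboxO
  have hTF : ∀ x ∈ O, x ∈ T ↔ ∀ i, F i x = 0 := fun x hx =>
    ⟨fun h => (hT ▸ (⟨h, hx⟩ : x ∈ T ∩ O) : x ∈ {x ∈ O | ∀ i, F i x = 0}).2,
      fun h => (hT.symm ▸ (⟨hx, h⟩ : x ∈ {x ∈ O | ∀ i, F i x = 0}) : x ∈ T ∩ O).1⟩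
  have hTS : ∀ z ∈ ball (0 : ℂ) s, fiber T r' z ⊆ fiber S r' z := fun z hz w hw =>
    ⟨hw.1, (hTF (z, w) (hbox ⟨hz, hw.1⟩)).1 hw.2 i₀⟩
  have hS : IsSheeted S s r' := by
    intro z₀ hz₀
    have hz₀' : z₀ ∈ ball (0 : ℂ) r \ {0} := ⟨hsr hz₀.1, hz₀.2⟩
    obtain ⟨ε, hε, hεsub, b, hb, hfb⟩ := hZ.exists_sheets (hsr₁ hz₀.1) (n := n) (by
      filter_upwards [(isOpen_punctured r).mem_nhds hz₀'] with z hz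
      exact (hball z hz.1).1 hz.2)
    obtain ⟨δ, hδ, hδs⟩ := Metric.isOpen_iff.1 (isOpen_punctured s) z₀ hz₀
    exact ⟨min ε δ, lt_min hε hδ, (ball_subset_ball (min_le_right _ _)).trans hδs, Fin n,
      inferInstance, b, fun j => (hb j).mono (ball_subset_ball (min_le_left _ _)),
      fun z hz => hfb z (ball_subset_ball (min_le_left _ _) hz)⟩
  refine ⟨s, r', ?_, ?_, hboxO, hs, hr', ?_, ?_, ?_, hacc 0 ⟨h0T, h0⟩⟩
  · exact (min_le_right _ _).trans_lt (by linarith [min_le_left R ρ])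
  · linarith [min_le_left R ρ]
  · refine hS.of_subset (fun z hz => hTS z hz.1) ?_
    rintro z₀ ε hε hsub b hb hbS ⟨z₁, hz₁, hB⟩ z₂ hz₂
    have hgO : ∀ z ∈ ball z₀ ε, (z, b z) ∈ O := fun z hz => hbox ⟨(hsub hz).1, (hbS z hz).1⟩
    have hc : ContinuousAt b z₁ := hb.continuousOn.continuousAt (isOpen_ball.mem_nhds hz₁)
    -- points of `T` accumulate at `(z₁, b z₁)`, and near this point they lie on the sheet
    have hloc : ∀ᶠ y in 𝓝[T] (z₁, b z₁), y.2 = b y.1 := by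
      have h1 := hS.eventually_eq (hsub hz₁) hc (by
        filter_upwards [isOpen_ball.mem_nhds hz₁] with z hz using hbS z hz)
      rw [eventually_nhdsWithin_iff] at h1 ⊢
      filter_upwards [h1, hO.mem_nhds (hgO z₁ hz₁)] with y hy hyO hyT
      exact hy ((hTF y hyO).1 hyT i₀)
    have hfreq : ∃ᶠ z in 𝓝[≠] z₁, (z, b z) ∈ T := by
      have h2 := mem_closure_iff_frequently.1 (hacc (z₁, b z₁) ⟨hB, hgO z₁ hz₁⟩)
      rw [eventually_nhdsWithin_iff] at hloc
      have h3 : ∃ᶠ y : ℂ × ℂ in 𝓝 (z₁, b z₁), (y.1 ≠ z₁ ∧ (y.1, b y.1) ∈ T) := by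
        refine (h2.and_eventually hloc).mono ?_
        rintro ⟨y1, y2⟩ ⟨hy, hy'⟩
        have := hy' hy.1
        simp only at this
        subst this
        refine ⟨fun h => hy.2 ?_, hy.1⟩
        simp only at h
        rw [h]; rfl
      rw [frequently_nhdsWithin_iff]
      exact (Tendsto.frequently (p := fun z => z ≠ z₁ ∧ (z, b z) ∈ T)
        (continuousAt_fst (p := (z₁, b z₁))) h3).mono fun z hz => ⟨hz.2, hz.1⟩
    refine (hTF _ (hgO z₂ hz₂)).2 fun i => ?_
    have hd := (differentiableOn_comp_graph hO (hF i) isOpen_ball hb hgO).analyticOnNhd isOpen_ball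
    refine hd.eqOn_zero_of_preconnected_of_frequently_eq_zero (convex_ball _ _).isPreconnected hz₁
      ?_ hz₂
    refine (hfreq.and_eventually (nhdsWithin_le_nhds (isOpen_ball.mem_nhds hz₁))).mono ?_
    rintro z ⟨hzT, hz⟩
    exact (hTF _ (hgO z hz)).1 hzT i
  · ext w
    constructor
    · intro hw
      exact hcenter w (ball_subset_closedBall hw.1) (hTS 0 (mem_ball_self hs) hw).2
    · rintro rfl
      exact ⟨mem_ball_self hr', h0T⟩
  · intro ε hε
    have hK : IsCompact (closedBall (0 : ℂ) r' \ ball 0 ε) :=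
      (isCompact_closedBall _ _).diff isOpen_ball
    have h1 : ∀ᶠ z in 𝓝 (0 : ℂ), ∀ w ∈ closedBall (0 : ℂ) r' \ ball 0 ε, f (z, w) ≠ 0 := by
      refine hK.eventually_forall_of_forall_eventually fun w hw => ?_
      have hc : ContinuousAt f (0, w) := (hF i₀).continuousOn.continuousAt (hO.mem_nhds
        (hboxO ⟨mem_closedBall_self hs.le, hw.1⟩))
      refine hc.eventually_ne fun h => hw.2 ?_
      rw [hcenter w hw.1 h]
      exact mem_ball_self hε
    obtain ⟨δ, hδ, hδ'⟩ := Metric.eventually_nhds_iff_ball.1 (h1.and (ball_mem_nhds 0 hs))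
    refine ⟨δ, hδ, fun z hz w hw => ?_⟩
    by_contra hcon
    exact (hδ' z hz).1 w ⟨ball_subset_closedBall hw.1, by simpa using hcon⟩
      (hTS z (hδ' z hz).2 hw).2

end LocalCurve

end PlaneCurve

namespace PlaneCurve

/-! ### Weierstrass polynomials and norms -/

section Weierstrass

open Set Filter Topology Metric Polynomial

lemma isPreconnected_punctured (r : ℝ) : IsPreconnected (ball (0 : ℂ) r \ {0}) := by
  rcases le_or_gt r 0 with hr | hr
  · rw [ball_eq_empty.2 hr]; simp [isPreconnected_empty]
  have : ball (0 : ℂ) r \ {0} = Complex.exp '' {z | z.re < Real.log r} := by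
    ext z
    constructor
    · rintro ⟨hz, hz0⟩
      have hz0' : z ≠ 0 := hz0
      refine ⟨Complex.log z, ?_, Complex.exp_log hz0'⟩
      simp only [Set.mem_ofPred_eq, Complex.log_re]
      exact Real.log_lt_log (norm_pos_iff.2 hz0') (by simpa using hz)
    · rintro ⟨w, hw, rfl⟩
      refine ⟨?_, Complex.exp_ne_zero w⟩
      rw [mem_ball_zero_iff, Complex.norm_exp]
      exact (Real.exp_lt_exp.2 hw).trans_eq (Real.exp_log hr)
  rw [this]
  exact (convex_halfSpace_re_lt _).isPreconnected.image _ Complex.continuous_exp.continuousOn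

/-- The monic polynomial whose roots are the values of `h` at the points of `B` over `z`. -/
noncomputable def fiberPoly (B : Set (ℂ × ℂ)) (r' : ℝ) (h : ℂ × ℂ → ℂ) (z : ℂ) : ℂ[X] :=
  ∏ᶠ w ∈ fiber B r' z, (X - C (h (z, w)))

lemma fiberPoly_eq {B : Set (ℂ × ℂ)} {r' : ℝ} {h : ℂ × ℂ → ℂ} {z : ℂ} {ι : Type} [Fintype ι]
    {b : ι → ℂ} (hb : Function.Injective b) (hf : fiber B r' z = range b) :
    fiberPoly B r' h z = ∏ j, (X - C (h (z, b j))) := by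
  rw [fiberPoly, hf, finprod_mem_range hb, finprod_eq_prod_of_fintype]

lemma differentiableOn_coeff_prod {ι : Type} (s : Finset ι) {D : Set ℂ} {g : ι → ℂ → ℂ}
    (hg : ∀ j, DifferentiableOn ℂ (g j) D) (k : ℕ) :
    DifferentiableOn ℂ (fun z => (∏ j ∈ s, (X - C (g j z))).coeff k) D := by
  classical
  induction s using Finset.induction_on generalizing k with
  | empty => simp only [Finset.prod_empty]; exact differentiableOn_const _
  | insert j s hj ih =>
    simp only [Finset.prod_insert hj, sub_mul, coeff_sub, coeff_C_mul]
    refine DifferentiableOn.fun_sub ?_ ((hg j).fun_mul (ih k))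
    cases k with
    | zero => simp
    | succ k => simpa only [coeff_X_mul] using ih k

lemma norm_coeff_prod_le {ι : Type} (s : Finset ι) {g : ι → ℂ} {M : ℝ} (hM : 0 ≤ M)
    (hg : ∀ j ∈ s, ‖g j‖ ≤ M) (k : ℕ) : ‖(∏ j ∈ s, (X - C (g j))).coeff k‖ ≤ (1 + M) ^ s.card := by
  classical
  induction s using Finset.induction_on generalizing k with
  | empty =>
    simp only [Finset.prod_empty, coeff_one, Finset.card_empty, pow_zero]
    split_ifs <;> simp
  | insert j s hj ih =>
    have ih' := ih (fun i hi => hg i (Finset.mem_insert_of_mem hi))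
    have h0 : 0 ≤ (1 + M) ^ s.card := by positivity
    rw [Finset.prod_insert hj, sub_mul, coeff_sub, coeff_C_mul, Finset.card_insert_of_notMem hj,
      pow_succ, mul_comm, mul_add, mul_one, mul_comm, mul_comm _ M]
    refine (norm_sub_le _ _).trans (add_le_add ?_ ?_)
    · cases k with
      | zero => simpa using h0
      | succ k => simpa only [coeff_X_mul] using ih' k
    · rw [norm_mul]
      exact mul_le_mul (hg j (Finset.mem_insert_self _ _)) (ih' k) (norm_nonneg _) hM

variable {B O : Set (ℂ × ℂ)} {r r' : ℝ} {h : ℂ × ℂ → ℂ}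

/-- The coefficients of the polynomials `fiberPoly` extend holomorphically over the puncture, by
Riemann's theorem. -/
theorem IsSheeted.exists_fiberPoly_eq (hB : IsSheeted B r r') (hr : 0 < r) (hO : IsOpen O)
    (hbox : ball (0 : ℂ) r ×ˢ ball (0 : ℂ) r' ⊆ O) (hh : DifferentiableOn ℂ h O) {M : ℝ}
    (hM : ∀ z ∈ ball (0 : ℂ) r \ {0}, ∀ w ∈ fiber B r' z, ‖h (z, w)‖ ≤ M) :
    ∃ (m : ℕ) (c : ℕ → ℂ → ℂ), (∀ k, DifferentiableOn ℂ (c k) (ball 0 r)) ∧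
      ∀ z ∈ ball (0 : ℂ) r \ {0}, (fiberPoly B r' h z).natDegree = m ∧
        ∀ k, (fiberPoly B r' h z).coeff k = c k z := by
  have hloc : ∀ z₀ ∈ ball (0 : ℂ) r \ {0}, (∀ᶠ z in 𝓝 z₀, (fiberPoly B r' h z).natDegree =
      (fiberPoly B r' h z₀).natDegree) ∧
      ∀ k, DifferentiableAt ℂ (fun z => (fiberPoly B r' h z).coeff k) z₀ := by
    intro z₀ hz₀
    obtain ⟨ε, hε, hsub, ι, hι, b, hb, hfib⟩ := hB z₀ hz₀
    have hpoly : ∀ z ∈ ball z₀ ε, fiberPoly B r' h z = ∏ j, (X - C (h (z, b j z))) := fun z hz =>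
      fiberPoly_eq (hfib z hz).1 (hfib z hz).2
    constructor
    · filter_upwards [ball_mem_nhds z₀ hε] with z hz
      rw [hpoly z hz, hpoly z₀ (mem_ball_self hε), natDegree_finsetProd_X_sub_C_eq_card,
        natDegree_finsetProd_X_sub_C_eq_card]
    · intro k
      have hd := differentiableOn_coeff_prod (Finset.univ) (D := ball z₀ ε)
        (g := fun j z => h (z, b j z))
        (fun j => differentiableOn_comp_graph hO hh isOpen_ball (hb j)
          fun z hz => hbox ⟨(hsub hz).1, by
            have : b j z ∈ fiber B r' z := by rw [(hfib z hz).2]; exact ⟨j, rfl⟩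
            exact this.1⟩) k
      refine (hd.differentiableAt (ball_mem_nhds z₀ hε)).congr_of_eventuallyEq ?_
      filter_upwards [ball_mem_nhds z₀ hε] with z hz
      rw [hpoly z hz]
  have hz₁ : ((r / 2 : ℝ) : ℂ) ∈ ball (0 : ℂ) r \ {0} := by
    constructor
    · simp [abs_of_pos hr, hr]
    · simpa using hr.ne'
  have hdeg : ∀ z ∈ ball (0 : ℂ) r \ {0}, (fiberPoly B r' h z).natDegree =
      (fiberPoly B r' h ((r / 2 : ℝ) : ℂ)).natDegree := by
    intro z hz
    refine (isPreconnected_punctured r).constant (Y := ℕ)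
      (f := fun z => (fiberPoly B r' h z).natDegree) ?_ hz hz₁
    intro z₀ hz₀
    exact ((continuousAt_const (y := (fiberPoly B r' h z₀).natDegree)).congr
      ((hloc z₀ hz₀).1.mono fun z h => h.symm)).continuousWithinAt
  set m := (fiberPoly B r' h ((r / 2 : ℝ) : ℂ)).natDegree
  have hbound : ∀ k, ∀ z ∈ ball (0 : ℂ) r \ {0},
      ‖(fiberPoly B r' h z).coeff k‖ ≤ (1 + max M 0) ^ m := by
    intro k z hz
    obtain ⟨ε, hε, hsub, ι, hι, b, hb, hfib⟩ := hB z hz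
    have hz' := hfib z (mem_ball_self hε)
    have hp := fiberPoly_eq (h := h) hz'.1 hz'.2
    have hcard : m = (Finset.univ : Finset ι).card := by
      rw [← hdeg z hz, hp, natDegree_finsetProd_X_sub_C_eq_card]
    rw [hp, hcard]
    refine norm_coeff_prod_le _ (le_max_right _ _) (fun j _ => (hM z hz _ ?_).trans
      (le_max_left _ _)) k
    rw [hz'.2]; exact ⟨j, rfl⟩
  refine ⟨m, fun k => Function.update (fun z => (fiberPoly B r' h z).coeff k) 0
    (limUnder (𝓝[≠] 0) fun z => (fiberPoly B r' h z).coeff k), fun k => ?_, fun z hz =>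
      ⟨hdeg z hz, fun k => ?_⟩⟩
  · refine Complex.differentiableOn_update_limUnder_of_bddAbove (ball_mem_nhds 0 hr)
      (fun z hz => ((hloc z hz).2 k).differentiableWithinAt) ?_
    refine ⟨(1 + max M 0) ^ m, ?_⟩
    rintro _ ⟨z, hz, rfl⟩
    exact hbound k z hz
  · change _ = Function.update (fun z => (fiberPoly B r' h z).coeff k) 0 _ z
    rw [Function.update_of_ne hz.2]

lemma eval_fiberPoly (hB : IsSheeted B r r') {z : ℂ} (hz : z ∈ ball (0 : ℂ) r \ {0}) (t : ℂ) :
    ∃ (ι : Type) (_ : Fintype ι) (x : ι → ℂ), fiber B r' z = range x ∧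
      (fiberPoly B r' h z).natDegree = Fintype.card ι ∧
      (fiberPoly B r' h z).eval t = ∏ j, (t - h (z, x j)) := by
  obtain ⟨ε, hε, hsub, ι, hι, b, hb, hfib⟩ := hB z hz
  have hz' := hfib z (mem_ball_self hε)
  refine ⟨ι, hι, (b · z), hz'.2, ?_, ?_⟩
  · rw [fiberPoly_eq hz'.1 hz'.2, natDegree_finsetProd_X_sub_C_eq_card]; rfl
  · rw [fiberPoly_eq hz'.1 hz'.2, eval_prod]
    simp

lemma eval_fiberPoly_eq_zero_iff (hB : IsSheeted B r r') {z : ℂ} (hz : z ∈ ball (0 : ℂ) r \ {0})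
    (t : ℂ) : (fiberPoly B r' h z).eval t = 0 ↔ ∃ w ∈ fiber B r' z, h (z, w) = t := by
  obtain ⟨ι, hι, x, hx, -, he⟩ := eval_fiberPoly (h := h) hB hz t
  rw [he, hx, Finset.prod_eq_zero_iff]
  simp only [Finset.mem_univ, true_and, sub_eq_zero, mem_range, exists_exists_eq_and]
  exact exists_congr fun _ => eq_comm

/-- A nonempty union of sheets is the zero set of a holomorphic function, its Weierstrass
polynomial. -/
theorem IsSheeted.exists_weierstrass (hB : IsSheeted B r r') (hr : 0 < r)
    (hsmall : ∀ ε > 0, ∃ δ > 0, ∀ z ∈ ball (0 : ℂ) δ \ {0}, ∀ w ∈ fiber B r' z, ‖w‖ < ε)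
    (hne : ∃ z ∈ ball (0 : ℂ) r \ {0}, (fiber B r' z).Nonempty) :
    ∃ P : ℂ × ℂ → ℂ, DifferentiableOn ℂ P (ball (0 : ℂ) r ×ˢ univ) ∧
      (∀ z ∈ ball (0 : ℂ) r \ {0}, ∀ w, P (z, w) = 0 ↔ w ∈ fiber B r' z) ∧
      ∃ m, m ≠ 0 ∧ ∀ w, P (0, w) = w ^ m := by
  obtain ⟨m, c, hc, hpoly⟩ := hB.exists_fiberPoly_eq (h := Prod.snd) hr isOpen_univ (subset_univ _)
    (by fun_prop) (M := r') (fun z _ w hw => (mem_ball_zero_iff.1 hw.1).le)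
  let P : ℂ × ℂ → ℂ := fun p => ∑ k ∈ Finset.range (m + 1), c k p.1 * p.2 ^ k
  have hP : ∀ z ∈ ball (0 : ℂ) r \ {0}, ∀ w, P (z, w) = (fiberPoly B r' Prod.snd z).eval w := by
    intro z hz w
    rw [eval_eq_sum_range, (hpoly z hz).1]
    exact Finset.sum_congr rfl fun k _ => by rw [(hpoly z hz).2]
  have hPd : DifferentiableOn ℂ P (ball (0 : ℂ) r ×ˢ univ) := by
    refine DifferentiableOn.fun_sum fun k _ => DifferentiableOn.mul ?_ (by fun_prop)
    exact (hc k).comp (by fun_prop) fun p hp => hp.1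
  have hPlim : ∀ w, Tendsto (fun z => P (z, w)) (𝓝[≠] 0) (𝓝 (P (0, w))) := by
    intro w
    have h1 : ContinuousAt P (0, w) := hPd.continuousOn.continuousAt
      (prod_mem_nhds (ball_mem_nhds 0 hr) univ_mem)
    have h2 : Tendsto (fun z : ℂ => (z, w)) (𝓝[≠] 0) (𝓝 (0, w)) :=
      ((continuous_id.prodMk continuous_const).tendsto' 0 (0, w) rfl).mono_left nhdsWithin_le_nhds
    exact h1.tendsto.comp h2
  have hm : m ≠ 0 := by
    obtain ⟨z, hz, w, hw⟩ := hne
    obtain ⟨ι, hι, x, hx, hd, -⟩ := eval_fiberPoly (h := Prod.snd) hB hz 0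
    rw [← (hpoly z hz).1, hd]
    rw [hx] at hw
    obtain ⟨j, -⟩ := hw
    exact (Fintype.card_pos_iff.2 ⟨j⟩).ne'
  refine ⟨P, hPd, fun z hz w => ?_, m, hm, ?_⟩
  · rw [hP z hz, eval_fiberPoly_eq_zero_iff hB hz]
    simp
  -- the roots tend to zero with `z`, so the polynomial `P (0, ·)` is a power of `w`
  · intro w
    refine tendsto_nhds_unique (hPlim w) ?_
    rw [Metric.tendsto_nhds]
    intro η hη
    have hcont : ContinuousAt (fun t : ℝ => (‖w‖ + t) ^ m - ‖w‖ ^ m) 0 := by fun_prop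
    have hev := hcont.tendsto.eventually_lt_const (u := η) (by simpa using hη)
    obtain ⟨ε, hε, hball⟩ := Metric.eventually_nhds_iff_ball.1 hev
    obtain ⟨δ, hδ, hsm⟩ := hsmall (ε / 2) (half_pos hε)
    rw [eventually_nhdsWithin_iff]
    filter_upwards [ball_mem_nhds (0 : ℂ) hδ, ball_mem_nhds (0 : ℂ) hr] with z hz hzr hz0
    obtain ⟨ι, hι, x, hx, hd, he⟩ := eval_fiberPoly (h := Prod.snd) hB ⟨hzr, hz0⟩ w
    rw [hP z ⟨hzr, hz0⟩, he, dist_eq_norm]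
    rw [(hpoly z ⟨hzr, hz0⟩).1] at hd
    have hxs : ∀ j, ‖x j‖ ≤ ε / 2 := fun j =>
      (hsm z ⟨hz, hz0⟩ (x j) (by rw [hx]; exact ⟨j, rfl⟩)).le
    have key : ∀ s : Finset ι, ‖∏ j ∈ s, (w - x j) - w ^ s.card‖ ≤
        (‖w‖ + ε / 2) ^ s.card - ‖w‖ ^ s.card := by
      classical
      intro s
      induction s using Finset.induction_on with
      | empty => simp
      | insert j s hj ih =>
        rw [Finset.prod_insert hj, Finset.card_insert_of_notMem hj]
        have h1 : (w - x j) * ∏ i ∈ s, (w - x i) - w ^ (s.card + 1) =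
            (w - x j) * (∏ i ∈ s, (w - x i) - w ^ s.card) - x j * w ^ s.card := by ring
        rw [h1]
        refine (norm_sub_le _ _).trans ?_
        rw [norm_mul, norm_mul, norm_pow]
        have h2 : ‖w - x j‖ ≤ ‖w‖ + ε / 2 := (norm_sub_le _ _).trans (by gcongr; exact hxs j)
        have h3 : ‖w - x j‖ * ‖∏ i ∈ s, (w - x i) - w ^ s.card‖ ≤
            (‖w‖ + ε / 2) * ((‖w‖ + ε / 2) ^ s.card - ‖w‖ ^ s.card) :=
          mul_le_mul h2 ih (norm_nonneg _) (by positivity)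
        have h4 : ‖x j‖ * ‖w‖ ^ s.card ≤ ε / 2 * ‖w‖ ^ s.card := by gcongr; exact hxs j
        calc _ ≤ _ := add_le_add h3 h4
          _ = _ := by ring
    have h5 := key Finset.univ
    rw [Finset.card_univ, ← hd] at h5
    refine h5.trans_lt (hball (ε / 2) ?_)
    rw [mem_ball_zero_iff, Real.norm_of_nonneg (half_pos hε).le]
    linarith

end Weierstrass

end PlaneCurve

namespace PlaneCurve

/-! ### Functions on a curve near a point, modulo an ideal vanishing only there -/

section Ideal

open Set Filter Topology Metric Polynomial

variable {T O : Set (ℂ × ℂ)} {r r' : ℝ}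

lemma differentiableOn_prod_two {ι : Type*} (s : Finset ι) {f : ι → ℂ × ℂ → ℂ} {D : Set (ℂ × ℂ)}
    (hf : ∀ i, DifferentiableOn ℂ (f i) D) : DifferentiableOn ℂ (fun p => ∏ i ∈ s, f i p) D := by
  classical
  induction s using Finset.induction_on with
  | empty => simp
  | insert i s hi ih => simpa only [Finset.prod_insert hi] using (hf i).fun_mul ih

/-- The product of the values of `h` over the sheets on which it is not identically zero does not
vanish near the puncture, and its sign-adjusted extension is congruent to `0` modulo `h` on these
sheets. -/
lemma IsLocalCurve.exists_norm (hT : IsLocalCurve T r r') (hO : IsOpen O)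
    (hbox : closedBall (0 : ℂ) r ×ˢ closedBall (0 : ℂ) r' ⊆ O) {h : ℂ × ℂ → ℂ}
    (hh : DifferentiableOn ℂ h O) :
    ∃ (N : ℂ → ℂ) (q : ℂ × ℂ → ℂ), DifferentiableOn ℂ N (ball 0 r) ∧
      DifferentiableOn ℂ q (ball (0 : ℂ) r ×ˢ ball (0 : ℂ) r') ∧ (∀ᶠ z in 𝓝[≠] 0, N z ≠ 0) ∧
      ∀ z ∈ ball (0 : ℂ) r \ {0}, ∀ w ∈ fiber T r' z, (¬ ∀ᶠ y in 𝓝[T] (z, w), h y = 0) →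
        N z + h (z, w) * q (z, w) = 0 := by
  have hbox' : ball (0 : ℂ) r ×ˢ ball (0 : ℂ) r' ⊆ O :=
    (Set.prod_mono ball_subset_closedBall ball_subset_closedBall).trans hbox
  set B := nonvanishing T (fun _ : Unit => h) with hBdef
  have hB : IsSheeted B r r' := isSheeted_nonvanishing hT.sheeted hO hbox' (fun _ => hh)
  obtain ⟨M, hM⟩ := ((isCompact_closedBall (0 : ℂ) r).prod
    (isCompact_closedBall (0 : ℂ) r')).exists_bound_of_continuousOn (hh.continuousOn.mono hbox)
  obtain ⟨m, c, hc, hpoly⟩ := hB.exists_fiberPoly_eq hT.pos hO hbox' hh (M := M)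
    (fun z hz w hw => hM (z, w) ⟨ball_subset_closedBall hz.1, ball_subset_closedBall hw.1⟩)
  have hN0 : ∀ z ∈ ball (0 : ℂ) r \ {0}, c 0 z = 0 → ∃ w ∈ fiber B r' z, h (z, w) = 0 := by
    intro z hz h0
    rw [← (hpoly z hz).2, coeff_zero_eq_eval_zero] at h0
    exact (eval_fiberPoly_eq_zero_iff hB hz 0).1 h0
  refine ⟨c 0, fun p => ∑ k ∈ Finset.range m, c (k + 1) p.1 * h p ^ k, hc 0, ?_, ?_, ?_⟩
  · refine DifferentiableOn.fun_sum fun k _ => DifferentiableOn.mul ?_ ((hh.mono hbox').fun_pow k)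
    exact (hc (k + 1)).comp (by fun_prop) fun p hp => hp.1
  · have han : AnalyticAt ℂ (c 0) 0 := (hc 0).analyticAt (ball_mem_nhds 0 hT.pos)
    refine han.eventually_eq_zero_or_eventually_ne_zero.resolve_left fun hev => ?_
    -- otherwise the product of the values of `h` vanishes near some `z₁ ≠ 0`
    have hev' : ∀ᶠ z in 𝓝[≠] (0 : ℂ), (∀ᶠ z' in 𝓝 z, c 0 z' = 0) ∧ z ∈ ball (0 : ℂ) r \ {0} := by
      refine Filter.Eventually.and (nhdsWithin_le_nhds hev.eventually_nhds) ?_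
      filter_upwards [self_mem_nhdsWithin, nhdsWithin_le_nhds (ball_mem_nhds 0 hT.pos)] with z h1 h2
        using ⟨h2, h1⟩
    obtain ⟨z₁, hz₁, hz₁'⟩ := hev'.exists
    obtain ⟨ε, hε, hsub, ι, hι, b, hb, hfib⟩ := hB z₁ hz₁'
    have hbB : ∀ j, ∀ z ∈ ball z₁ ε, b j z ∈ fiber B r' z := fun j z hz => by
      rw [(hfib z hz).2]; exact ⟨j, rfl⟩
    have hne : ∀ j, ∀ᶠ z in 𝓝[≠] z₁, h (z, b j z) ≠ 0 := by
      intro j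
      have hd := (differentiableOn_comp_graph hO hh isOpen_ball (hb j) fun z hz =>
        hbox' ⟨(hsub hz).1, (hbB j z hz).1⟩).analyticAt (ball_mem_nhds z₁ hε)
      refine hd.eventually_eq_zero_or_eventually_ne_zero.resolve_left fun h0 => ?_
      refine (hbB j z₁ (mem_ball_self hε)).2.2 ?_
      have hcont : ContinuousAt (b j) z₁ := (hb j).continuousOn.continuousAt (ball_mem_nhds _ hε)
      have hloc := hT.sheeted.eventually_eq hz₁' hcont (by
        filter_upwards [ball_mem_nhds z₁ hε] with z hz
        exact ⟨(hbB j z hz).1, (hbB j z hz).2.1⟩)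
      filter_upwards [hloc, nhdsWithin_le_nhds
        ((continuousAt_fst (p := (z₁, b j z₁))).eventually h0)] with y hy hy0 _
      rwa [← hy] at hy0
    obtain ⟨z, ⟨hz1, hz2⟩, hz3⟩ := (((eventually_all.2 hne).and (nhdsWithin_le_nhds hz₁)).and
      (nhdsWithin_le_nhds (ball_mem_nhds z₁ hε))).exists
    obtain ⟨w, hw, hw0⟩ := hN0 z (hsub hz3) hz2
    rw [(hfib z hz3).2] at hw
    obtain ⟨j, rfl⟩ := hw
    exact hz1 j hw0
  · intro z hz w hw hnv
    have hwB : w ∈ fiber B r' z := ⟨hw.1, hw.2, fun h => hnv (h.mono fun y hy => hy ())⟩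
    have h0 := (eval_fiberPoly_eq_zero_iff (h := h) hB hz (h (z, w))).2 ⟨w, hwB, rfl⟩
    rw [eval_eq_sum_range, (hpoly z hz).1, Finset.sum_range_succ'] at h0
    simp only [(hpoly z hz).2, pow_zero, mul_one] at h0
    rw [← h0, Finset.mul_sum, add_comm]
    congr 1
    exact Finset.sum_congr rfl fun k _ => by ring

lemma IsLocalCurve.eq_zero_of_mem (hT : IsLocalCurve T r r') {x : ℂ × ℂ} (hx : x ∈ T)
    (hx2 : x.2 ∈ ball (0 : ℂ) r') (hx1 : x.1 = 0) : x = 0 := by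
  obtain ⟨z, w⟩ := x
  simp only at hx1 hx2
  subst hx1
  have : w ∈ fiber T r' 0 := ⟨hx2, hx⟩
  rw [hT.fiber_zero] at this
  rw [mem_singleton_iff.1 this]; rfl

/-- If the functions `h i` do not all vanish identically on any sheet, a power of the coordinate `z`
lies in the ideal they generate on the curve. -/
theorem IsLocalCurve.exists_pow_fst_eq (hT : IsLocalCurve T r r') (hO : IsOpen O)
    (hbox : closedBall (0 : ℂ) r ×ˢ closedBall (0 : ℂ) r' ⊆ O) {l : ℕ} {h : Fin l → ℂ × ℂ → ℂ}
    (hh : ∀ i, DifferentiableOn ℂ (h i) O)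
    (hne : ∀ z ∈ ball (0 : ℂ) r \ {0}, ∀ w ∈ fiber T r' z,
      ¬ ∀ᶠ y in 𝓝[T] (z, w), ∀ i, h i y = 0) :
    ∃ δ > 0, δ ≤ r ∧ ∃ (K : ℕ) (g : Fin l → ℂ × ℂ → ℂ),
      (∀ i, DifferentiableOn ℂ (g i) (ball (0 : ℂ) δ ×ˢ ball (0 : ℂ) r')) ∧
      ∀ z ∈ ball (0 : ℂ) δ, ∀ w ∈ fiber T r' z, z ^ K = ∑ i, g i (z, w) * h i (z, w) := by
  classical
  have hbox' : ball (0 : ℂ) r ×ˢ ball (0 : ℂ) r' ⊆ O :=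
    (Set.prod_mono ball_subset_closedBall ball_subset_closedBall).trans hbox
  choose N q hN hq hN0 hNq using fun i => hT.exists_norm hO hbox (hh i)
  have hNd : DifferentiableOn ℂ (fun z => ∏ i, N i z) (ball 0 r) :=
    DifferentiableOn.fun_finsetProd fun i _ => hN i
  have hNne : ¬ ∀ᶠ z in 𝓝 (0 : ℂ), ∏ i, N i z = 0 := fun hev => by
    obtain ⟨z, hz1, hz2⟩ := ((eventually_all.2 hN0).and (nhdsWithin_le_nhds hev)).exists
    exact Finset.prod_ne_zero_iff.2 (fun i _ => hz1 i) hz2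
  obtain ⟨K, u, hu, hu0, hNu⟩ := exists_eq_pow_mul isOpen_ball hNd (mem_ball_self hT.pos) hNne
  obtain ⟨δ, hδ, hball⟩ := Metric.eventually_nhds_iff_ball.1
    (((hu.continuousOn.continuousAt (ball_mem_nhds 0 hT.pos)).eventually_ne hu0).and
      (ball_mem_nhds 0 hT.pos))
  have hsub : ball (0 : ℂ) (min δ r) ⊆ ball 0 r := ball_subset_ball (min_le_right _ _)
  have hsub' : ball (0 : ℂ) (min δ r) ×ˢ ball (0 : ℂ) r' ⊆ ball (0 : ℂ) r ×ˢ ball (0 : ℂ) r' :=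
    Set.prod_mono_left hsub
  have hune : ∀ z ∈ ball (0 : ℂ) (min δ r), u z ≠ 0 := fun z hz =>
    (hball z (ball_subset_ball (min_le_left _ _) hz)).1
  have hfst : ∀ {F : ℂ → ℂ}, DifferentiableOn ℂ F (ball 0 r) →
      DifferentiableOn ℂ (fun p : ℂ × ℂ => F p.1) (ball (0 : ℂ) (min δ r) ×ˢ ball (0 : ℂ) r') :=
    fun hF => hF.comp (by fun_prop) fun p hp => hsub hp.1
  let g : Fin l → ℂ × ℂ → ℂ := fun i p => -(u p.1)⁻¹ * (q i p *
    (∏ j ∈ Finset.univ with j < i, (N j p.1 + h j p * q j p)) *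
      ∏ j ∈ Finset.univ with i < j, N j p.1)
  have hg : ∀ i, DifferentiableOn ℂ (g i) (ball (0 : ℂ) (min δ r) ×ˢ ball (0 : ℂ) r') := by
    intro i
    refine DifferentiableOn.fun_mul ((hfst hu).fun_inv fun p hp => hune p.1 hp.1).fun_neg ?_
    refine DifferentiableOn.fun_mul (DifferentiableOn.fun_mul ((hq i).mono hsub') ?_) ?_
    · refine differentiableOn_prod_two _ fun j => ?_
      exact (hfst (hN j)).fun_add
        (((hh j).mono (hsub'.trans hbox')).fun_mul ((hq j).mono hsub'))
    · exact differentiableOn_prod_two _ fun j => hfst (hN j)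
  have hpunct : ∀ z ∈ ball (0 : ℂ) (min δ r), z ≠ 0 → ∀ w ∈ fiber T r' z,
      z ^ K = ∑ i, g i (z, w) * h i (z, w) := by
    intro z hz hz0 w hw
    have hz' : z ∈ ball (0 : ℂ) r \ {0} := ⟨hsub hz, hz0⟩
    have hnv := hne z hz' w hw
    rw [eventually_all, not_forall] at hnv
    obtain ⟨i, hi⟩ := hnv
    have hprod : ∏ j, (N j z + h j (z, w) * q j (z, w)) = 0 :=
      Finset.prod_eq_zero (Finset.mem_univ i) (hNq i z hz' w hw hi)
    rw [Finset.prod_add_ordered, hNu z (hsub hz), sub_zero] at hprod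
    have hu' := hune z hz
    have h2 : z ^ K = (u z)⁻¹ * (z ^ K * u z) := by field_simp
    rw [h2, eq_neg_of_add_eq_zero_left hprod, ← Finset.sum_neg_distrib, Finset.mul_sum]
    refine Finset.sum_congr rfl fun j _ => ?_
    simp only [g]
    ring
  refine ⟨min δ r, lt_min hδ hT.pos, min_le_right _ _, K, g, hg, fun z hz w hw => ?_⟩
  by_cases hz0 : z = 0
  · -- at the origin, by continuity
    have hx := hT.eq_zero_of_mem hw.2 hw.1 hz0
    have hbmem : ball (0 : ℂ) (min δ r) ×ˢ ball (0 : ℂ) r' ∈ 𝓝 (0 : ℂ × ℂ) :=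
      prod_mem_nhds (ball_mem_nhds 0 (lt_min hδ hT.pos)) (ball_mem_nhds 0 hT.pos')
    have hc : ContinuousAt (fun p : ℂ × ℂ => p.1 ^ K - ∑ i, g i p * h i p) 0 := by
      refine ContinuousAt.sub (by fun_prop) ?_
      refine ContinuousOn.continuousAt (s := ball (0 : ℂ) (min δ r) ×ˢ ball (0 : ℂ) r') ?_ hbmem
      exact continuousOn_finsetSum _ fun i _ => ((hg i).continuousOn).fun_mul
        ((hh i).continuousOn.mono (hsub'.trans hbox'))
    have hfreq : ∃ᶠ p in 𝓝 (0 : ℂ × ℂ), p.1 ^ K - ∑ i, g i p * h i p = 0 := by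
      refine ((mem_closure_iff_frequently.1 hT.notIsolated).and_eventually hbmem).mono ?_
      rintro ⟨a, b⟩ ⟨⟨hpT, hp0⟩, hpb⟩
      rw [sub_eq_zero]
      exact hpunct a hpb.1 (fun ha => hp0 (hT.eq_zero_of_mem hpT hpb.2 ha)) b ⟨hpb.2, hpT⟩
    have h0 : (fun p : ℂ × ℂ => p.1 ^ K - ∑ i, g i p * h i p) 0 = 0 := by
      by_contra hcon
      exact hfreq (hc.eventually_ne hcon)
    rw [← hx] at h0
    exact sub_eq_zero.1 h0
  · exact hpunct z hz hz0 w hw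

/-- On the curve, a power of `w` is divisible by `z`. -/
lemma IsLocalCurve.exists_pow_snd_eq (hT : IsLocalCurve T r r') :
    ∃ (m : ℕ) (g : ℂ × ℂ → ℂ),
      DifferentiableOn ℂ g (ball (0 : ℂ) (min r r') ×ˢ ball (0 : ℂ) (min r r')) ∧
      ∀ p ∈ T, p ∈ ball (0 : ℂ) (min r r') ×ˢ ball (0 : ℂ) (min r r') → p.2 ^ m = p.1 * g p := by
  obtain ⟨P, hPd, hP, m, hm, hP0⟩ := hT.sheeted.exists_weierstrass hT.pos
    (fun ε hε => by
      obtain ⟨δ, hδ, h⟩ := hT.small ε hε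
      exact ⟨δ, hδ, fun z hz => h z hz.1⟩)
    (by
      have hbmem : ball (0 : ℂ) r ×ˢ ball (0 : ℂ) r' ∈ 𝓝 (0 : ℂ × ℂ) :=
        prod_mem_nhds (ball_mem_nhds 0 hT.pos) (ball_mem_nhds 0 hT.pos')
      obtain ⟨⟨a, b⟩, ⟨hpT, hp0⟩, hpb⟩ :=
        ((mem_closure_iff_frequently.1 hT.notIsolated).and_eventually hbmem).exists
      exact ⟨a, ⟨hpb.1, fun ha => hp0 (hT.eq_zero_of_mem hpT hpb.2 ha)⟩, b, hpb.2, hpT⟩)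
  have hsub : ball (0 : ℂ) (min r r') ×ˢ ball (0 : ℂ) (min r r') ⊆ ball (0 : ℂ) r ×ˢ univ :=
    Set.prod_mono (ball_subset_ball (min_le_left _ _)) (subset_univ _)
  obtain ⟨g, hg, hPg⟩ := exists_eq_add_fst_mul (hPd.mono hsub)
  refine ⟨m, fun p => -g p, hg.fun_neg, ?_⟩
  rintro ⟨z, w⟩ hpT ⟨hz, hw⟩
  have hw' : w ∈ ball (0 : ℂ) r' := ball_subset_ball (min_le_right _ _) hw
  have hz' : z ∈ ball (0 : ℂ) r := ball_subset_ball (min_le_left _ _) hz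
  have h0 : P (z, w) = 0 := by
    by_cases hz0 : z = 0
    · have := hT.eq_zero_of_mem hpT hw' hz0
      rw [Prod.mk_eq_zero] at this
      rw [this.1, this.2, hP0, zero_pow hm]
    · exact (hP z ⟨hz', hz0⟩ w).2 ⟨hw', hpT⟩
  have := hPg z w
  rw [h0, hP0] at this
  simp only [mul_neg]
  exact eq_neg_of_add_eq_zero_left this.symm

lemma exists_taylor_one {s : ℝ} {G : ℂ → ℂ} (hG : DifferentiableOn ℂ G (ball 0 s)) (M : ℕ) :
    ∃ (a : ℕ → ℂ) (G' : ℂ → ℂ), DifferentiableOn ℂ G' (ball 0 s) ∧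
      ∀ w, G w = ∑ j ∈ Finset.range M, a j * w ^ j + w ^ M * G' w := by
  induction M with
  | zero => exact ⟨0, G, hG, by simp⟩
  | succ M ih =>
    obtain ⟨a, G', hG', h⟩ := ih
    refine ⟨fun j => if j < M then a j else G' 0, dslope G' 0, ?_, fun w => ?_⟩
    · by_cases hs : 0 < s
      · exact (Complex.differentiableOn_dslope (ball_mem_nhds 0 hs)).2 hG'
      · rw [ball_eq_empty.2 (not_lt.1 hs)]
        exact fun _ h => h.elim
    · have h1 := sub_smul_dslope G' 0 w
      simp only [sub_zero, smul_eq_mul] at h1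
      rw [h w, Finset.sum_range_succ, pow_succ, mul_assoc, h1]
      simp only [lt_irrefl, if_false]
      rw [Finset.sum_congr (f := fun j => (if j < M then a j else G' 0) * w ^ j)
        (g := fun j => a j * w ^ j) (s₁ := Finset.range M) rfl
        fun j hj => by rw [if_pos (Finset.mem_range.1 hj)]]
      ring

/-- Division by the monomials `z ^ K` and `w ^ M`, with a polynomial remainder. -/
lemma exists_taylor {s : ℝ} {f : ℂ × ℂ → ℂ}
    (hf : DifferentiableOn ℂ f (ball (0 : ℂ) s ×ˢ ball (0 : ℂ) s)) (K M : ℕ) :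
    ∃ (a : ℕ → ℕ → ℂ) (g₁ g₂ : ℂ × ℂ → ℂ),
      DifferentiableOn ℂ g₁ (ball (0 : ℂ) s ×ˢ ball (0 : ℂ) s) ∧
      DifferentiableOn ℂ g₂ (ball (0 : ℂ) s ×ˢ ball (0 : ℂ) s) ∧
      ∀ z w, f (z, w) = ∑ i ∈ Finset.range K, ∑ j ∈ Finset.range M, a i j * (z ^ i * w ^ j) +
        z ^ K * g₁ (z, w) + w ^ M * g₂ (z, w) := by
  induction K with
  | zero => exact ⟨0, f, 0, hf, differentiableOn_const _, by simp⟩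
  | succ K ih =>
    obtain ⟨a, g₁, g₂, h₁, h₂, h⟩ := ih
    obtain ⟨g, hg, hg'⟩ := exists_eq_add_fst_mul h₁
    have hG : DifferentiableOn ℂ (fun w => g₁ (0, w)) (ball 0 s) := by
      intro w hw
      have hs : 0 < s := (norm_nonneg _).trans_lt (mem_ball_zero_iff.1 hw)
      exact ((h₁.separatelyHolomorphicOn (isOpen_ball.prod isOpen_ball)) (0, w)
        ⟨mem_ball_self hs, hw⟩).2.differentiableWithinAt
    obtain ⟨α, G', hG', hα⟩ := exists_taylor_one hG M
    refine ⟨fun i => if i < K then a i else α, g, fun p => g₂ p + p.1 ^ K * G' p.2, hg, ?_, ?_⟩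
    · exact h₂.fun_add (DifferentiableOn.fun_mul (by fun_prop)
        (hG'.comp (by fun_prop) fun p hp => hp.2))
    · intro z w
      rw [h z w, hg' z w, hα w, Finset.sum_range_succ]
      simp only [lt_irrefl, if_false]
      rw [Finset.sum_congr (g := fun i => ∑ j ∈ Finset.range M, a i j * (z ^ i * w ^ j))
        (f := fun i => ∑ j ∈ Finset.range M, (if i < K then a i else α) j * (z ^ i * w ^ j))
        (s₁ := Finset.range K) rfl fun i hi => by rw [if_pos (Finset.mem_range.1 hi)]]
      have e : ∑ j ∈ Finset.range M, α j * (z ^ K * w ^ j) =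
          z ^ K * ∑ j ∈ Finset.range M, α j * w ^ j := by
        rw [Finset.mul_sum]
        exact Finset.sum_congr rfl fun j _ => by ring
      rw [e]
      ring

/-- Near the origin, functions on the curve are polynomials of bounded degree modulo the ideal
generated by functions `h i` that do not all vanish identically on any sheet. -/
theorem IsLocalCurve.exists_polynomial_mod (hT : IsLocalCurve T r r') (hO : IsOpen O)
    (hbox : closedBall (0 : ℂ) r ×ˢ closedBall (0 : ℂ) r' ⊆ O) {l : ℕ} {h : Fin l → ℂ × ℂ → ℂ}
    (hh : ∀ i, DifferentiableOn ℂ (h i) O)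
    (hne : ∀ z ∈ ball (0 : ℂ) r \ {0}, ∀ w ∈ fiber T r' z,
      ¬ ∀ᶠ y in 𝓝[T] (z, w), ∀ i, h i y = 0) :
    ∃ δ > 0, ball (0 : ℂ) δ ×ˢ ball (0 : ℂ) δ ⊆ O ∧
      (∀ p ∈ T, p ∈ ball (0 : ℂ) δ ×ˢ ball (0 : ℂ) δ → p ≠ 0 → ∃ i, h i p ≠ 0) ∧
      ∃ K M : ℕ, ∀ s, s ≤ δ → ∀ f : ℂ × ℂ → ℂ,
        DifferentiableOn ℂ f (ball (0 : ℂ) s ×ˢ ball (0 : ℂ) s) →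
        ∃ (a : ℕ → ℕ → ℂ) (g : Fin l → ℂ × ℂ → ℂ),
          (∀ i, DifferentiableOn ℂ (g i) (ball (0 : ℂ) s ×ˢ ball (0 : ℂ) s)) ∧
          ∀ p ∈ T, p ∈ ball (0 : ℂ) s ×ˢ ball (0 : ℂ) s →
            f p = ∑ i ∈ Finset.range K, ∑ j ∈ Finset.range M, a i j * (p.1 ^ i * p.2 ^ j) +
              ∑ i, g i p * h i p := by
  obtain ⟨δ₁, hδ₁, hδ₁r, K, g, hg, hKg⟩ := hT.exists_pow_fst_eq hO hbox hh hne
  obtain ⟨m, γ, hγ, hmγ⟩ := hT.exists_pow_snd_eq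
  let δ := min δ₁ (min r r')
  have hδr' : δ ≤ r' := (min_le_right _ _).trans (min_le_right _ _)
  have hδr : δ ≤ min r r' := min_le_right _ _
  refine ⟨δ, lt_min hδ₁ (lt_min hT.pos hT.pos'), ?_, ?_, K, m * K, fun s hs f hf => ?_⟩
  · refine (Set.prod_mono ?_ ?_).trans hbox
    · exact (ball_subset_ball (hδr.trans (min_le_left _ _))).trans ball_subset_closedBall
    · exact (ball_subset_ball hδr').trans ball_subset_closedBall
  · rintro ⟨z, w⟩ hp ⟨hz, hw⟩ hp0
    by_contra! hcon
    have hw' := ball_subset_ball hδr' hw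
    have := hKg z (ball_subset_ball (min_le_left _ _) hz) w ⟨hw', hp⟩
    simp only [hcon, mul_zero, Finset.sum_const_zero] at this
    exact hp0 (hT.eq_zero_of_mem hp hw' (eq_zero_of_pow_eq_zero this))
  · obtain ⟨a, g₁, g₂, h₁, h₂, hfa⟩ := exists_taylor hf K (m * K)
    have hs1 : ball (0 : ℂ) s ×ˢ ball (0 : ℂ) s ⊆ ball (0 : ℂ) δ₁ ×ˢ ball (0 : ℂ) r' :=
      Set.prod_mono (ball_subset_ball (hs.trans (min_le_left _ _)))
        (ball_subset_ball (hs.trans hδr'))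
    have hs2 : ball (0 : ℂ) s ×ˢ ball (0 : ℂ) s ⊆
        ball (0 : ℂ) (min r r') ×ˢ ball (0 : ℂ) (min r r') :=
      Set.prod_mono (ball_subset_ball (hs.trans hδr)) (ball_subset_ball (hs.trans hδr))
    refine ⟨a, fun i p => (g₁ p + γ p ^ K * g₂ p) * g i p, fun i => ?_, ?_⟩
    · exact (h₁.fun_add (((hγ.mono hs2).fun_pow K).fun_mul h₂)).fun_mul ((hg i).mono hs1)
    · rintro ⟨z, w⟩ hp hps
      have e1 := hKg z (hs1 hps).1 w ⟨(hs1 hps).2, hp⟩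
      have e2 := hmγ (z, w) hp (hs2 hps)
      simp only at e2
      rw [hfa z w, pow_mul, e2]
      simp only [mul_assoc]
      rw [← Finset.mul_sum, ← e1]
      ring

end Ideal

end PlaneCurve

namespace PlaneCurve

/-! ### Holomorphic coordinates adapted to a function -/

section Coordinates

open Set Filter Topology Metric ZStability

lemma not_eventually_line_eq_zero {G : C2 → ℂ} {ρ : ℝ} (hG : DifferentiableOn ℂ G (ball 0 ρ))
    {v : C2} (hv : v ∈ ball (0 : C2) ρ) (hGv : G v ≠ 0) : ¬ ∀ᶠ w in 𝓝 (0 : ℂ), G (w • v) = 0 := by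
  intro hev
  have hρ : 0 < ρ := pos_of_mem_ball hv
  let ℓ : ℂ →L[ℂ] C2 := (ContinuousLinearMap.id ℂ ℂ).smulRight v
  have hS : IsOpen (ℓ ⁻¹' ball 0 ρ) := isOpen_ball.preimage ℓ.continuous
  have hc : Convex ℝ (ℓ ⁻¹' ball 0 ρ) :=
    (convex_ball (0 : C2) ρ).linear_preimage (ℓ.restrictScalars ℝ).toLinearMap
  have hd : DifferentiableOn ℂ (fun w => G (ℓ w)) (ℓ ⁻¹' ball 0 ρ) :=
    hG.comp ℓ.differentiable.differentiableOn fun _ h => h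
  have h1 : (1 : ℂ) ∈ ℓ ⁻¹' ball 0 ρ := by simpa [ℓ] using hv
  have := (hd.analyticOnNhd hS).eqOn_zero_of_preconnected_of_eventuallyEq_zero hc.isPreconnected
    (z₀ := 0) (by simpa [ℓ] using hρ) (by filter_upwards [hev] with w hw; simpa [ℓ] using hw) h1
  exact hGv (by simpa [ℓ] using this)

/-- Linear coordinates on `ℂ²` such that a given nonzero germ vanishes identically on neither
axis. -/
lemma exists_linearEquiv_nonvanishing {G : C2 → ℂ} {O : Set C2} (hO : IsOpen O) (h0 : (0 : C2) ∈ O)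
    (hG : DifferentiableOn ℂ G O) (hne : ¬ ∀ᶠ v in 𝓝 0, G v = 0) :
    ∃ L : (ℂ × ℂ) ≃L[ℂ] C2, (¬ ∀ᶠ w in 𝓝 (0 : ℂ), G (L (0, w)) = 0) ∧
      ¬ ∀ᶠ w in 𝓝 (0 : ℂ), G (L (w, 0)) = 0 := by
  obtain ⟨ρ, hρ, hsub⟩ := Metric.isOpen_iff.1 hO 0 h0
  have hGρ := hG.mono hsub
  have hW : IsOpen {v ∈ ball (0 : C2) ρ | G v ≠ 0} := by
    have := hGρ.continuousOn.isOpen_inter_preimage isOpen_ball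
      (isOpen_compl_singleton (x := (0 : ℂ)))
    exact this
  set W := {v ∈ ball (0 : C2) ρ | G v ≠ 0} with hWdef
  have hWne : W.Nonempty := by
    by_contra hemp
    refine hne ?_
    filter_upwards [ball_mem_nhds (0 : C2) hρ] with v hv
    by_contra hGv
    exact hemp ⟨v, hv, hGv⟩
  -- a nonempty open subset of `ℂ²` lies in no proper subspace
  have key : ∀ K : Submodule ℂ C2, K ≠ ⊤ → ∃ v ∈ W, v ∉ K := by
    intro K hK
    by_contra! hcon
    exact hK (K.eq_top_of_nonempty_interior' (hWne.mono (interior_maximal hcon hW)))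
  have hfr : Module.finrank ℂ C2 = 2 := by simp
  obtain ⟨v₁, hv₁, hv₁0⟩ := key ⊥ (by
    intro h
    have := finrank_top ℂ C2
    rw [← h, finrank_bot, hfr] at this
    omega)
  obtain ⟨v₂, hv₂, hv₂s⟩ := key (Submodule.span ℂ {v₁}) (by
    intro h
    have h1 := finrank_top ℂ C2
    have h2 := finrank_span_le_card (R := ℂ) ({v₁} : Set C2)
    rw [h, h1, hfr] at h2
    simp at h2)
  have hli : LinearIndependent ℂ ![v₁, v₂] := by
    refine (LinearIndependent.pair_iff' (by simpa using hv₁0)).2 fun a ha => hv₂s ?_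
    rw [← ha]
    exact Submodule.smul_mem _ _ (Submodule.mem_span_singleton_self v₁)
  let f : (ℂ × ℂ) →ₗ[ℂ] C2 :=
    (LinearMap.id.smulRight v₁).coprod (LinearMap.id.smulRight v₂)
  have hf : ∀ z w : ℂ, f (z, w) = z • v₁ + w • v₂ := fun z w => by simp [f]
  have hinj : Function.Injective f := by
    rw [injective_iff_map_eq_zero]
    rintro ⟨z, w⟩ h
    rw [hf] at h
    have := LinearIndependent.pair_iff.1 hli z w h
    simp [this.1, this.2]
  refine ⟨(LinearMap.linearEquivOfInjective f hinj (by simp)).toContinuousLinearEquiv, ?_, ?_⟩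
  · simpa [hf] using not_eventually_line_eq_zero hGρ hv₂.1 hv₂.2
  · simpa [hf] using not_eventually_line_eq_zero hGρ hv₁.1 hv₁.2

variable {X : Type u} [TopologicalSpace X] [ChartedSpace C2 X]

/-- Holomorphic coordinates `(z, w)` on an open subset of the surface, which differ from a chart of
the atlas by an affine map. -/
structure IsHolomorphicChart (Φ : OpenPartialHomeomorph X (ℂ × ℂ)) : Prop where
  mdifferentiableOn : MDifferentiableOn 𝓘(ℂ, C2) 𝓘(ℂ, ℂ × ℂ) Φ Φ.source
  mdifferentiableOn_symm : MDifferentiableOn 𝓘(ℂ, ℂ × ℂ) 𝓘(ℂ, C2) Φ.symm Φ.target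
  exists_affine : ∃ e ∈ atlas C2 X, e.source = Φ.source ∧
    ∃ (L : (ℂ × ℂ) →L[ℂ] C2) (c : C2), ∀ x ∈ Φ.source, e x = c + L (Φ x)

namespace IsHolomorphicChart

variable {Φ : OpenPartialHomeomorph X (ℂ × ℂ)}

lemma differentiableOn_comp_symm (hΦ : IsHolomorphicChart Φ) {f : X → ℂ} {U : Set X}
    (hf : MDifferentiableOn 𝓘(ℂ, C2) 𝓘(ℂ, ℂ) f U) :
    DifferentiableOn ℂ (f ∘ Φ.symm) (Φ.target ∩ Φ.symm ⁻¹' U) := by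
  rw [← mdifferentiableOn_iff_differentiableOn]
  exact hf.comp (hΦ.mdifferentiableOn_symm.mono inter_subset_left) inter_subset_right

lemma mdifferentiableOn_comp (hΦ : IsHolomorphicChart Φ) {g : ℂ × ℂ → ℂ} {O : Set (ℂ × ℂ)}
    (hg : DifferentiableOn ℂ g O) :
    MDifferentiableOn 𝓘(ℂ, C2) 𝓘(ℂ, ℂ) (g ∘ Φ) (Φ.source ∩ Φ ⁻¹' O) := by
  rw [← mdifferentiableOn_iff_differentiableOn] at hg
  exact hg.comp (hΦ.mdifferentiableOn.mono inter_subset_left) inter_subset_right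

end IsHolomorphicChart

/-- A chart centred at `p`, followed by a linear change of coordinates. -/
lemma exists_isHolomorphicChart [IsManifold 𝓘(ℂ, C2) ω X] (p : X) (L : (ℂ × ℂ) ≃L[ℂ] C2) :
    ∃ Φ : OpenPartialHomeomorph X (ℂ × ℂ), IsHolomorphicChart Φ ∧ p ∈ Φ.source ∧ Φ p = 0 ∧
      ∀ x, Φ.symm x = (chartAt C2 p).symm (chartAt C2 p p + L x) := by
  have : IsManifold 𝓘(ℂ, C2) 1 X := IsManifold.of_le (n := ω) le_top
  let e := chartAt C2 p
  let h : C2 ≃ₜ ℂ × ℂ := (Homeomorph.subRight (e p)).trans L.symm.toHomeomorph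
  have hs : ∀ x, (e.transHomeomorph h).symm x = e.symm (e p + L x) := fun x => by
    simp [h, OpenPartialHomeomorph.transHomeomorph, add_comm]
  refine ⟨e.transHomeomorph h, ⟨?_, ?_, e, chart_mem_atlas C2 p, rfl, L, e p, ?_⟩,
    mem_chart_source C2 p, ?_, hs⟩
  · have h1 : MDifferentiableOn 𝓘(ℂ, C2) 𝓘(ℂ, ℂ × ℂ) h univ := by
      rw [mdifferentiableOn_iff_differentiableOn]
      exact (L.symm.differentiable.comp (differentiable_id.sub_const (e p))).differentiableOn
    exact h1.comp (mdifferentiableOn_atlas (chart_mem_atlas C2 p)) fun _ _ => trivial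
  · have h1 : MDifferentiableOn 𝓘(ℂ, ℂ × ℂ) 𝓘(ℂ, C2) h.symm univ := by
      rw [mdifferentiableOn_iff_differentiableOn]
      exact ((L.differentiable).add_const (e p)).differentiableOn
    exact (mdifferentiableOn_atlas_symm (chart_mem_atlas C2 p)).comp
      (h1.mono (subset_univ _)) fun x hx => hx
  · intro x _
    simp [h]
  · simp [h, e]

/-- Coordinates centred at `p` in which a holomorphic function not vanishing near `p` vanishes
identically on neither axis. -/
lemma exists_isHolomorphicChart_nonvanishing [IsManifold 𝓘(ℂ, C2) ω X] {p : X} {U : Set X}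
    (hU : IsOpen U) (hp : p ∈ U) {f : X → ℂ} (hf : MDifferentiableOn 𝓘(ℂ, C2) 𝓘(ℂ, ℂ) f U)
    (hne : ¬ ∀ᶠ x in 𝓝 p, f x = 0) :
    ∃ Φ : OpenPartialHomeomorph X (ℂ × ℂ), IsHolomorphicChart Φ ∧ p ∈ Φ.source ∧ Φ p = 0 ∧
      (¬ ∀ᶠ w in 𝓝 (0 : ℂ), f (Φ.symm (0, w)) = 0) ∧
      ¬ ∀ᶠ w in 𝓝 (0 : ℂ), f (Φ.symm (w, 0)) = 0 := by
  have : IsManifold 𝓘(ℂ, C2) 1 X := IsManifold.of_le (n := ω) le_top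
  let e := chartAt C2 p
  have hpe : p ∈ e.source := mem_chart_source C2 p
  let O : Set C2 := {v | e p + v ∈ e.target ∩ e.symm ⁻¹' U}
  have hO₀ : IsOpen (e.target ∩ e.symm ⁻¹' U) := e.isOpen_inter_preimage_symm hU
  have hO : IsOpen O := hO₀.preimage (by fun_prop)
  have h0 : (0 : C2) ∈ O := by
    simp [O, e.map_source hpe, e.left_inv hpe, hp]
  have hfe : DifferentiableOn ℂ (f ∘ e.symm) (e.target ∩ e.symm ⁻¹' U) := by
    rw [← mdifferentiableOn_iff_differentiableOn]
    exact hf.comp ((mdifferentiableOn_atlas_symm (chart_mem_atlas C2 p)).mono inter_subset_left)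
      inter_subset_right
  have hG : DifferentiableOn ℂ (fun v => f (e.symm (e p + v))) O :=
    hfe.comp (f := fun v => e p + v) (by fun_prop) fun _ h => h
  obtain ⟨L, hL1, hL2⟩ := exists_linearEquiv_nonvanishing hO h0 hG (by
    intro hev
    refine hne ?_
    have ht : Tendsto (fun x => e x - e p) (𝓝 p) (𝓝 0) := by
      have := (e.continuousAt hpe).sub_const (e p)
      simpa [ContinuousAt] using this
    filter_upwards [ht.eventually hev, e.open_source.mem_nhds hpe] with x hx hxs
    simpa [e.left_inv hxs] using hx)
  obtain ⟨Φ, hΦ, hpΦ, hΦ0, hsymm⟩ := exists_isHolomorphicChart p L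
  exact ⟨Φ, hΦ, hpΦ, hΦ0, by simpa only [hsymm] using hL1, by simpa only [hsymm] using hL2⟩

end Coordinates

end PlaneCurve

namespace PlaneCurve

/-! ### Curves in adapted coordinates -/

section Curves

open Set Filter Topology Metric ZStability

variable {X : Type u} [TopologicalSpace X] [ChartedSpace C2 X] {V : Set X}

/-- A curve has empty interior: at a regular point it is the zero set of a function with nonzero
differential. -/
lemma exists_notMem_of_isCurve (hV : IsCurve V) {p : X} (hp : p ∈ V) {U : Set X} (hU : IsOpen U)
    (hpU : p ∈ U) : ∃ x ∈ U, x ∉ V := by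
  by_contra! hcon
  obtain ⟨q, hqU, -, U', hU', hqU', f, hf, hdf, hVf⟩ :=
    _root_.mem_closure_iff.1 (hV.2 hp) U hU hpU
  refine hdf ?_
  have : f =ᶠ[𝓝 q] fun _ => 0 := by
    filter_upwards [hU.mem_nhds hqU, hU'.mem_nhds hqU'] with x hx hx'
    have : x ∈ V ∩ U' := ⟨hcon x hx, hx'⟩
    rw [hVf] at this
    exact this.2
  rw [this.mfderiv_eq]
  exact mfderiv_const

/-- The image of `V` in the coordinates `Φ`. -/
def trace (Φ : OpenPartialHomeomorph X (ℂ × ℂ)) (V : Set X) : Set (ℂ × ℂ) :=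
  Φ.target ∩ Φ.symm ⁻¹' V

/-- A curve has no isolated points: it would have a regular one, and in coordinates the zero set of
a function of two variables has none. -/
lemma mem_closure_diff_of_isCurve [IsManifold 𝓘(ℂ, C2) ω X] (hV : IsCurve V) {p : X}
    (hp : p ∈ V) : p ∈ closure (V \ {p}) := by
  by_contra hcl
  obtain ⟨N, hN, hpN, hNV⟩ : ∃ N : Set X, IsOpen N ∧ p ∈ N ∧ ∀ x ∈ N, x ∈ V → x = p := by
    rw [_root_.mem_closure_iff] at hcl
    push Not at hcl
    obtain ⟨N, hN, hpN, h⟩ := hcl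
    refine ⟨N, hN, hpN, fun x hx hxV => ?_⟩
    by_contra hne
    exact (h ▸ (show x ∈ N ∩ (V \ {p}) from ⟨hx, hxV, hne⟩) : x ∈ (∅ : Set X))
  obtain ⟨q, hqN, hqr⟩ := _root_.mem_closure_iff.1 (hV.2 hp) N hN hpN
  obtain rfl : q = p := hNV q hqN hqr.1
  obtain ⟨-, U, hU, hqU, f, hf, -, hVf⟩ := hqr
  have hne : ¬ ∀ᶠ x in 𝓝 q, f x = 0 := by
    intro hev
    obtain ⟨W, hW, hWo, hqW⟩ := eventually_nhds_iff.1 hev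
    obtain ⟨x, hx, hxV⟩ := exists_notMem_of_isCurve hV hp (hWo.inter hU) ⟨hqW, hqU⟩
    have : x ∈ {x ∈ U | f x = 0} := ⟨hx.2, hW x hx.1⟩
    rw [← hVf] at this
    exact hxV this.1
  obtain ⟨Φ, hΦ, hqΦ, hΦ0, hne1, -⟩ := exists_isHolomorphicChart_nonvanishing hU hqU hf hne
  have hqs : Φ.symm 0 = q := by rw [← hΦ0, Φ.left_inv hqΦ]
  have hO : IsOpen (Φ.target ∩ Φ.symm ⁻¹' (U ∩ N)) := Φ.isOpen_inter_preimage_symm (hU.inter hN)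
  have h0 : ((0 : ℂ), (0 : ℂ)) ∈ Φ.target ∩ Φ.symm ⁻¹' (U ∩ N) := by
    refine ⟨by rw [← Prod.zero_eq_mk, ← hΦ0]; exact Φ.map_source hqΦ, ?_⟩
    rw [mem_preimage, ← Prod.zero_eq_mk, hqs]
    exact ⟨hqU, hqN⟩
  have hfd := (hΦ.differentiableOn_comp_symm hf).mono (inter_subset_inter_right Φ.target
    (preimage_mono (f := Φ.symm) (inter_subset_left (s := U) (t := N))))
  obtain ⟨r', hr', -, -, r, hr, -, hZ⟩ := exists_zeroFree hO h0 hfd hne1 one_pos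
  have hf0 : f q = 0 := by
    have : q ∈ V ∩ U := ⟨hp, hqU⟩
    rw [hVf] at this
    exact this.2
  have hz0 : (ZeroFree.zeros (f ∘ Φ.symm) 0 r' 0).Nonempty :=
    ⟨0, mem_ball_self hr', by simp [← Prod.zero_eq_mk, hqs, hf0]⟩
  rw [hZ.zeros_nonempty_iff (mem_ball_self hr)] at hz0
  -- the number of zeros on the nearby circles is constant, so `q` is not isolated
  obtain ⟨z, ⟨hz, hzr⟩, hz0'⟩ : ∃ z : ℂ, (powerSum (f ∘ Φ.symm) 0 r' 0 z =
      powerSum (f ∘ Φ.symm) 0 r' 0 0 ∧ z ∈ ball (0 : ℂ) r) ∧ z ≠ 0 := by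
    have h1 := (hZ.eventually_powerSum_zero_eq (mem_ball_self hr)).and (ball_mem_nhds (0 : ℂ) hr)
    have h2 : ∀ᶠ z in 𝓝[≠] (0 : ℂ), _ := h1.filter_mono nhdsWithin_le_nhds
    exact (h2.and self_mem_nhdsWithin).exists
  rw [← hz, ← hZ.zeros_nonempty_iff hzr] at hz0
  obtain ⟨w, hw, hfw⟩ := hz0
  have hmem := hZ.subset (mk_mem_prod hzr (ball_subset_closedBall hw))
  have hxV : Φ.symm (z, w) ∈ V := by
    have : Φ.symm (z, w) ∈ {x ∈ U | f x = 0} := ⟨hmem.2.1, hfw⟩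
    rw [← hVf] at this
    exact this.1
  have := hNV _ hmem.2.2 hxV
  have h3 : Φ (Φ.symm (z, w)) = 0 := by rw [this, hΦ0]
  rw [Φ.right_inv hmem.1] at h3
  exact hz0' (congrArg Prod.fst h3)

/-- Coordinates `Φ` centred at a point `p` of a curve `V`, together with radii of a bidisc in which
`V` is a local curve, and a neighbourhood `O` of the bidisc on which `f` is a holomorphic function
that vanishes on `V` but identically on neither axis. -/
structure AdaptedChart (V : Set X) (p : X) (U : Set X) (Φ : OpenPartialHomeomorph X (ℂ × ℂ))
    (O : Set (ℂ × ℂ)) (f : ℂ × ℂ → ℂ) (r r' : ℝ) : Prop where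
  chart : IsHolomorphicChart Φ
  mem_source : p ∈ Φ.source
  center : Φ p = 0
  isOpen : IsOpen O
  subset : O ⊆ Φ.target ∩ Φ.symm ⁻¹' U
  box_subset : closedBall (0 : ℂ) r ×ˢ closedBall (0 : ℂ) r' ⊆ O
  diff : DifferentiableOn ℂ f O
  eq_zero : ∀ x ∈ trace Φ V, x ∈ O → f x = 0
  not_eventually_snd : ¬ ∀ᶠ w in 𝓝 (0 : ℂ), f (0, w) = 0
  not_eventually_fst : ¬ ∀ᶠ w in 𝓝 (0 : ℂ), f (w, 0) = 0
  isLocalCurve : IsLocalCurve (trace Φ V) r r'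

/-- Every point of a curve has coordinates in which the curve is a branched union of sheets over the
first coordinate. -/
theorem exists_adaptedChart [IsManifold 𝓘(ℂ, C2) ω X] (hV : IsCurve V) {p : X} (hp : p ∈ V)
    {U : Set X} (hU : IsOpen U) (hpU : p ∈ U) :
    ∃ Φ O f r r', AdaptedChart V p U Φ O f r r' := by
  obtain ⟨U', hU', hpU', n, F, hF, hVF⟩ := hV.1.1.2 p hp
  obtain ⟨i₀, hne⟩ : ∃ i, ¬ ∀ᶠ x in 𝓝 p, F i x = 0 := by
    by_contra! hcon
    rw [← eventually_all] at hcon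
    obtain ⟨W, hW, hWo, hpW⟩ := eventually_nhds_iff.1 hcon
    obtain ⟨x, hx, hxV⟩ := exists_notMem_of_isCurve hV hp (hWo.inter hU') ⟨hpW, hpU'⟩
    have : x ∈ {x ∈ U' | ∀ i, F i x = 0} := ⟨hx.2, hW x hx.1⟩
    rw [← hVF] at this
    exact hxV this.1
  obtain ⟨Φ, hΦ, hpΦ, hΦ0, hne1, hne2⟩ :=
    exists_isHolomorphicChart_nonvanishing hU' hpU' (hF i₀) hne
  have hps : Φ.symm 0 = p := by rw [← hΦ0, Φ.left_inv hpΦ]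
  have h0t : (0 : ℂ × ℂ) ∈ Φ.target := by rw [← hΦ0]; exact Φ.map_source hpΦ
  have hO : IsOpen (Φ.target ∩ Φ.symm ⁻¹' (U' ∩ U)) := Φ.isOpen_inter_preimage_symm (hU'.inter hU)
  have h0 : (0 : ℂ × ℂ) ∈ Φ.target ∩ Φ.symm ⁻¹' (U' ∩ U) :=
    ⟨h0t, by rw [mem_preimage, hps]; exact ⟨hpU', hpU⟩⟩
  have hFd : ∀ i, DifferentiableOn ℂ (F i ∘ Φ.symm) (Φ.target ∩ Φ.symm ⁻¹' (U' ∩ U)) := fun i =>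
    (hΦ.differentiableOn_comp_symm (hF i)).mono (inter_subset_inter_right Φ.target
      (preimage_mono (f := Φ.symm) (inter_subset_left (s := U') (t := U))))
  have hT : trace Φ V ∩ (Φ.target ∩ Φ.symm ⁻¹' (U' ∩ U)) =
      {x ∈ Φ.target ∩ Φ.symm ⁻¹' (U' ∩ U) | ∀ i, (F i ∘ Φ.symm) x = 0} := by
    ext x
    constructor
    · rintro ⟨hx, hxO⟩
      have : Φ.symm x ∈ V ∩ U' := ⟨hx.2, hxO.2.1⟩
      rw [hVF] at this
      exact ⟨hxO, this.2⟩
    · rintro ⟨hxO, hx⟩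
      have : Φ.symm x ∈ {x ∈ U' | ∀ i, F i x = 0} := ⟨hxO.2.1, hx⟩
      rw [← hVF] at this
      exact ⟨⟨hxO.1, this.1⟩, hxO⟩
  have hacc : ∀ x ∈ trace Φ V ∩ (Φ.target ∩ Φ.symm ⁻¹' (U' ∩ U)),
      x ∈ closure (trace Φ V \ {x}) := by
    rintro x ⟨hx, -⟩
    rw [_root_.mem_closure_iff]
    intro W hW hxW
    have hW' : IsOpen (Φ.source ∩ Φ ⁻¹' W) := Φ.isOpen_inter_preimage hW
    obtain ⟨y, ⟨hys, hyW⟩, hyV, hyne⟩ :=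
      _root_.mem_closure_iff.1 (mem_closure_diff_of_isCurve hV hx.2) _ hW'
      ⟨Φ.map_target hx.1, by rwa [mem_preimage, Φ.right_inv hx.1]⟩
    refine ⟨Φ y, hyW, ⟨Φ.map_source hys, by rwa [mem_preimage, Φ.left_inv hys]⟩, fun h => hyne ?_⟩
    rw [mem_singleton_iff] at h ⊢
    rw [← h, Φ.left_inv hys]
  obtain ⟨r, r', -, -, hbox, hcurve⟩ := exists_isLocalCurve hO h0 hFd hT
    ⟨h0t, by rwa [mem_preimage, hps]⟩ hacc hne1 one_pos
  refine ⟨Φ, _, F i₀ ∘ Φ.symm, r, r', hΦ, hpΦ, hΦ0, hO, ?_, hbox, hFd i₀, ?_, hne1, hne2, hcurve⟩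
  · exact fun x hx => ⟨hx.1, hx.2.2⟩
  · intro x hx hxO
    have : x ∈ trace Φ V ∩ (Φ.target ∩ Φ.symm ⁻¹' (U' ∩ U)) := ⟨hx, hxO⟩
    rw [hT] at this
    exact this.2 i₀

namespace AdaptedChart

variable {p : X} {U : Set X} {Φ : OpenPartialHomeomorph X (ℂ × ℂ)} {O : Set (ℂ × ℂ)}
  {f : ℂ × ℂ → ℂ} {r r' : ℝ}

lemma zero_mem (h : AdaptedChart V p U Φ O f r r') : (0 : ℂ × ℂ) ∈ O :=
  h.box_subset ⟨mem_closedBall_self h.isLocalCurve.pos.le,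
    mem_closedBall_self h.isLocalCurve.pos'.le⟩

lemma symm_zero (h : AdaptedChart V p U Φ O f r r') : Φ.symm 0 = p := by
  rw [← h.center, Φ.left_inv h.mem_source]

lemma ball_subset (h : AdaptedChart V p U Φ O f r r') :
    ball (0 : ℂ) r ×ˢ ball (0 : ℂ) r' ⊆ O :=
  (Set.prod_mono ball_subset_closedBall ball_subset_closedBall).trans h.box_subset

/-- The part of the manifold corresponding to an open set of coordinates. -/
lemma isOpen_preimage (h : AdaptedChart V p U Φ O f r r') {D : Set (ℂ × ℂ)} (hD : IsOpen D)
    (h0 : (0 : ℂ × ℂ) ∈ D) : IsOpen (Φ.source ∩ Φ ⁻¹' D) ∧ p ∈ Φ.source ∩ Φ ⁻¹' D :=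
  ⟨Φ.isOpen_inter_preimage hD, h.mem_source, by rwa [mem_preimage, h.center]⟩

lemma differentiableOn_comp_symm (h : AdaptedChart V p U Φ O f r r') {g : X → ℂ}
    (hg : MDifferentiableOn 𝓘(ℂ, C2) 𝓘(ℂ, ℂ) g U) : DifferentiableOn ℂ (g ∘ Φ.symm) O :=
  (h.chart.differentiableOn_comp_symm hg).mono h.subset

end AdaptedChart

lemma map_symm_nhdsWithin_trace {X : Type u} [TopologicalSpace X]
    (Φ : OpenPartialHomeomorph X (ℂ × ℂ)) {x : ℂ × ℂ}
    (hx : x ∈ Φ.target) (V : Set X) {P : X → Prop} :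
    (∀ᶠ y in 𝓝[trace Φ V] x, P (Φ.symm y)) ↔ ∀ᶠ y in 𝓝[V] (Φ.symm x), P y := by
  have hxs := Φ.map_target hx
  constructor
  · intro h
    rw [eventually_nhdsWithin_iff] at h ⊢
    have h' := (Φ.continuousAt hxs).eventually (by rwa [Φ.right_inv hx])
    filter_upwards [h', Φ.open_source.mem_nhds hxs] with y hy hys hyV
    have := hy ⟨Φ.map_source hys, by rwa [mem_preimage, Φ.left_inv hys]⟩
    rwa [Φ.left_inv hys] at this
  · intro h
    rw [eventually_nhdsWithin_iff] at h ⊢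
    filter_upwards [(Φ.symm.continuousAt hx).eventually h] with y hy hyV
    exact hy hyV.2

/-- The closure of the complement in a curve of an analytic subset is analytic: near a point of the
subset it is a union of sheets, hence the zero set of a Weierstrass polynomial. -/
theorem isAnalyticSubset_closure_diff [IsManifold 𝓘(ℂ, C2) ω X] (hV : IsCurve V) {A : Set X}
    (hA : IsAnalyticSubset A) : IsAnalyticSubset (closure (V \ A)) := by
  refine ⟨isClosed_closure, fun p hp => ?_⟩
  have hpV : p ∈ V := closure_minimal sdiff_subset hV.1.1.1 hp
  by_cases hpA : p ∈ A
  swap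
  · obtain ⟨U, hU, hpU, n, F, hF, hVF⟩ := hV.1.1.2 p hpV
    refine ⟨U ∩ Aᶜ, hU.inter hA.1.isOpen_compl, ⟨hpU, hpA⟩, n, F,
      fun i => (hF i).mono inter_subset_left, ?_⟩
    ext x
    constructor
    · rintro ⟨hx, hxU⟩
      have : x ∈ V ∩ U := ⟨closure_minimal sdiff_subset hV.1.1.1 hx, hxU.1⟩
      rw [hVF] at this
      exact ⟨hxU, this.2⟩
    · rintro ⟨hxU, hx⟩
      have : x ∈ {x ∈ U | ∀ i, F i x = 0} := ⟨hxU.1, hx⟩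
      rw [← hVF] at this
      exact ⟨subset_closure ⟨this.1, hxU.2⟩, hxU⟩
  obtain ⟨U, hU, hpU, n, h, hh, hAh⟩ := hA.2 p hpA
  obtain ⟨Φ, O, f, r, r', hc⟩ := exists_adaptedChart hV hpV hU hpU
  have hhd : ∀ i, DifferentiableOn ℂ (h i ∘ Φ.symm) O := fun i =>
    hc.differentiableOn_comp_symm (hh i)
  have hAO : ∀ x ∈ O, Φ.symm x ∈ A ↔ ∀ i, h i (Φ.symm x) = 0 := fun x hx => by
    have hxU : Φ.symm x ∈ U := (hc.subset hx).2
    have : Φ.symm x ∈ A ∩ U ↔ Φ.symm x ∈ {x ∈ U | ∀ i, h i x = 0} := by rw [hAh]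
    simpa [hxU] using this
  set B := nonvanishing (trace Φ V) (fun i => h i ∘ Φ.symm) with hB
  have hBO : ∀ x ∈ O, x ∈ B ↔ Φ.symm x ∈ closure (V \ A) := by
    intro x hx
    have hxt := (hc.subset hx).1
    have h1 : (∀ᶠ y in 𝓝[trace Φ V] x, ∀ i, (h i ∘ Φ.symm) y = 0) ↔
        ∀ᶠ y in 𝓝[V] (Φ.symm x), y ∈ A := by
      rw [← map_symm_nhdsWithin_trace Φ hxt]
      refine eventually_congr ?_
      filter_upwards [mem_nhdsWithin_of_mem_nhds (hc.isOpen.mem_nhds hx)] with y hy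
      exact (hAO y hy).symm
    have h2 : Φ.symm x ∈ closure (V \ A) ↔ ¬ ∀ᶠ y in 𝓝[V] (Φ.symm x), y ∈ A := by
      rw [mem_closure_iff_frequently, eventually_nhdsWithin_iff, not_eventually]
      refine frequently_congr (Eventually.of_forall fun y => ?_)
      simp
    rw [h2, ← h1]
    refine ⟨fun hxB => hxB.2, fun hxB => ⟨⟨hxt, ?_⟩, hxB⟩⟩
    rw [h1, ← h2] at hxB
    exact closure_minimal sdiff_subset hV.1.1.1 hxB
  have hBsub : B ⊆ trace Φ V := fun x hx => hx.1
  have hBs : IsSheeted B r r' := isSheeted_nonvanishing hc.isLocalCurve.sheeted hc.isOpen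
    hc.ball_subset hhd
  have h0B : (0 : ℂ × ℂ) ∈ B := by rw [hBO 0 hc.zero_mem, hc.symm_zero]; exact hp
  obtain ⟨P, hP, hPB, m, hm, hPm⟩ := hBs.exists_weierstrass hc.isLocalCurve.pos (by
      intro ε hε
      obtain ⟨δ, hδ, h'⟩ := hc.isLocalCurve.small ε hε
      exact ⟨δ, hδ, fun z hz w hw => h' z hz.1 w ⟨hw.1, hBsub hw.2⟩⟩) (by
      have hfr := h0B.2
      rw [eventually_nhdsWithin_iff, not_eventually] at hfr
      have hbox : ball (0 : ℂ) r ×ˢ ball (0 : ℂ) r' ∈ 𝓝 (0 : ℂ × ℂ) :=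
        prod_mem_nhds (ball_mem_nhds _ hc.isLocalCurve.pos) (ball_mem_nhds _ hc.isLocalCurve.pos')
      obtain ⟨⟨z, w⟩, hzw, hbx⟩ := (hfr.and_eventually hbox).exists
      push Not at hzw
      obtain ⟨hzwT, i, hi⟩ := hzw
      have hz : z ≠ 0 := by
        rintro rfl
        have : w ∈ fiber (trace Φ V) r' 0 := ⟨hbx.2, hzwT⟩
        rw [hc.isLocalCurve.fiber_zero, mem_singleton_iff] at this
        subst this
        have := (hAO (0, 0) hc.zero_mem).1 (by rw [← Prod.zero_eq_mk, hc.symm_zero]; exact hpA) i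
        exact hi this
      exact ⟨z, ⟨hbx.1, hz⟩, w, hbx.2, hzwT, fun hev => hi (hev.self_of_nhdsWithin hzwT i)⟩)
  obtain ⟨hUo, hpU₀⟩ := hc.isOpen_preimage (isOpen_ball.prod isOpen_ball)
    (show (0 : ℂ × ℂ) ∈ ball (0 : ℂ) r ×ˢ ball (0 : ℂ) r' from
      ⟨mem_ball_self hc.isLocalCurve.pos, mem_ball_self hc.isLocalCurve.pos'⟩)
  refine ⟨_, hUo, hpU₀, 1, fun _ => P ∘ Φ, fun _ => (hc.chart.mdifferentiableOn_comp hP).mono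
    fun x hx => ⟨hx.1, hx.2.1, trivial⟩, ?_⟩
  have key : ∀ x ∈ Φ.source ∩ Φ ⁻¹' (ball (0 : ℂ) r ×ˢ ball (0 : ℂ) r'),
      x ∈ closure (V \ A) ↔ P (Φ x) = 0 := by
    rintro x ⟨hxs, hx1, hx2⟩
    have hO := hBO (Φ x) (hc.ball_subset ⟨hx1, hx2⟩)
    rw [Φ.left_inv hxs] at hO
    rw [← hO]
    generalize Φ x = y at hx1 hx2 ⊢
    obtain ⟨z, w⟩ := y
    by_cases hz : z = 0
    · subst hz
      rw [hPm, pow_eq_zero_iff hm]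
      constructor
      · intro hw
        have : w ∈ fiber (trace Φ V) r' 0 := ⟨hx2, hBsub hw⟩
        rwa [hc.isLocalCurve.fiber_zero, mem_singleton_iff] at this
      · rintro rfl
        exact h0B
    · rw [hPB z ⟨hx1, hz⟩ w]
      exact ⟨fun h => ⟨hx2, h⟩, fun h => h.2⟩
  ext x
  constructor
  · rintro ⟨hx, hxU⟩
    exact ⟨hxU, fun _ => (key x hxU).1 hx⟩
  · rintro ⟨hxU, hx⟩
    exact ⟨(key x hxU).2 (hx 0), hxU⟩

/-- The identity principle on an irreducible curve: an analytic subset with nonempty interior in the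
curve is the whole curve. -/
theorem eq_of_isAnalyticSubset_of_interior [IsManifold 𝓘(ℂ, C2) ω X] (hV : IsCurve V) {A : Set X}
    (hA : IsAnalyticSubset A) (hAV : A ⊆ V) {W : Set X} (hW : IsOpen W) (hne : (V ∩ W).Nonempty)
    (hsub : V ∩ W ⊆ A) : A = V := by
  have hB := isAnalyticSubset_closure_diff hV hA
  have hBV : closure (V \ A) ⊆ V := closure_minimal sdiff_subset hV.1.1.1
  refine (hV.1.2.2 A _ hA hB ?_).resolve_right fun hBeq => ?_
  · refine subset_antisymm (fun x hx => ?_) (union_subset hAV hBV)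
    by_cases hxA : x ∈ A
    · exact Or.inl hxA
    · exact Or.inr (subset_closure ⟨hx, hxA⟩)
  · obtain ⟨x, hxV, hxW⟩ := hne
    rw [← hBeq] at hxV
    obtain ⟨y, hyW, hyV, hyA⟩ := _root_.mem_closure_iff.1 hxV W hW hxW
    exact hyA (hsub ⟨hyV, hyW⟩)

/-- The functions defining a proper analytic subset of a curve vanish identically on no sheet. -/
lemma AdaptedChart.not_eventually_eq_zero [IsManifold 𝓘(ℂ, C2) ω X] (hV : IsCurve V) {A : Set X}
    (hA : IsAnalyticSubset A) (hAV : A ⊆ V) (hne : A ≠ V) {p : X} {U : Set X}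
    {Φ : OpenPartialHomeomorph X (ℂ × ℂ)} {O : Set (ℂ × ℂ)} {f : ℂ × ℂ → ℂ} {r r' : ℝ}
    (hc : AdaptedChart V p U Φ O f r r') {l : ℕ} {h : Fin l → X → ℂ}
    (hAh : ∀ x ∈ U, x ∈ V → (∀ i, h i x = 0) → x ∈ A) {x : ℂ × ℂ} (hx : x ∈ trace Φ V)
    (hxO : x ∈ O) : ¬ ∀ᶠ y in 𝓝[trace Φ V] x, ∀ i, h i (Φ.symm y) = 0 := by
  intro hev
  rw [map_symm_nhdsWithin_trace Φ hx.1 (P := fun y => ∀ i, h i y = 0),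
    eventually_nhdsWithin_iff] at hev
  obtain ⟨W, hW, hWo, hxW⟩ := eventually_nhds_iff.1 hev
  refine hne (eq_of_isAnalyticSubset_of_interior hV hA hAV
    (W := W ∩ (Φ.source ∩ Φ ⁻¹' O)) (hWo.inter (Φ.isOpen_inter_preimage hc.isOpen))
    ⟨Φ.symm x, hx.2, hxW, Φ.map_target hx.1, by rwa [mem_preimage, Φ.right_inv hx.1]⟩ ?_)
  rintro y ⟨hyV, hyW, hys, hyO⟩
  have := (hc.subset hyO).2
  rw [mem_preimage, Φ.left_inv hys] at this
  exact hAh y this hyV (hW y hyW hyV)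

/-- A proper analytic subset of a compact irreducible curve is finite. -/
theorem finite_of_isAnalyticSubset [IsManifold 𝓘(ℂ, C2) ω X] [CompactSpace X] (hV : IsCurve V)
    {A : Set X} (hA : IsAnalyticSubset A) (hAV : A ⊆ V) (hne : A ≠ V) : A.Finite := by
  have hloc : ∀ p ∈ A, ∃ N : Set X, IsOpen N ∧ p ∈ N ∧ A ∩ N ⊆ {p} := by
    intro p hp
    obtain ⟨U, hU, hpU, n, h, hh, hAh⟩ := hA.2 p hp
    obtain ⟨Φ, O, f, r, r', hc⟩ := exists_adaptedChart hV (hAV hp) hU hpU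
    obtain ⟨δ, hδ, hδO, hδ', -⟩ := hc.isLocalCurve.exists_polynomial_mod hc.isOpen hc.box_subset
      (fun i => hc.differentiableOn_comp_symm (hh i)) (fun z hz w hw =>
        hc.not_eventually_eq_zero hV hA hAV hne (fun x hxU hxV hx => by
          have : x ∈ {x ∈ U | ∀ i, h i x = 0} := ⟨hxU, hx⟩
          rw [← hAh] at this
          exact this.1) hw.2 (hc.ball_subset ⟨hz.1, hw.1⟩))
    obtain ⟨hNo, hpN⟩ := hc.isOpen_preimage (isOpen_ball.prod isOpen_ball)
      (show (0 : ℂ × ℂ) ∈ ball (0 : ℂ) δ ×ˢ ball (0 : ℂ) δ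
        from ⟨mem_ball_self hδ, mem_ball_self hδ⟩)
    refine ⟨_, hNo, hpN, ?_⟩
    rintro x ⟨hxA, hxs, hx⟩
    by_contra hxp
    obtain ⟨i, hi⟩ := hδ' (Φ x)
      ⟨Φ.map_source hxs, by rw [mem_preimage, Φ.left_inv hxs]; exact hAV hxA⟩ hx (fun h0 => hxp (by
        rw [mem_singleton_iff, ← Φ.left_inv hxs, h0, hc.symm_zero]))
    refine hi ?_
    have hxU := (hc.subset (hδO hx)).2
    rw [mem_preimage, Φ.left_inv hxs] at hxU
    have : x ∈ A ∩ U := ⟨hxA, hxU⟩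
    rw [hAh] at this
    rw [Function.comp_apply, Φ.left_inv hxs]
    exact this.2 i
  choose! N hNo hpN hN using hloc
  obtain ⟨t, htA, ht⟩ := hA.1.isCompact.elim_nhds_subcover N fun p hp =>
    (hNo p hp).mem_nhds (hpN p hp)
  refine t.finite_toSet.subset fun x hx => ?_
  obtain ⟨p, hp, hxp⟩ := mem_iUnion₂.1 (ht hx)
  obtain rfl : x = p := hN p (htA p hp) ⟨hx, hxp⟩
  exact hp

end Curves

end PlaneCurve

namespace PlaneCurve

/-! ### The area formula for holomorphic functions, with multiplicities -/

section Area

open Set Filter Topology Metric MeasureTheory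

lemma abs_det_restrictScalars_smulRight (a : ℂ) :
    |((ContinuousLinearMap.toSpanSingleton ℂ a).restrictScalars ℝ).det| = ‖a‖ ^ 2 := by
  have h : (((ContinuousLinearMap.toSpanSingleton ℂ a).restrictScalars ℝ).det) = ‖a‖ ^ 2 := by
    simp [ContinuousLinearMap.det, LinearMap.det_restrictScalars, Algebra.norm_complex_eq,
      Complex.normSq_eq_norm_sq, LinearMap.det_ring]
  rw [h, abs_of_nonneg (by positivity)]

/-- Off its critical points, which do not contribute, `g` is locally injective; on countably many
pieces where it is injective the change of variables formula applies. -/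
lemma exists_seq_injOn {g : ℂ → ℂ} {D A : Set ℂ} (hD : IsOpen D) (hg : DifferentiableOn ℂ g D)
    (hA : MeasurableSet A) (hAD : A ⊆ D) : ∃ s : ℕ → Set ℂ, (∀ k, MeasurableSet (s k)) ∧
      Pairwise (Function.onFun Disjoint s) ∧ (∀ k, s k ⊆ A) ∧ (∀ k, MeasurableSet (g '' s k)) ∧
      ∫⁻ ζ in A, ENNReal.ofReal (‖deriv g ζ‖ ^ 2) = ∑' k, volume (g '' s k) := by
  have hS : IsOpen {ζ ∈ D | deriv g ζ ≠ 0} :=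
    (hg.deriv hD).continuousOn.isOpen_inter_preimage hD isOpen_compl_singleton
  set S := {ζ ∈ D | deriv g ζ ≠ 0}
  have h𝓑c : (insert ∅ {b ∈ countableBasis ℂ | InjOn g b}).Countable :=
    ((countable_countableBasis ℂ).mono (sep_subset _ _)).insert _
  obtain ⟨v, hv⟩ := h𝓑c.exists_eq_range (insert_nonempty _ _)
  have hvo : ∀ k, IsOpen (v k) ∧ InjOn g (v k) := fun k => by
    have : v k ∈ insert ∅ {b ∈ countableBasis ℂ | InjOn g b} := hv ▸ mem_range_self k
    rcases this with h | h
    · rw [h]; exact ⟨isOpen_empty, injOn_empty g⟩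
    · exact ⟨(isBasis_countableBasis ℂ).isOpen h.1, h.2⟩
  have hcov : S ⊆ ⋃ k, v k := by
    rintro ζ ⟨hζD, hζ⟩
    have hst : HasStrictDerivAt g (deriv g ζ) ζ :=
      (hg.analyticAt (hD.mem_nhds hζD)).hasStrictDerivAt
    have hst' := hst.hasStrictFDerivAt_equiv hζ
    obtain ⟨b, hb, hζb, hbs⟩ := (isBasis_countableBasis ℂ).exists_subset_of_mem_open
      hst'.mem_toOpenPartialHomeomorph_source (hst'.toOpenPartialHomeomorph g).open_source
    have : b ∈ insert ∅ {b ∈ countableBasis ℂ | InjOn g b} :=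
      Or.inr ⟨hb, ((hst'.toOpenPartialHomeomorph g).injOn.mono hbs)⟩
    rw [hv] at this
    obtain ⟨k, rfl⟩ := this
    exact mem_iUnion.2 ⟨k, hζb⟩
  let s : ℕ → Set ℂ := fun k => A ∩ S ∩ disjointed v k
  have hsm : ∀ k, MeasurableSet (s k) := fun k =>
    (hA.inter hS.measurableSet).inter
      (MeasurableSet.disjointed (fun i => (hvo i).1.measurableSet) k)
  have hsd : Pairwise (Function.onFun Disjoint s) := fun i j hij =>
    (disjoint_disjointed v hij).mono inter_subset_right inter_subset_right
  have hinj : ∀ k, InjOn g (s k) := fun k =>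
    (hvo k).2.mono (inter_subset_right.trans (disjointed_subset v k))
  have hder : ∀ k, ∀ ζ ∈ s k, HasFDerivWithinAt g
      ((ContinuousLinearMap.toSpanSingleton ℂ (deriv g ζ)).restrictScalars ℝ) (s k) ζ := by
    intro k ζ hζ
    have := (hg.differentiableAt (hD.mem_nhds (hAD hζ.1.1))).hasDerivAt.hasFDerivAt
    exact (this.restrictScalars ℝ).hasFDerivWithinAt
  refine ⟨s, hsm, hsd, fun k x hx => hx.1.1, fun k => ?_, ?_⟩
  · exact measurable_image_of_fderivWithin (hsm k) (hder k) (hinj k)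
  · have hU : A ∩ S = ⋃ k, s k := by
      rw [← inter_iUnion, iUnion_disjointed, inter_eq_left.2 (inter_subset_right.trans hcov)]
    rw [← lintegral_inter_add_sdiff _ A hS.measurableSet, hU, lintegral_iUnion hsm hsd,
      setLIntegral_eq_zero (hA.diff hS.measurableSet) (fun ζ hζ => ?_), add_zero]
    · congr 1
      ext k
      rw [← lintegral_abs_det_fderiv_eq_addHaar_image volume (hsm k) (hder k) (hinj k)]
      simp only [abs_det_restrictScalars_smulRight]
    · have : deriv g ζ = 0 := by
        by_contra h
        exact hζ.2 ⟨hAD hζ.1, h⟩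
      simp [this]

/-- If the fibres of a finite family of holomorphic functions have altogether at most `N` points,
then the areas of the domains in the pulled back metric add up to at most `N` times the area of
the target. -/
theorem sum_lintegral_deriv_sq_le {n : ℕ} {g : Fin n → ℂ → ℂ} {D A : Fin n → Set ℂ}
    (hD : ∀ i, IsOpen (D i)) (hg : ∀ i, DifferentiableOn ℂ (g i) (D i))
    (hA : ∀ i, MeasurableSet (A i)) (hAD : ∀ i, A i ⊆ D i) {B : Set ℂ} (hB : MeasurableSet B)
    (hgB : ∀ i, ∀ ζ ∈ A i, g i ζ ∈ B) {N : ℕ}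
    (hN : ∀ z ∈ B, {x : Fin n × ℂ | x.2 ∈ A x.1 ∧ g x.1 x.2 = z}.encard ≤ N) :
    ∑ i, ∫⁻ ζ in A i, ENNReal.ofReal (‖deriv (g i) ζ‖ ^ 2) ≤ N * volume B := by
  choose s hsm hsd hsA hsi hs using fun i => exists_seq_injOn (hD i) (hg i) (hA i) (hAD i)
  calc ∑ i, ∫⁻ ζ in A i, ENNReal.ofReal (‖deriv (g i) ζ‖ ^ 2)
      = ∑' x : Fin n × ℕ, volume (g x.1 '' s x.1 x.2) := by
        rw [ENNReal.tsum_prod (f := fun i k => volume (g i '' s i k)), tsum_fintype]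
        exact Finset.sum_congr rfl fun i _ => hs i
    _ = ∑' x : Fin n × ℕ, ∫⁻ z, (g x.1 '' s x.1 x.2).indicator 1 z := by
        congr 1
        ext x
        rw [lintegral_indicator_one (hsi _ _)]
    _ = ∫⁻ z, ∑' x : Fin n × ℕ, (g x.1 '' s x.1 x.2).indicator 1 z :=
        (lintegral_tsum fun x => (measurable_one.indicator (hsi _ _)).aemeasurable).symm
    _ ≤ ∫⁻ z, B.indicator (fun _ => (N : ℝ≥0∞)) z := by
        refine lintegral_mono fun z => ?_
        by_cases hz : z ∈ B
        · rw [indicator_of_mem hz]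
          have h1 : ∀ x : Fin n × ℕ, (g x.1 '' s x.1 x.2).indicator (1 : ℂ → ℝ≥0∞) z =
              {x : Fin n × ℕ | z ∈ g x.1 '' s x.1 x.2}.indicator 1 x := fun x => by
            by_cases h : z ∈ g x.1 '' s x.1 x.2
            · rw [indicator_of_mem h, indicator_of_mem (by exact h)]; rfl
            · rw [indicator_of_notMem h, indicator_of_notMem (by exact h)]
          simp_rw [h1]
          rw [← tsum_subtype]
          simp only [Pi.one_apply, ENNReal.tsum_one]
          have h2 : {x : Fin n × ℕ | z ∈ g x.1 '' s x.1 x.2}.encard ≤ N := by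
            choose! c hc using fun (x : Fin n × ℕ) (hx : z ∈ g x.1 '' s x.1 x.2) => hx
            refine le_trans (encard_le_encard_of_injOn (f := fun x => (x.1, c x)) ?_ ?_) (hN z hz)
            · exact fun x hx => ⟨hsA _ _ (hc x hx).1, (hc x hx).2⟩
            · rintro ⟨i, k⟩ hx ⟨j, l⟩ hy hxy
              obtain ⟨rfl, h⟩ := Prod.mk_inj.1 hxy
              have hx1 := (hc _ hx).1
              have hy1 := (hc _ hy).1
              simp only at h hx1 hy1
              rw [← h] at hy1
              by_contra hne
              exact (hsd i fun hkl => hne (by rw [hkl])).le_bot ⟨hx1, hy1⟩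
          exact_mod_cast h2
        · rw [indicator_of_notMem hz, nonpos_iff_eq_zero, ENNReal.tsum_eq_zero]
          refine fun x => indicator_of_notMem ?_ _
          rintro ⟨ζ, hζ, rfl⟩
          exact hz (hgB _ _ (hsA _ _ hζ))
    _ = N * volume B := by rw [lintegral_indicator_const hB]

end Area

end PlaneCurve

namespace PlaneCurve

/-! ### Positivity of the area of a curve -/

section Integral

open Set Filter Topology Metric MeasureTheory ZStability

variable {X : Type u} [TopologicalSpace X] [ChartedSpace C2 X] {V : Set X}

/-- The density of the pulled back form along a holomorphic disc, computed in any chart of the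
atlas. -/
lemma pullbackDensity_eq_formInChart [IsManifold 𝓘(ℂ, C2) 1 X] (η : ClosedForm X 2)
    {e : OpenPartialHomeomorph X C2} (he : e ∈ atlas C2 X) {γ : ℂ → X} {z : ℂ}
    (hγ : MDifferentiableAt 𝓘(ℂ, ℂ) 𝓘(ℂ, C2) γ z) (hz : γ z ∈ e.source) :
    pullbackDensity η γ z = formInChart η.toFun e (e (γ z))
      ![deriv (e ∘ γ) z, Complex.I • deriv (e ∘ γ) z] := by
  have he1 : MDifferentiableAt 𝓘(ℂ, C2) 𝓘(ℂ, C2) e (γ z) :=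
    (mdifferentiableOn_atlas he).mdifferentiableAt (e.open_source.mem_nhds hz)
  have he2 : MDifferentiableAt 𝓘(ℂ, C2) 𝓘(ℂ, C2) e.symm (e (γ z)) :=
    (mdifferentiableOn_atlas_symm he).mdifferentiableAt (e.open_target.mem_nhds (e.map_source hz))
  have heq : γ =ᶠ[𝓝 z] e.symm ∘ (e ∘ γ) := by
    filter_upwards [hγ.continuousAt (e.open_source.mem_nhds hz)] with y hy
    exact (e.left_inv hy).symm
  have hd : DifferentiableAt ℂ (e ∘ γ) z :=
    mdifferentiableAt_iff_differentiableAt.1 (he1.comp z hγ)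
  have h1 : ∀ v : ℂ, (mfderiv 𝓘(ℂ, ℂ) 𝓘(ℂ, C2) γ z v : C2) =
      (mfderiv 𝓘(ℂ, C2) 𝓘(ℂ, C2) e.symm (e (γ z)) (v • deriv (e ∘ γ) z : C2) : C2) := by
    intro v
    have h3 := mfderiv_comp z (g := e.symm) (f := e ∘ γ) he2 (he1.comp z hγ)
    have h4 : (mfderiv 𝓘(ℂ, ℂ) 𝓘(ℂ, C2) γ z v : C2) =
        (mfderiv 𝓘(ℂ, ℂ) 𝓘(ℂ, C2) (e.symm ∘ (e ∘ γ)) z v : C2) := by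
      rw [heq.mfderiv_eq]
      rfl
    rw [h4, h3, mfderiv_eq_fderiv]
    have h5 : fderiv ℂ (e ∘ γ) z v = v • deriv (e ∘ γ) z := by
      rw [← fderiv_apply_one_eq_deriv, ← map_smul, smul_eq_mul, mul_one]
    rw [← h5]
    rfl
  have h2 : ∀ (x y : X) (_ : x = y) (a b : C2),
      η.toFun x ![(a : TangentSpace 𝓘(ℂ, C2) x), (b : TangentSpace 𝓘(ℂ, C2) x)] =
      η.toFun y ![(a : TangentSpace 𝓘(ℂ, C2) y), (b : TangentSpace 𝓘(ℂ, C2) y)] := by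
    rintro x y rfl a b
    rfl
  have h3 := h2 (γ z) (e.symm (e (γ z))) (e.left_inv hz).symm
    (mfderiv 𝓘(ℂ, ℂ) 𝓘(ℂ, C2) γ z (1 : ℂ)) (mfderiv 𝓘(ℂ, ℂ) 𝓘(ℂ, C2) γ z Complex.I)
  rw [pullbackDensity]
  refine h3.trans ?_
  refine congrArg (η.toFun (e.symm (e (γ z)))) (funext fun i => ?_)
  fin_cases i
  · exact (h1 1).trans (congrArg (mfderiv 𝓘(ℂ, C2) 𝓘(ℂ, C2) e.symm (e (γ z))) (one_smul ℂ _))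
  · exact h1 Complex.I

lemma pullbackDensity_eq_apply_I (η : ClosedForm X 2) (γ : ℂ → X) (z : ℂ) :
    pullbackDensity η γ z = η.toFun (γ z) ![mfderiv 𝓘(ℂ, ℂ) 𝓘(ℂ, C2) γ z (1 : ℂ),
      Complex.I • mfderiv 𝓘(ℂ, ℂ) 𝓘(ℂ, C2) γ z (1 : ℂ)] := by
  have : mfderiv 𝓘(ℂ, ℂ) 𝓘(ℂ, C2) γ z Complex.I =
      Complex.I • mfderiv 𝓘(ℂ, ℂ) 𝓘(ℂ, C2) γ z (1 : ℂ) := by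
    have h : ∀ T : ℂ →L[ℂ] C2, T Complex.I = Complex.I • T 1 := fun T => by
      rw [← map_smul, smul_eq_mul, mul_one]
    exact h _
  rw [pullbackDensity, this]

lemma pullbackDensity_nonneg {κ : ClosedForm X 2} (hκ : κ.IsKahler) (γ : ℂ → X) (z : ℂ) :
    0 ≤ pullbackDensity κ γ z := by
  rw [pullbackDensity_eq_apply_I]
  by_cases h : mfderiv 𝓘(ℂ, ℂ) 𝓘(ℂ, C2) γ z (1 : ℂ) = 0
  · rw [h]
    exact ((κ.toFun (γ z)).map_coord_zero (m := ![0, _]) 0 rfl).ge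
  · exact (hκ.pos _ _ h).le

/-- The density of a Kähler form is nonnegative, so its negative part does not contribute. -/
lemma partIntegral_neg_one {κ : ClosedForm X 2} (hκ : κ.IsKahler) :
    partIntegral (-1) κ V = 0 := by
  simp only [partIntegral, ENNReal.iSup_eq_zero]
  intro n P _
  refine Finset.sum_eq_zero fun i _ => ?_
  have : ∀ z, ENNReal.ofReal (-1 * pullbackDensity κ (P i).γ z) = 0 := fun z => by
    rw [ENNReal.ofReal_eq_zero]
    linarith [pullbackDensity_nonneg hκ (P i).γ z]
  simp only [this, lintegral_zero]

lemma continuousAt_pullbackDensity [IsManifold 𝓘(ℂ, C2) 1 X] (η : ClosedForm X 2) {γ : ℂ → X}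
    {D : Set ℂ} (hD : IsOpen D) (hγ : MDifferentiableOn 𝓘(ℂ, ℂ) 𝓘(ℂ, C2) γ D) {z : ℂ}
    (hz : z ∈ D) : ContinuousAt (pullbackDensity η γ) z := by
  let e := chartAt C2 (γ z)
  have he : e ∈ atlas C2 X := chart_mem_atlas C2 _
  have hze : γ z ∈ e.source := mem_chart_source C2 _
  have hD' : IsOpen (D ∩ γ ⁻¹' e.source) :=
    hγ.continuousOn.isOpen_inter_preimage hD e.open_source
  have hev : ∀ᶠ y in 𝓝 z, pullbackDensity η γ y = formInChart η.toFun e (e (γ y))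
      ![deriv (e ∘ γ) y, Complex.I • deriv (e ∘ γ) y] := by
    filter_upwards [hD'.mem_nhds ⟨hz, hze⟩] with y hy
    exact pullbackDensity_eq_formInChart η he (hγ.mdifferentiableAt (hD.mem_nhds hy.1)) hy.2
  refine ContinuousAt.congr ?_ (hev.mono fun _ h => h.symm)
  have hd : DifferentiableOn ℂ (e ∘ γ) (D ∩ γ ⁻¹' e.source) := by
    rw [← mdifferentiableOn_iff_differentiableOn]
    exact (mdifferentiableOn_atlas he).comp (hγ.mono inter_subset_left) inter_subset_right
  have h1 : ContinuousAt (deriv (e ∘ γ)) z :=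
    (hd.deriv hD').continuousOn.continuousAt (hD'.mem_nhds ⟨hz, hze⟩)
  have h2 : ContinuousAt (e ∘ γ) z := hd.continuousOn.continuousAt (hD'.mem_nhds ⟨hz, hze⟩)
  have h3 : ContinuousAt (formInChart η.toFun e) (e (γ z)) :=
    (η.smooth e he).continuousOn.continuousAt (e.open_target.mem_nhds (e.map_source hze))
  have h4 : ContinuousAt (fun y => formInChart η.toFun e (e (γ y))) z :=
    ContinuousAt.comp (f := fun y => e (γ y)) h3 h2
  refine h4.eval (continuousAt_pi.2 fun i => ?_)
  fin_cases i
  · exact h1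
  · exact h1.const_smul Complex.I

/-- A sheet of a curve consists of regular points. -/
lemma AdaptedChart.mem_regularLocus {p : X} {U : Set X} {Φ : OpenPartialHomeomorph X (ℂ × ℂ)}
    {O : Set (ℂ × ℂ)} {f : ℂ × ℂ → ℂ} {r r' : ℝ} (hc : AdaptedChart V p U Φ O f r r') {D : Set ℂ}
    (hD : IsOpen D) (hDr : D ⊆ ball 0 r \ {0}) {b : ℂ → ℂ} (hb : DifferentiableOn ℂ b D)
    (hbT : ∀ z ∈ D, b z ∈ fiber (trace Φ V) r' z) {z₁ : ℂ} (hz₁ : z₁ ∈ D) :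
    Φ.symm (z₁, b z₁) ∈ regularLocus V := by
  have hT := (hbT z₁ hz₁).2
  refine ⟨hT.2, ?_⟩
  have hev := hc.isLocalCurve.sheeted.eventually_eq (hDr hz₁)
    (hb.continuousOn.continuousAt (hD.mem_nhds hz₁))
    (by filter_upwards [hD.mem_nhds hz₁] with z hz using hbT z hz)
  rw [eventually_nhdsWithin_iff] at hev
  obtain ⟨N, hN, hNo, hzN⟩ := _root_.eventually_nhds_iff.1 hev
  have hWo : IsOpen (N ∩ D ×ˢ univ) := hNo.inter (hD.prod isOpen_univ)
  have hzs : Φ.symm (z₁, b z₁) ∈ Φ.source := Φ.map_target hT.1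
  have hg : DifferentiableOn ℂ (fun x : ℂ × ℂ => x.2 - b x.1) (D ×ˢ univ) :=
    differentiableOn_snd.sub (hb.comp differentiableOn_fst fun x hx => hx.1)
  have hmd := hc.chart.mdifferentiableOn_comp hg
  refine ⟨Φ.source ∩ Φ ⁻¹' (N ∩ D ×ˢ univ), Φ.isOpen_inter_preimage hWo,
    ⟨hzs, by rw [mem_preimage, Φ.right_inv hT.1]; exact ⟨hzN, hz₁, trivial⟩⟩,
    (fun x : ℂ × ℂ => x.2 - b x.1) ∘ Φ, hmd.mono fun x hx => ⟨hx.1, hx.2.2⟩, fun h0 => ?_, ?_⟩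
  · have hΦs : MDifferentiableAt 𝓘(ℂ, ℂ × ℂ) 𝓘(ℂ, C2) Φ.symm (z₁, b z₁) :=
      hc.chart.mdifferentiableOn_symm.mdifferentiableAt (Φ.open_target.mem_nhds hT.1)
    have hfd : MDifferentiableAt 𝓘(ℂ, C2) 𝓘(ℂ, ℂ) ((fun x : ℂ × ℂ => x.2 - b x.1) ∘ Φ)
        (Φ.symm (z₁, b z₁)) :=
      hmd.mdifferentiableAt ((Φ.isOpen_inter_preimage (hD.prod isOpen_univ)).mem_nhds
        ⟨hzs, by rw [mem_preimage, Φ.right_inv hT.1]; exact ⟨hz₁, trivial⟩⟩)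
    have hcomp := mfderiv_comp (z₁, b z₁) hfd hΦs
    rw [h0, ContinuousLinearMap.zero_comp] at hcomp
    have heq : (((fun x : ℂ × ℂ => x.2 - b x.1) ∘ Φ) ∘ Φ.symm) =ᶠ[𝓝 (z₁, b z₁)]
        fun x : ℂ × ℂ => x.2 - b x.1 := by
      filter_upwards [Φ.open_target.mem_nhds hT.1] with x hx
      simp [Φ.right_inv hx]
    rw [heq.mfderiv_eq, mfderiv_eq_fderiv] at hcomp
    -- differentiate along the second axis
    have h1 : HasDerivAt (fun w : ℂ => (z₁, w)) (0, 1) (b z₁) :=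
      (hasDerivAt_const (b z₁) z₁).prodMk (hasDerivAt_id (b z₁))
    have h2 : HasFDerivAt (fun x : ℂ × ℂ => x.2 - b x.1)
        (fderiv ℂ (fun x : ℂ × ℂ => x.2 - b x.1) (z₁, b z₁)) (z₁, b z₁) :=
      (hg.differentiableAt ((hD.prod isOpen_univ).mem_nhds ⟨hz₁, trivial⟩)).hasFDerivAt
    have h3 := h2.comp_hasDerivAt (b z₁) h1
    have h4 : HasDerivAt (fun w : ℂ => w - b z₁) 1 (b z₁) := (hasDerivAt_id _).sub_const _
    have h5 := h3.unique h4
    have h6 : fderiv ℂ (fun x : ℂ × ℂ => x.2 - b x.1) (z₁, b z₁) = 0 := hcomp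
    rw [h6] at h5
    simp at h5
  · ext x
    constructor
    · rintro ⟨hxV, hxs, hxN⟩
      refine ⟨⟨hxs, hxN⟩, ?_⟩
      have := hN (Φ x) hxN.1 ⟨Φ.map_source hxs, by rwa [mem_preimage, Φ.left_inv hxs]⟩
      simp [this]
    · rintro ⟨⟨hxs, hxN⟩, hx⟩
      refine ⟨?_, hxs, hxN⟩
      have hx' : (Φ x).2 = b (Φ x).1 := sub_eq_zero.1 hx
      have := (hbT _ hxN.2.1).2.2
      rwa [mem_preimage, ← hx', Prod.mk.eta, Φ.left_inv hxs] at this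

lemma IsLocalCurve.exists_ne_zero {T : Set (ℂ × ℂ)} {r r' : ℝ} (hT : IsLocalCurve T r r') :
    ∃ z ∈ ball (0 : ℂ) r \ {0}, (fiber T r' z).Nonempty := by
  have hbox : ball (0 : ℂ) r ×ˢ ball (0 : ℂ) r' ∈ 𝓝 (0 : ℂ × ℂ) :=
    prod_mem_nhds (ball_mem_nhds _ hT.pos) (ball_mem_nhds _ hT.pos')
  obtain ⟨⟨z, w⟩, ⟨hz, hw⟩, hzwT, hne⟩ := mem_closure_iff_nhds.1 hT.notIsolated _ hbox
  refine ⟨z, ⟨hz, ?_⟩, w, hw, hzwT⟩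
  rintro rfl
  have : w ∈ fiber T r' 0 := ⟨hw, hzwT⟩
  rw [hT.fiber_zero, mem_singleton_iff] at this
  exact hne (by rw [this]; rfl)

/-- A single sheet over a small disc already contributes: the density of a Kähler form is positive
along an immersed disc. -/
theorem partIntegral_one_pos [IsManifold 𝓘(ℂ, C2) ω X] (hV : IsCurve V) {κ : ClosedForm X 2}
    (hκ : κ.IsKahler) : 0 < partIntegral 1 κ V := by
  have : IsManifold 𝓘(ℂ, C2) 1 X := IsManifold.of_le (n := ω) le_top
  obtain ⟨p, hp⟩ := hV.1.2.1
  obtain ⟨Φ, O, f, r, r', hc⟩ := exists_adaptedChart hV hp isOpen_univ trivial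
  obtain ⟨z₀, hz₀, w₀, hw₀⟩ := hc.isLocalCurve.exists_ne_zero
  obtain ⟨ε, hε, hεr, ι, _, b, hb, hfib⟩ := hc.isLocalCurve.sheeted z₀ hz₀
  have hz₀ε := mem_ball_self (x := z₀) hε
  have hw := hw₀
  rw [(hfib z₀ hz₀ε).2] at hw
  obtain ⟨j, -⟩ := hw
  have hbT : ∀ z ∈ ball z₀ ε, b j z ∈ fiber (trace Φ V) r' z := fun z hz => by
    rw [(hfib z hz).2]; exact mem_range_self j
  have hgd : DifferentiableOn ℂ (fun z => (z, b j z)) (ball z₀ ε) :=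
    differentiableOn_id.prodMk (hb j)
  let γ : ℂ → X := fun z => Φ.symm (z, b j z)
  have hγ : MDifferentiableOn 𝓘(ℂ, ℂ) 𝓘(ℂ, C2) γ (ball z₀ ε) := by
    have h1 : MDifferentiableOn 𝓘(ℂ, ℂ) 𝓘(ℂ, ℂ × ℂ) (fun z => (z, b j z)) (ball z₀ ε) := by
      rw [mdifferentiableOn_iff_differentiableOn]; exact hgd
    exact hc.chart.mdifferentiableOn_symm.comp h1 fun z hz => (hbT z hz).2.1
  have hΦγ : ∀ z ∈ ball z₀ ε, Φ (γ z) = (z, b j z) := fun z hz => Φ.right_inv (hbT z hz).2.1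
  have hpos : 0 < pullbackDensity κ γ z₀ := by
    rw [pullbackDensity_eq_apply_I]
    refine hκ.pos _ _ fun h0 => ?_
    have hΦd : MDifferentiableAt 𝓘(ℂ, C2) 𝓘(ℂ, ℂ × ℂ) Φ (γ z₀) :=
      hc.chart.mdifferentiableOn.mdifferentiableAt (Φ.open_source.mem_nhds
        (Φ.map_target (hbT z₀ hz₀ε).2.1))
    have hcomp := mfderiv_comp z₀ hΦd (hγ.mdifferentiableAt (isOpen_ball.mem_nhds hz₀ε))
    have heq : Φ ∘ γ =ᶠ[𝓝 z₀] fun z => (z, b j z) := by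
      filter_upwards [isOpen_ball.mem_nhds hz₀ε] with z hz using hΦγ z hz
    rw [heq.mfderiv_eq, mfderiv_eq_fderiv] at hcomp
    have h1 := congrArg (fun T : ℂ →L[ℂ] ℂ × ℂ => T 1) hcomp
    have h2 : (mfderiv 𝓘(ℂ, C2) 𝓘(ℂ, ℂ × ℂ) Φ (γ z₀))
        (mfderiv 𝓘(ℂ, ℂ) 𝓘(ℂ, C2) γ z₀ (1 : ℂ)) = 0 := by
      rw [h0]; exact map_zero _
    have h3 : fderiv ℂ (fun z => (z, b j z)) z₀ 1 = 0 := h1.trans h2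
    have h4 : HasDerivAt (fun z => (z, b j z)) (1, deriv (b j) z₀) z₀ :=
      (hasDerivAt_id z₀).prodMk ((hb j).differentiableAt (isOpen_ball.mem_nhds hz₀ε)).hasDerivAt
    rw [fderiv_apply_one_eq_deriv, h4.deriv] at h3
    exact one_ne_zero (congrArg Prod.fst h3)
  have hcont := continuousAt_pullbackDensity κ isOpen_ball hγ hz₀ε
  have hev : ∀ᶠ z in 𝓝 z₀, pullbackDensity κ γ z₀ / 2 < pullbackDensity κ γ z :=
    hcont.eventually (lt_mem_nhds (half_lt_self hpos))
  obtain ⟨δ, hδ, hδs⟩ := Metric.eventually_nhds_iff_ball.1 hev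
  let P : CoordinatePiece V :=
    { D := ball z₀ ε
      γ := γ
      A := ball z₀ (min δ ε)
      isOpen_D := isOpen_ball
      holomorphic := hγ
      injOn := fun x hx y hy hxy => by
        have h1 := hΦγ x hx
        have h2 := hΦγ y hy
        rw [hxy, h2] at h1
        exact (congrArg Prod.fst h1).symm
      mapsTo := fun z hz => hc.mem_regularLocus isOpen_ball hεr (hb j) hbT hz
      measurableSet_A := measurableSet_ball
      A_subset := ball_subset_ball (min_le_right _ _) }
  have hle : ∫⁻ z in P.A, ENNReal.ofReal (1 * pullbackDensity κ P.γ z) ≤ partIntegral 1 κ V := by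
    refine le_trans (le_of_eq ?_) (le_iSup_of_le 1 (le_iSup_of_le (fun _ => P) (le_iSup_of_le
      (fun i j hij => absurd (Subsingleton.elim i j) hij) le_rfl)))
    simp
  refine lt_of_lt_of_le ?_ hle
  refine lt_of_lt_of_le ?_ (setLIntegral_mono' (f := fun _ =>
    ENNReal.ofReal (pullbackDensity κ γ z₀ / 2)) P.measurableSet_A fun z hz => ?_)
  · rw [setLIntegral_const]
    exact ENNReal.mul_pos (by simpa using hpos)
      (measure_ball_pos volume z₀ (lt_min hδ hε)).ne'
  · rw [one_mul]
    exact ENNReal.ofReal_le_ofReal (hδs z (ball_subset_ball (min_le_left _ _) hz)).le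

end Integral

end PlaneCurve

namespace PlaneCurve

/-! ### Finiteness of the area of a compact curve -/

section Lelong

open Set Filter Topology Metric MeasureTheory ZStability

/-- The area of the projection to the first coordinate, counted with multiplicity, of disjoint
pieces of the zero set of `f` is locally bounded. -/
lemma exists_sum_lintegral_fst_le {f : ℂ × ℂ → ℂ} {O : Set (ℂ × ℂ)} {r r' : ℝ} (hr : 0 < r)
    (hZ : ZeroFree f O (ball 0 r) 0 r') : ∃ δ₀ > 0, ∀ δ ≤ δ₀, ∃ K : ℝ≥0∞, K ≠ ⊤ ∧
      ∀ (n : ℕ) (g : Fin n → ℂ → ℂ × ℂ) (D A : Fin n → Set ℂ), (∀ i, IsOpen (D i)) →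
        (∀ i, DifferentiableOn ℂ (g i) (D i)) → (∀ i, MeasurableSet (A i)) → (∀ i, A i ⊆ D i) →
        (∀ i, ∀ ζ ∈ A i, g i ζ ∈ ball (0 : ℂ) δ ×ˢ ball (0 : ℂ) δ ∧ f (g i ζ) = 0) →
        (∀ i j, ∀ ζ ∈ A i, ∀ ξ ∈ A j, g i ζ = g j ξ → i = j ∧ ζ = ξ) →
        ∑ i, ∫⁻ ζ in A i, ENNReal.ofReal (‖deriv (fun ζ => (g i ζ).1) ζ‖ ^ 2) ≤ K := by
  obtain ⟨δ₁, hδ₁, hps⟩ := Metric.eventually_nhds_iff_ball.1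
    ((hZ.eventually_powerSum_zero_eq (mem_ball_self hr)).and (isOpen_ball.mem_nhds
      (mem_ball_self (x := (0 : ℂ)) hr)))
  let N : ℕ := ⌈‖powerSum f 0 r' 0 0‖⌉₊
  refine ⟨min δ₁ r', lt_min hδ₁ hZ.pos, fun δ hδ => ⟨N * volume (ball (0 : ℂ) δ),
    ENNReal.mul_ne_top (by simp) measure_ball_lt_top.ne, ?_⟩⟩
  intro n g D A hD hg hA hAD hgA hinj
  refine sum_lintegral_deriv_sq_le hD (fun i => (hg i).fst) hA hAD measurableSet_ball
    (fun i ζ hζ => (hgA i ζ hζ).1.1) fun z hz => ?_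
  have hz' := hps z (ball_subset_ball (hδ.trans (min_le_left _ _)) hz)
  have hcard : (ZeroFree.zeros f 0 r' z).encard ≤ N := by
    rw [← (hZ.finite_zeros hz'.2).cast_ncard_eq, Nat.cast_le]
    have h1 := hZ.ncard_zeros_le hz'.2
    rw [hz'.1] at h1
    exact_mod_cast h1.trans (Nat.le_ceil _)
  refine le_trans (encard_le_encard_of_injOn (f := fun x => (g x.1 x.2).2) ?_ ?_) hcard
  · rintro ⟨i, ζ⟩ ⟨hζ, rfl⟩
    have := hgA i ζ hζ
    exact ⟨ball_subset_ball (hδ.trans (min_le_right _ _)) this.1.2, this.2⟩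
  · rintro ⟨i, ζ⟩ ⟨hζ, h1⟩ ⟨j, ξ⟩ ⟨hξ, h2⟩ h3
    obtain ⟨rfl, rfl⟩ := hinj i j ζ hζ ξ hξ (Prod.ext (h1.trans h2.symm) h3)
    rfl

variable {X : Type u} [TopologicalSpace X] [ChartedSpace C2 X] {V : Set X}

lemma measurableSet_inter_preimage (P : CoordinatePiece V) {N : Set X} (hN : IsOpen N) :
    IsOpen (P.D ∩ P.γ ⁻¹' N) ∧ MeasurableSet (P.A ∩ P.γ ⁻¹' N) := by
  have h : IsOpen (P.D ∩ P.γ ⁻¹' N) :=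
    P.holomorphic.continuousOn.isOpen_inter_preimage P.isOpen_D hN
  refine ⟨h, ?_⟩
  have : P.A ∩ P.γ ⁻¹' N = P.A ∩ (P.D ∩ P.γ ⁻¹' N) := by
    rw [← inter_assoc, inter_eq_left.2 P.A_subset]
  rw [this]
  exact P.measurableSet_A.inter h.measurableSet

/-- Locally, the density of any form is bounded by that of the Euclidean area in given coordinates.
-/
lemma pullbackDensity_le [IsManifold 𝓘(ℂ, C2) 1 X] (η : ClosedForm X 2)
    {Φ : OpenPartialHomeomorph X (ℂ × ℂ)} (hΦ : IsHolomorphicChart Φ) {p : X} (hp : p ∈ Φ.source) :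
    ∃ M : Set X, IsOpen M ∧ p ∈ M ∧ ∃ C : ℝ, 0 ≤ C ∧ ∀ (γ : ℂ → X) (z : ℂ),
      MDifferentiableAt 𝓘(ℂ, ℂ) 𝓘(ℂ, C2) γ z → γ z ∈ M → γ z ∈ Φ.source →
      pullbackDensity η γ z ≤ C * (‖deriv (fun ζ => (Φ (γ ζ)).1) z‖ ^ 2 +
        ‖deriv (fun ζ => (Φ (γ ζ)).2) z‖ ^ 2) := by
  obtain ⟨e, he, hes, L, c, hL⟩ := hΦ.exists_affine
  have hpe : p ∈ e.source := by rwa [hes]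
  have h3 : ContinuousAt (formInChart η.toFun e) (e p) :=
    (η.smooth e he).continuousOn.continuousAt (e.open_target.mem_nhds (e.map_source hpe))
  have h4 : ContinuousAt (fun x => ‖formInChart η.toFun e (e x)‖) p :=
    (ContinuousAt.comp (f := e) h3 (e.continuousAt hpe)).norm
  have hev := h4.eventually (gt_mem_nhds (lt_add_one _))
  obtain ⟨M, hM, hMo, hpM⟩ := _root_.eventually_nhds_iff.1 hev
  set C₀ := ‖formInChart η.toFun e (e p)‖ + 1
  refine ⟨M, hMo, hpM, C₀ * ‖L‖ ^ 2, by positivity, fun γ z hγ hzM hzs => ?_⟩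
  have hze : γ z ∈ e.source := by rwa [hes]
  rw [pullbackDensity_eq_formInChart η he hγ hze]
  have hΦd : MDifferentiableAt 𝓘(ℂ, C2) 𝓘(ℂ, ℂ × ℂ) Φ (γ z) :=
    hΦ.mdifferentiableOn.mdifferentiableAt (Φ.open_source.mem_nhds hzs)
  have hg : DifferentiableAt ℂ (Φ ∘ γ) z := mdifferentiableAt_iff_differentiableAt.1 (hΦd.comp z hγ)
  have heq : e ∘ γ =ᶠ[𝓝 z] fun ζ => c + L ((Φ ∘ γ) ζ) := by
    filter_upwards [hγ.continuousAt (Φ.open_source.mem_nhds hzs)] with ζ hζ using hL _ hζ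
  have hder : deriv (e ∘ γ) z = L (deriv (Φ ∘ γ) z) := by
    rw [heq.deriv_eq]
    exact ((L.hasFDerivAt.comp_hasDerivAt z hg.hasDerivAt).const_add c).deriv
  have h1 : deriv (fun ζ => (Φ (γ ζ)).1) z = (deriv (Φ ∘ γ) z).1 :=
    ((ContinuousLinearMap.fst ℂ ℂ ℂ).hasFDerivAt.comp_hasDerivAt z hg.hasDerivAt).deriv
  have h2 : deriv (fun ζ => (Φ (γ ζ)).2) z = (deriv (Φ ∘ γ) z).2 :=
    ((ContinuousLinearMap.snd ℂ ℂ ℂ).hasFDerivAt.comp_hasDerivAt z hg.hasDerivAt).deriv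
  rw [h1, h2, hder]
  set v := deriv (Φ ∘ γ) z
  have hv : ‖v‖ ^ 2 ≤ ‖v.1‖ ^ 2 + ‖v.2‖ ^ 2 := by
    rw [Prod.norm_def]
    rcases max_choice ‖v.1‖ ‖v.2‖ with h | h <;> rw [h] <;>
      nlinarith [sq_nonneg ‖v.1‖, sq_nonneg ‖v.2‖]
  calc formInChart η.toFun e (e (γ z)) ![L v, Complex.I • L v]
      ≤ ‖formInChart η.toFun e (e (γ z)) ![L v, Complex.I • L v]‖ := le_abs_self _
    _ ≤ ‖formInChart η.toFun e (e (γ z))‖ * ∏ i, ‖(![L v, Complex.I • L v] : Fin 2 → C2) i‖ :=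
        ContinuousAlternatingMap.le_opNorm _ _
    _ = ‖formInChart η.toFun e (e (γ z))‖ * ‖L v‖ ^ 2 := by
        simp [Fin.prod_univ_two, norm_smul, sq]
    _ ≤ C₀ * (‖L‖ * ‖v‖) ^ 2 := by
        gcongr
        · exact (hM _ hzM).le
        · exact L.le_opNorm v
    _ ≤ C₀ * ‖L‖ ^ 2 * (‖v.1‖ ^ 2 + ‖v.2‖ ^ 2) := by
        rw [mul_pow, ← mul_assoc]
        gcongr

/-- The area of a curve is locally finite: in suitable coordinates it is bounded by the areas of
the two coordinate projections, both of which have finite fibres. -/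
theorem exists_sum_lintegral_le [IsManifold 𝓘(ℂ, C2) ω X] (hV : IsCurve V) (η : ClosedForm X 2)
    {p : X} (hp : p ∈ V) : ∃ N : Set X, IsOpen N ∧ p ∈ N ∧ ∃ K : ℝ≥0∞, K ≠ ⊤ ∧
      ∀ (n : ℕ) (P : Fin n → CoordinatePiece V),
        (Pairwise fun i j => Disjoint ((P i).γ '' (P i).A) ((P j).γ '' (P j).A)) →
        ∑ i, ∫⁻ z in (P i).A ∩ (P i).γ ⁻¹' N,
          ENNReal.ofReal (1 * pullbackDensity η (P i).γ z) ≤ K := by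
  have : IsManifold 𝓘(ℂ, C2) 1 X := IsManifold.of_le (n := ω) le_top
  obtain ⟨Φ, O, f, r, r', hc⟩ := exists_adaptedChart hV hp isOpen_univ trivial
  obtain ⟨r₁', -, -, -, r₁, hr₁, -, hZ₁⟩ :=
    exists_zeroFree hc.isOpen hc.zero_mem hc.diff hc.not_eventually_snd one_pos
  obtain ⟨r₂', -, -, -, r₂, hr₂, -, hZ₂⟩ := exists_zeroFree (f := f ∘ Prod.swap)
    (hc.isOpen.preimage continuous_swap) hc.zero_mem
    (hc.diff.comp (f := Prod.swap) (differentiable_snd.prodMk differentiable_fst).differentiableOn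
      fun x hx => hx) hc.not_eventually_fst one_pos
  obtain ⟨δ₁, hδ₁, H₁⟩ := exists_sum_lintegral_fst_le hr₁ hZ₁
  obtain ⟨δ₂, hδ₂, H₂⟩ := exists_sum_lintegral_fst_le hr₂ hZ₂
  obtain ⟨M, hMo, hpM, C, hC, hdens⟩ := pullbackDensity_le η hc.chart hc.mem_source
  set δ := min δ₁ δ₂
  have hδ : 0 < δ := lt_min hδ₁ hδ₂
  obtain ⟨K₁, hK₁, H₁⟩ := H₁ δ (min_le_left _ _)
  obtain ⟨K₂, hK₂, H₂⟩ := H₂ δ (min_le_right _ _)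
  obtain ⟨hNo, hpN⟩ := hc.isOpen_preimage (hc.isOpen.inter (isOpen_ball.prod isOpen_ball))
    (show (0 : ℂ × ℂ) ∈ O ∩ ball (0 : ℂ) δ ×ˢ ball (0 : ℂ) δ from
      ⟨hc.zero_mem, mem_ball_self hδ, mem_ball_self hδ⟩)
  set N := M ∩ (Φ.source ∩ Φ ⁻¹' (O ∩ ball (0 : ℂ) δ ×ˢ ball (0 : ℂ) δ)) with hN
  have hNo' : IsOpen N := hMo.inter hNo
  refine ⟨N, hNo', ⟨hpM, hpN⟩, ENNReal.ofReal C * (K₁ + K₂),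
    ENNReal.mul_ne_top ENNReal.ofReal_ne_top (ENNReal.add_ne_top.2 ⟨hK₁, hK₂⟩), ?_⟩
  intro n P hP
  have hD := fun i => (measurableSet_inter_preimage (P i) hNo').1
  have hA := fun i => (measurableSet_inter_preimage (P i) hNo').2
  have hAD : ∀ i, (P i).A ∩ (P i).γ ⁻¹' N ⊆ (P i).D ∩ (P i).γ ⁻¹' N := fun i =>
    inter_subset_inter_left _ (P i).A_subset
  have hg : ∀ i, DifferentiableOn ℂ (fun ζ => Φ ((P i).γ ζ)) ((P i).D ∩ (P i).γ ⁻¹' N) := by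
    intro i
    rw [← mdifferentiableOn_iff_differentiableOn]
    exact hc.chart.mdifferentiableOn.comp ((P i).holomorphic.mono inter_subset_left)
      fun x hx => hx.2.2.1
  have hgA : ∀ i, ∀ ζ ∈ (P i).A ∩ (P i).γ ⁻¹' N, Φ ((P i).γ ζ) ∈ ball (0 : ℂ) δ ×ˢ ball (0 : ℂ) δ ∧
      f (Φ ((P i).γ ζ)) = 0 := by
    rintro i ζ ⟨hζ, hζN⟩
    refine ⟨hζN.2.2.2, hc.eq_zero _ ⟨Φ.map_source hζN.2.1, ?_⟩ hζN.2.2.1⟩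
    rw [mem_preimage, Φ.left_inv hζN.2.1]
    exact ((P i).mapsTo ((P i).A_subset hζ)).1
  have hinj : ∀ i j, ∀ ζ ∈ (P i).A ∩ (P i).γ ⁻¹' N, ∀ ξ ∈ (P j).A ∩ (P j).γ ⁻¹' N,
      Φ ((P i).γ ζ) = Φ ((P j).γ ξ) → i = j ∧ ζ = ξ := by
    rintro i j ζ ⟨hζ, hζN⟩ ξ ⟨hξ, hξN⟩ h
    have h' := Φ.injOn hζN.2.1 hξN.2.1 h
    have hij : i = j := by
      by_contra hne
      exact (hP hne).le_bot ⟨⟨ζ, hζ, rfl⟩, ⟨ξ, hξ, h'.symm⟩⟩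
    subst hij
    exact ⟨rfl, (P i).injOn ((P i).A_subset hζ) ((P i).A_subset hξ) h'⟩
  have B₁ := H₁ n (fun i ζ => Φ ((P i).γ ζ)) _ _ hD hg hA hAD hgA hinj
  have B₂ := H₂ n (fun i ζ => (Φ ((P i).γ ζ)).swap) _ _ hD (fun i => (hg i).snd.prodMk (hg i).fst)
    hA hAD (fun i ζ hζ => ⟨(hgA i ζ hζ).1.symm, by simpa using (hgA i ζ hζ).2⟩)
    (fun i j ζ hζ ξ hξ h => hinj i j ζ hζ ξ hξ (Prod.swap_injective h))
  refine le_trans ?_ (mul_le_mul_right (add_le_add B₁ B₂) _)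
  rw [← Finset.sum_add_distrib, Finset.mul_sum]
  refine Finset.sum_le_sum fun i _ => ?_
  rw [← lintegral_add_left (by
    exact ((measurable_deriv _).norm.pow_const 2).ennreal_ofReal),
    ← lintegral_const_mul' _ _ ENNReal.ofReal_ne_top]
  refine setLIntegral_mono' (hA i) fun ζ hζ => ?_
  rw [one_mul, ← ENNReal.ofReal_add (by positivity) (by positivity), ← ENNReal.ofReal_mul hC]
  exact ENNReal.ofReal_le_ofReal (hdens _ ζ ((P i).holomorphic.mdifferentiableAt
    ((P i).isOpen_D.mem_nhds ((P i).A_subset hζ.1))) hζ.2.1 hζ.2.2.1)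

/-- Near a point, the area of disjoint pieces of a curve is bounded by the areas of their
projections to the two coordinate axes, counted with multiplicity, and the fibres of the projections
have bounded cardinality. Compactness makes the local bounds global. -/
theorem partIntegral_one_ne_top [IsManifold 𝓘(ℂ, C2) ω X] [CompactSpace X] (hV : IsCurve V)
    (η : ClosedForm X 2) : partIntegral 1 η V ≠ ⊤ := by
  choose! N hNo hpN K hK hle using fun p (hp : p ∈ V) => exists_sum_lintegral_le hV η hp
  obtain ⟨t, htV, ht⟩ := hV.1.1.1.isCompact.elim_nhds_subcover N fun p hp =>
    (hNo p hp).mem_nhds (hpN p hp)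
  refine ne_top_of_le_ne_top (ENNReal.sum_ne_top.2 fun p hp => hK p (htV p hp))
    (iSup_le fun n => iSup_le fun P => iSup_le fun hP =>
      (?_ : _ ≤ ∑ p ∈ t, K p))
  calc ∑ i, ∫⁻ z in (P i).A, ENNReal.ofReal (1 * pullbackDensity η (P i).γ z)
      ≤ ∑ i, ∑ p ∈ t, ∫⁻ z in (P i).A ∩ (P i).γ ⁻¹' N p,
          ENNReal.ofReal (1 * pullbackDensity η (P i).γ z) := by
        refine Finset.sum_le_sum fun i _ => ?_
        rw [← Finset.sum_coe_sort t, ← tsum_fintype (L := .unconditional _)]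
        refine le_trans (lintegral_mono_set fun z hz => ?_) (lintegral_iUnion_le
          (fun p : t => (P i).A ∩ (P i).γ ⁻¹' N p) _)
        obtain ⟨p, hp, hzp⟩ := mem_iUnion₂.1 (ht ((P i).mapsTo ((P i).A_subset hz)).1)
        exact mem_iUnion.2 ⟨⟨p, hp⟩, hz, hzp⟩
    _ = ∑ p ∈ t, ∑ i, ∫⁻ z in (P i).A ∩ (P i).γ ⁻¹' N p,
          ENNReal.ofReal (1 * pullbackDensity η (P i).γ z) := Finset.sum_comm
    _ ≤ ∑ p ∈ t, K p := Finset.sum_le_sum fun p hp => hle p (htV p hp) n P hP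

/-- A curve has positive area with respect to a Kähler form. -/
theorem integralOver_pos [IsManifold 𝓘(ℂ, C2) ω X] [CompactSpace X] (hV : IsCurve V)
    {κ : ClosedForm X 2} (hκ : κ.IsKahler) : 0 < integralOver κ V := by
  rw [integralOver, partIntegral_neg_one hκ, ENNReal.toReal_zero, sub_zero]
  exact ENNReal.toReal_pos (partIntegral_one_pos hV hκ).ne' (partIntegral_one_ne_top hV κ)

end Lelong

end PlaneCurve

namespace ZStability

/-! ### Sections of sheaves of modules on a curve -/

section Sections

open CategoryTheory.Limits

variable {X : Type u} [TopologicalSpace X] [ChartedSpace C2 X] {V : Set X}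

variable {𝓔 𝓕 𝓠 𝓢 : SheafOfModules.{u} (structureSheaf V)}

/-- The map `𝓔(W) → 𝓠(W)` induced by a morphism of sheaves. -/
noncomputable def sectionMap (q : 𝓔 ⟶ 𝓠) (W : Opens (TopCat.of V)) :
    𝓔.val.obj (op W) →ₗ[(structureSheaf V).obj.obj (op W)] 𝓠.val.obj (op W) :=
  (q.val.app (op W)).hom

lemma sectionMap_restrictSection (q : 𝓔 ⟶ 𝓠) {W W' : Opens (TopCat.of V)} (h : W' ≤ W)
    (s : 𝓔.val.obj (op W)) :
    sectionMap q W' (restrictSection 𝓔 h s) = restrictSection 𝓠 h (sectionMap q W s) :=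
  PresheafOfModules.naturality_apply q.val (homOfLE h).op s

lemma restrictSection_smul (𝓕 : SheafOfModules.{u} (structureSheaf V)) {W W' : Opens (TopCat.of V)}
    (h : W' ≤ W) (f : (structureSheaf V).obj.obj (op W)) (s : 𝓕.val.obj (op W)) :
    restrictSection 𝓕 h (f • s) = restrictFunction h f • restrictSection 𝓕 h s :=
  𝓕.val.map_smul (homOfLE h).op f s

lemma restrictSection_zero (𝓕 : SheafOfModules.{u} (structureSheaf V)) {W W' : Opens (TopCat.of V)}
    (h : W' ≤ W) : restrictSection 𝓕 h 0 = 0 :=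
  map_zero (𝓕.val.map (homOfLE h).op).hom

lemma restrictSection_restrictSection (𝓕 : SheafOfModules.{u} (structureSheaf V))
    {W W' W'' : Opens (TopCat.of V)} (h : W' ≤ W) (h' : W'' ≤ W') (s : 𝓕.val.obj (op W)) :
    restrictSection 𝓕 h' (restrictSection 𝓕 h s) = restrictSection 𝓕 (h'.trans h) s := by
  exact (ConcreteCategory.congr_hom (𝓕.val.presheaf.map_comp (homOfLE h).op (homOfLE h').op) s).symm

lemma restrictSection_self (𝓕 : SheafOfModules.{u} (structureSheaf V)) {W : Opens (TopCat.of V)}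
    (h : W ≤ W) (s : 𝓕.val.obj (op W)) : restrictSection 𝓕 h s = s := by
  exact ConcreteCategory.congr_hom (𝓕.val.presheaf.map_id (op W)) s

lemma restrictSection_sum (𝓕 : SheafOfModules.{u} (structureSheaf V)) {W W' : Opens (TopCat.of V)}
    (h : W' ≤ W) {ι : Type*} [Fintype ι] (s : ι → 𝓕.val.obj (op W)) :
    restrictSection 𝓕 h (∑ i, s i) = ∑ i, restrictSection 𝓕 h (s i) :=
  map_sum (𝓕.val.map (homOfLE h).op).hom s _

lemma restrictSection_combination (𝓕 : SheafOfModules.{u} (structureSheaf V))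
    {W W' W'' : Opens (TopCat.of V)} (h : W' ≤ W) (h' : W'' ≤ W') {n : ℕ}
    (s : Fin n → 𝓕.val.obj (op W)) (c : Fin n → (structureSheaf V).obj.obj (op W')) :
    restrictSection 𝓕 h' (combination 𝓕 h s c) =
      combination 𝓕 (h'.trans h) s fun i => restrictFunction h' (c i) := by
  rw [combination, restrictSection_sum]
  exact Finset.sum_congr rfl fun i _ => by
    rw [restrictSection_smul, restrictSection_restrictSection]

lemma combination_restrictSection (𝓕 : SheafOfModules.{u} (structureSheaf V))
    {W W' W'' : Opens (TopCat.of V)} (h : W' ≤ W) (h' : W'' ≤ W') {n : ℕ}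
    (s : Fin n → 𝓕.val.obj (op W)) (c : Fin n → (structureSheaf V).obj.obj (op W'')) :
    combination 𝓕 h' (fun i => restrictSection 𝓕 h (s i)) c = combination 𝓕 (h'.trans h) s c :=
  Finset.sum_congr rfl fun i _ => by rw [restrictSection_restrictSection]

lemma sectionMap_combination (q : 𝓔 ⟶ 𝓠) {W W' : Opens (TopCat.of V)} (h : W' ≤ W) {n : ℕ}
    (s : Fin n → 𝓔.val.obj (op W)) (c : Fin n → (structureSheaf V).obj.obj (op W')) :
    sectionMap q W' (combination 𝓔 h s c) = combination 𝓠 h (fun i => sectionMap q W (s i)) c := by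
  rw [combination, map_sum]
  exact Finset.sum_congr rfl fun i _ => by rw [map_smul, sectionMap_restrictSection]

/-- The combination of sections, as a linear map. -/
noncomputable def combinationLinear (𝓕 : SheafOfModules.{u} (structureSheaf V))
    {W W' : Opens (TopCat.of V)} (h : W' ≤ W) {n : ℕ} (s : Fin n → 𝓕.val.obj (op W)) :
    (Fin n → (structureSheaf V).obj.obj (op W')) →ₗ[(structureSheaf V).obj.obj (op W')]
      𝓕.val.obj (op W') where
  toFun := combination 𝓕 h s
  map_add' c d := by
    simp only [combination, Pi.add_apply, add_smul, Finset.sum_add_distrib]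
  map_smul' f c := by
    simp only [combination, Pi.smul_apply, smul_eq_mul, RingHom.id_apply, Finset.smul_sum]
    exact Finset.sum_congr rfl fun i _ => mul_smul f (c i) (restrictSection 𝓕 h (s i))

/-- Sections agreeing locally are equal. -/
lemma section_ext (𝓕 : SheafOfModules.{u} (structureSheaf V)) {W : Opens (TopCat.of V)}
    {s t : 𝓕.val.obj (op W)} (h : ∀ p ∈ W, ∃ (W' : Opens (TopCat.of V)) (hW : W' ≤ W), p ∈ W' ∧
      restrictSection 𝓕 hW s = restrictSection 𝓕 hW t) : s = t := by
  choose! W' hW hp hst using h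
  refine TopCat.Sheaf.eq_of_locally_eq' (F := ((SheafOfModules.toSheaf _).obj 𝓕))
    (fun p : W => W' p) W (fun p => homOfLE (hW p p.2)) (fun p hpW => ?_) s t
    fun p => hst p p.2
  exact Opens.mem_iSup.2 ⟨⟨p, hpW⟩, hp p hpW⟩

lemma section_eq_zero (𝓕 : SheafOfModules.{u} (structureSheaf V)) {W : Opens (TopCat.of V)}
    {s : 𝓕.val.obj (op W)} (h : ∀ p ∈ W, ∃ (W' : Opens (TopCat.of V)) (hW : W' ≤ W), p ∈ W' ∧
      restrictSection 𝓕 hW s = 0) : s = 0 :=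
  section_ext 𝓕 fun p hp => by
    obtain ⟨W', hW, hpW, h0⟩ := h p hp
    exact ⟨W', hW, hpW, by rw [h0, restrictSection_zero]⟩

/-- Two sections agreeing on the intersection can be glued. -/
lemma exists_glue (𝓕 : SheafOfModules.{u} (structureSheaf V)) {W₁ W₂ : Opens (TopCat.of V)}
    (s₁ : 𝓕.val.obj (op W₁)) (s₂ : 𝓕.val.obj (op W₂))
    (h : restrictSection 𝓕 (inf_le_left : W₁ ⊓ W₂ ≤ W₁) s₁ =
      restrictSection 𝓕 (inf_le_right : W₁ ⊓ W₂ ≤ W₂) s₂) {W : Opens (TopCat.of V)}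
    (h₁ : W₁ ≤ W) (h₂ : W₂ ≤ W) (hW : W ≤ W₁ ⊔ W₂) :
    ∃ s : 𝓕.val.obj (op W), restrictSection 𝓕 h₁ s = s₁ ∧ restrictSection 𝓕 h₂ s = s₂ := by
  let U : Bool → Opens (TopCat.of V) := fun b => bif b then W₁ else W₂
  let sf : ∀ b, ToType (((SheafOfModules.toSheaf _).obj 𝓕).obj.obj (op (U b))) := fun b =>
    match b with
    | true => s₁
    | false => s₂
  obtain ⟨s, hs, -⟩ := TopCat.Sheaf.existsUnique_gluing' ((SheafOfModules.toSheaf _).obj 𝓕) U W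
    (fun b => match b with
      | true => homOfLE h₁
      | false => homOfLE h₂) (hW.trans (sup_le (le_iSup U true) (le_iSup U false))) sf (by
      rintro (_ | _) (_ | _)
      · rfl
      · have := congrArg (restrictSection 𝓕 (le_inf inf_le_right inf_le_left : W₂ ⊓ W₁ ≤ W₁ ⊓ W₂)) h
        rw [restrictSection_restrictSection, restrictSection_restrictSection] at this
        exact this.symm
      · exact h
      · rfl)
  exact ⟨s, hs true, hs false⟩

end Sections

end ZStability

namespace ZStability

/-! ### Exactness on sections -/

section Exactness

open CategoryTheory.Limits

variable {X : Type u} [TopologicalSpace X] [ChartedSpace C2 X] {V : Set X}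
  {𝓔 𝓕 𝓠 𝓢 : SheafOfModules.{u} (structureSheaf V)}

/-- An epimorphism of sheaves of modules is locally surjective: the sheaf associated with the
cokernel of the underlying morphism of presheaves vanishes. -/
theorem exists_sectionMap_eq_of_epi (q : 𝓔 ⟶ 𝓠) [Epi q] {W : Opens (TopCat.of V)}
    (t : 𝓠.val.obj (op W)) {p : V} (hp : p ∈ W) :
    ∃ (W' : Opens (TopCat.of V)) (h : W' ≤ W), p ∈ W' ∧ ∃ s : 𝓔.val.obj (op W'),
      sectionMap q W' s = restrictSection 𝓠 h t := by
  let R := structureSheaf V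
  let α : R.obj ⟶ R.obj := 𝟙 _
  let a : PresheafOfModules.{u} R.obj ⥤ SheafOfModules.{u} R := PresheafOfModules.sheafification α
  let adj := PresheafOfModules.sheafificationAdjunction.{u} α
  let G := SheafOfModules.forget R ⋙ PresheafOfModules.restrictScalars α
  have hepi : Epi (a.map (G.map q)) := by
    have hnat := adj.counit.naturality q
    have : a.map (G.map q) = adj.counit.app 𝓔 ≫ q ≫ inv (adj.counit.app 𝓠) := by
      rw [← Category.assoc, IsIso.eq_comp_inv]
      exact hnat
    rw [this]
    infer_instance
  let π := cokernel.π (G.map q)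
  have hzero : a.map π = 0 := by
    rw [← cancel_epi (a.map (G.map q)), ← a.map_comp, cokernel.condition, comp_zero]
    exact a.map_zero _ _
  have hunit : π ≫ adj.unit.app (cokernel (G.map q)) = 0 := by
    have h1 : π ≫ adj.unit.app (cokernel (G.map q)) = adj.unit.app (G.obj 𝓠) ≫ G.map (a.map π) :=
      adj.unit.naturality π
    rw [h1, hzero, G.map_zero, comp_zero]
  have hab := congrArg (PresheafOfModules.toPresheaf R.obj).map hunit
  rw [Functor.map_comp, Functor.map_zero,
    PresheafOfModules.toPresheaf_map_sheafificationAdjunction_unit_app] at hab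
  let x : (cokernel (G.map q)).obj (op W) := (π.app (op W)).hom t
  have hx : (toSheafify (Opens.grothendieckTopology (TopCat.of V))
      (cokernel (G.map q)).presheaf).app (op W) x =
      (toSheafify (Opens.grothendieckTopology (TopCat.of V))
      (cokernel (G.map q)).presheaf).app (op W) 0 := by
    rw [map_zero]
    exact ConcreteCategory.congr_hom (NatTrans.congr_app hab (op W)) t
  have hinj : Presheaf.IsLocallyInjective (Opens.grothendieckTopology (TopCat.of V))
      (toSheafify (Opens.grothendieckTopology (TopCat.of V)) (cokernel (G.map q)).presheaf) :=
    inferInstance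
  obtain ⟨W', i, hi, hpW'⟩ := hinj.equalizerSieve_mem (X := op W) x 0 hx p hp
  refine ⟨W', i.le, hpW', ?_⟩
  have hi' : (π.app (op W')).hom (restrictSection 𝓠 i.le t) = 0 := by
    have h1 := PresheafOfModules.naturality_apply π i.op t
    have h2 : (cokernel (G.map q)).presheaf.map i.op x =
        (cokernel (G.map q)).presheaf.map i.op 0 := hi
    rw [map_zero] at h2
    exact h1.trans h2
  have hex := (ShortComplex.exact_cokernel (G.map q)).map
    (PresheafOfModules.evaluation R.obj (op W'))
  rw [ShortComplex.moduleCat_exact_iff] at hex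
  exact hex _ hi'

lemma sectionMap_injective (i : 𝓢 ⟶ 𝓔) [Mono i] (W : Opens (TopCat.of V)) :
    Function.Injective (sectionMap i W) := by
  have : Mono ((SheafOfModules.evaluation (structureSheaf V) (op W)).map i) := inferInstance
  exact (ModuleCat.mono_iff_injective _).1 this

lemma isZero_iff_forall_section_eq_zero :
    IsZero 𝓕 ↔ ∀ (W : Opens (TopCat.of V)) (s : 𝓕.val.obj (op W)), s = 0 := by
  rw [IsZero.iff_id_eq_zero]
  constructor
  · intro h W s
    exact congrArg (fun f : 𝓕 ⟶ 𝓕 => sectionMap f W s) h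
  · intro h
    ext W s
    exact (h W.unop _).trans (h W.unop _).symm

lemma shortExact_kernel (q : 𝓔 ⟶ 𝓠) [Epi q] :
    (ShortComplex.mk (kernel.ι q) q (kernel.condition q)).ShortExact where
  exact := ShortComplex.exact_kernel q
  mono_f := inferInstance
  epi_g := inferInstance

lemma isIso_of_isZero_kernel (q : 𝓔 ⟶ 𝓠) [Epi q] (h : IsZero (kernel q)) : IsIso q := by
  have : Mono q := Preadditive.mono_of_isZero_kernel q h
  exact isIso_of_mono_of_epi q

end Exactness

end ZStability

namespace ZStability

/-! ### Holomorphic functions on a curve -/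

section Functions

variable {X : Type u} [TopologicalSpace X] [ChartedSpace C2 X] {V : Set X}

/-- The value of a function at a point. -/
def evalAt {W : Opens (TopCat.of V)} {x : V} (hx : x ∈ W) :
    (structureSheaf V).obj.obj (op W) →+* ℂ :=
  (Pi.evalRingHom (fun _ : W => ℂ) ⟨x, hx⟩).comp (holFunctions V W).subtype

lemma evalAt_restrictFunction {W W' : Opens (TopCat.of V)} (h : W' ≤ W) {x : V} (hx : x ∈ W')
    (f : (structureSheaf V).obj.obj (op W)) :
    evalAt hx (restrictFunction h f) = evalAt (h hx) f := rfl

lemma function_ext {W : Opens (TopCat.of V)} {f g : (structureSheaf V).obj.obj (op W)}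
    (h : ∀ (x : V) (hx : x ∈ W), evalAt hx f = evalAt hx g) : f = g :=
  Subtype.ext (funext fun x => h x.1 x.2)

/-- The open subset of `V` cut out by an open subset of the surface. -/
def openTrace (V : Set X) {U : Set X} (hU : IsOpen U) : Opens (TopCat.of V) :=
  ⟨{x : V | x.1 ∈ U}, hU.preimage continuous_subtype_val⟩

lemma exists_openTrace_le {X : Type u} [TopologicalSpace X] {V : Set X} {W : Opens (TopCat.of V)}
    {x : V} (hx : x ∈ W) :
    ∃ (U : Set X) (hU : IsOpen U), x.1 ∈ U ∧ openTrace V hU ≤ W := by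
  obtain ⟨T, hT, hTW⟩ := isOpen_induced_iff.1 W.isOpen
  have key : ∀ y : V, y ∈ W ↔ y.1 ∈ T := fun y => by
    change y ∈ (W : Set V) ↔ _
    rw [← hTW]; rfl
  exact ⟨T, hT, (key x).1 hx, fun y hy => (key y).2 hy⟩

lemma exists_extension {W : Opens (TopCat.of V)} (f : (structureSheaf V).obj.obj (op W)) {x : V}
    (hx : x ∈ W) : ∃ (U : Set X), IsOpen U ∧ x.1 ∈ U ∧ ∃ g : X → ℂ,
      MDifferentiableOn 𝓘(ℂ, C2) 𝓘(ℂ, ℂ) g U ∧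
      ∀ (y : V) (hy : y ∈ W), y.1 ∈ U → evalAt hy f = g y.1 := by
  obtain ⟨U, hU, hxU, g, hg, hfg⟩ := f.2 ⟨x, hx⟩
  exact ⟨U, hU, hxU, g, hg, fun y hy hyU => hfg ⟨y, hy⟩ hyU⟩

lemma exists_function_of_mdifferentiableOn {W : Opens (TopCat.of V)} {U : Set X} (hU : IsOpen U)
    {g : X → ℂ} (hg : MDifferentiableOn 𝓘(ℂ, C2) 𝓘(ℂ, ℂ) g U) (hWU : ∀ y : V, y ∈ W → y.1 ∈ U) :
    ∃ f : (structureSheaf V).obj.obj (op W), ∀ (y : V) (hy : y ∈ W), evalAt hy f = g y.1 :=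
  ⟨(⟨fun y => g y.1.1, fun p => ⟨U, hU, hWU p.1 p.2, g, hg, fun _ _ => rfl⟩⟩ : holFunctions V W),
    fun _ _ => rfl⟩

lemma exists_function_of_locally {W : Opens (TopCat.of V)} (φ : V → ℂ)
    (h : ∀ x ∈ W, ∃ (W' : Opens (TopCat.of V)), W' ≤ W ∧ x ∈ W' ∧
      ∃ g : (structureSheaf V).obj.obj (op W'), ∀ (y : V) (hy : y ∈ W'), evalAt hy g = φ y) :
    ∃ f : (structureSheaf V).obj.obj (op W), ∀ (y : V) (hy : y ∈ W), evalAt hy f = φ y := by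
  have hφ : (holFunctionPredicate V).pred fun y : W => φ y.1 := by
    refine (holFunctionPredicate V).locality _ fun p => ?_
    obtain ⟨W', hW', hp, g, hg⟩ := h p.1 p.2
    refine ⟨W', hp, homOfLE hW', ?_⟩
    have : (fun y : W' => φ y.1) = g.1 := funext fun y => (hg y.1 y.2).symm
    change (holFunctionPredicate V).pred (fun y : W' => φ y.1)
    rw [this]
    exact g.2
  exact ⟨(⟨fun y => φ y.1, hφ⟩ : holFunctions V W), fun _ _ => rfl⟩

lemma exists_mul_eq_one {W : Opens (TopCat.of V)} (f : (structureSheaf V).obj.obj (op W)) {x : V}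
    (hx : x ∈ W) (hf : evalAt hx f ≠ 0) : ∃ (W' : Opens (TopCat.of V)) (h : W' ≤ W), x ∈ W' ∧
      ∃ g : (structureSheaf V).obj.obj (op W'), g * restrictFunction h f = 1 := by
  obtain ⟨U, hU, hxU, g, hg, hfg⟩ := exists_extension f hx
  have hU' : IsOpen (U ∩ g ⁻¹' {0}ᶜ) :=
    hg.continuousOn.isOpen_inter_preimage hU isOpen_compl_singleton
  have hxU' : x.1 ∈ U ∩ g ⁻¹' {0}ᶜ := ⟨hxU, by
    simp only [Set.mem_preimage, Set.mem_compl_iff, Set.mem_singleton_iff, ← hfg x hx hxU]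
    exact hf⟩
  have hinv : MDifferentiableOn 𝓘(ℂ, C2) 𝓘(ℂ, ℂ) (fun y => (g y)⁻¹) (U ∩ g ⁻¹' {0}ᶜ) := by
    intro y hy
    have h1 : MDifferentiableAt 𝓘(ℂ, ℂ) 𝓘(ℂ, ℂ) (fun z : ℂ => z⁻¹) (g y) :=
      (differentiableAt_inv hy.2).mdifferentiableAt
    exact (h1.comp y (hg.mdifferentiableAt (hU.mem_nhds hy.1))).mdifferentiableWithinAt
  obtain ⟨k, hk⟩ := exists_function_of_mdifferentiableOn (W := W ⊓ openTrace V hU') hU' hinv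
    fun y hy => hy.2
  refine ⟨W ⊓ openTrace V hU', inf_le_left, ⟨hx, hxU'⟩, k, function_ext fun y hy => ?_⟩
  rw [map_mul, hk, evalAt_restrictFunction, hfg y hy.1 hy.2.1, map_one]
  exact inv_mul_cancel₀ hy.2.2

lemma nontrivial_functions {W : Opens (TopCat.of V)} (hW : (W : Set V).Nonempty) :
    Nontrivial ((structureSheaf V).obj.obj (op W)) := by
  obtain ⟨x, hx⟩ := hW
  exact (evalAt hx).domain_nontrivial

lemma le_of_surjective {W : Opens (TopCat.of V)} (hW : (W : Set V).Nonempty) {n m : ℕ}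
    (f : (Fin n → (structureSheaf V).obj.obj (op W)) →ₗ[(structureSheaf V).obj.obj (op W)]
      (Fin m → (structureSheaf V).obj.obj (op W))) (hf : Function.Surjective f) : m ≤ n := by
  have h1 := nontrivial_functions hW
  have h2 : Nontrivial (holFunctions V W) := h1
  have : RankCondition ((structureSheaf V).obj.obj (op W)) :=
    inferInstanceAs (RankCondition (holFunctions V W))
  exact le_of_fin_surjective _ f hf

lemma injective_of_surjective {W : Opens (TopCat.of V)} {n : ℕ}
    (f : (Fin n → (structureSheaf V).obj.obj (op W)) →ₗ[(structureSheaf V).obj.obj (op W)]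
      (Fin n → (structureSheaf V).obj.obj (op W))) (hf : Function.Surjective f) :
    Function.Injective f := by
  have : OrzechProperty ((structureSheaf V).obj.obj (op W)) :=
    inferInstanceAs (OrzechProperty (holFunctions V W))
  exact OrzechProperty.injective_of_surjective_endomorphism f hf

end Functions

/-! ### Generic freeness and the rank -/

section Rank

open CategoryTheory.Limits

variable {X : Type u} [TopologicalSpace X] [ChartedSpace C2 X] {V : Set X}
  {𝓔 𝓕 𝓠 : SheafOfModules.{u} (structureSheaf V)}

/-- The sections `s` locally generate `𝓕` over `W`. -/
def Generates (𝓕 : SheafOfModules.{u} (structureSheaf V)) {W : Opens (TopCat.of V)} {n : ℕ}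
    (s : Fin n → 𝓕.val.obj (op W)) : Prop :=
  ∀ (W₁ : Opens (TopCat.of V)) (h₁ : W₁ ≤ W) (t : 𝓕.val.obj (op W₁)), ∀ q ∈ W₁,
    ∃ (W₂ : Opens (TopCat.of V)) (h₂ : W₂ ≤ W₁), q ∈ W₂ ∧
      ∃ c : Fin n → (structureSheaf V).obj.obj (op W₂),
        restrictSection 𝓕 h₂ t = combination 𝓕 (h₂.trans h₁) s c

lemma combination_succAbove (𝓕 : SheafOfModules.{u} (structureSheaf V))
    {W W' : Opens (TopCat.of V)} (h : W' ≤ W) {n : ℕ} (s : Fin (n + 1) → 𝓕.val.obj (op W))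
    (c : Fin (n + 1) → (structureSheaf V).obj.obj (op W')) (i : Fin (n + 1)) :
    combination 𝓕 h s c = c i • restrictSection 𝓕 h (s i) +
      combination 𝓕 h (fun k => s (i.succAbove k)) fun k => c (i.succAbove k) :=
  Fin.sum_univ_succAbove _ i

/-- Locally generating sections without relations form a basis. -/
lemma bijective_combination_of_injective {W : Opens (TopCat.of V)} {n : ℕ}
    {s : Fin n → 𝓕.val.obj (op W)} (hs : Generates 𝓕 s)
    (hinj : ∀ (W' : Opens (TopCat.of V)) (h : W' ≤ W), Function.Injective (combination 𝓕 h s))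
    (W' : Opens (TopCat.of V)) (h : W' ≤ W) : Function.Bijective (combination 𝓕 h s) := by
  refine ⟨hinj W' h, fun t => ?_⟩
  choose! N hN hqN d hd using fun q (hq : q ∈ W') => hs W' h t q hq
  classical
  -- the coefficients agree on overlaps, hence glue
  have hval : ∀ (y : V) (hy : y ∈ W') (z : V) (hz : z ∈ W') (hzy : z ∈ N y) (i : Fin n),
      evalAt hzy (d y i) = evalAt (hqN z hz) (d z i) := by
    intro y hy z hz hzy i
    have hle1 : N y ⊓ N z ≤ N y := inf_le_left
    have hle2 : N y ⊓ N z ≤ N z := inf_le_right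
    have h1 := congrArg (restrictSection 𝓕 hle1) (hd y hy)
    have h2 := congrArg (restrictSection 𝓕 hle2) (hd z hz)
    rw [restrictSection_restrictSection, restrictSection_combination] at h1 h2
    have h3 := congr_fun (hinj _ (hle1.trans ((hN y hy).trans h)) (h1.symm.trans h2)) i
    exact congrArg (evalAt (show z ∈ N y ⊓ N z from ⟨hzy, hqN z hz⟩)) h3
  have hc : ∀ i, ∃ f : (structureSheaf V).obj.obj (op W'), ∀ (y : V) (hy : y ∈ W'),
      evalAt hy f = if h : y ∈ W' then evalAt (hqN y h) (d y i) else 0 := fun i =>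
    exists_function_of_locally _ fun x hx => ⟨N x, hN x hx, hqN x hx, d x i, fun y hy => by
      rw [dif_pos (hN x hx hy), hval x hx y (hN x hx hy) hy]⟩
  choose c hc using hc
  refine ⟨c, section_ext 𝓕 fun p hp => ⟨N p, hN p hp, hqN p hp, ?_⟩⟩
  rw [restrictSection_combination, hd p hp]
  congr 1
  ext1 i
  refine function_ext fun y hy => ?_
  rw [evalAt_restrictFunction, hc, dif_pos (hN p hp hy), hval p hp y (hN p hp hy) hy]

/-- A sheaf of finite type is free over some nonempty open set: a minimal number of local
generators over nonempty open sets has no relations. -/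
theorem exists_isFreeOn (h𝓕 : IsFiniteType 𝓕) (hV : V.Nonempty) :
    ∃ (r : ℕ) (W : Opens (TopCat.of V)), (W : Set V).Nonempty ∧ IsFreeOn 𝓕 W r := by
  classical
  have hex : ∃ n : ℕ, ∃ W : Opens (TopCat.of V), (W : Set V).Nonempty ∧
      ∃ s : Fin n → 𝓕.val.obj (op W), Generates 𝓕 s := by
    obtain ⟨p, hp⟩ := hV
    obtain ⟨W, hpW, n, s, hs⟩ := h𝓕 ⟨p, hp⟩
    exact ⟨n, W, ⟨_, hpW⟩, s, hs⟩
  obtain ⟨W, hW, s, hs⟩ := Nat.find_spec hex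
  have hmin := fun m => Nat.find_min hex (m := m)
  generalize Nat.find hex = n at s hs hmin
  refine ⟨n, W, hW, s, bijective_combination_of_injective hs fun W' h => ?_⟩
  refine (injective_iff_map_eq_zero (combinationLinear 𝓕 h s)).2 fun c hc => ?_
  by_contra hne
  obtain ⟨i, hi⟩ := Function.ne_iff.1 hne
  obtain ⟨x, hx, hxi⟩ : ∃ (x : V) (hx : x ∈ W'), evalAt hx (c i) ≠ 0 := by
    by_contra! hcon
    exact hi (function_ext fun x hx => (hcon x hx).trans (map_zero (evalAt hx)).symm)
  obtain ⟨W'', hW'', hxW'', g, hg⟩ := exists_mul_eq_one (c i) hx hxi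
  obtain _ | m := n
  · exact i.elim0
  refine hmin m (Nat.lt_succ_self m) ⟨W'', ⟨x, hxW''⟩,
    fun k => restrictSection 𝓕 (hW''.trans h) (s (i.succAbove k)), ?_⟩
  intro W₁ h₁ t q hq
  obtain ⟨W₂, h₂, hq₂, d, hd⟩ := hs W₁ (h₁.trans (hW''.trans h)) t q hq
  refine ⟨W₂, h₂, hq₂, fun k => d (i.succAbove k) - d i * restrictFunction (h₂.trans h₁) g *
    restrictFunction (h₂.trans (h₁.trans hW'')) (c (i.succAbove k)), ?_⟩
  rw [combination_restrictSection, hd, combination_succAbove 𝓕 _ s d i]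
  have h0 := congrArg (restrictSection 𝓕 (h₂.trans (h₁.trans hW''))) hc
  rw [restrictSection_zero] at h0
  have h0' := (restrictSection_combination 𝓕 h (h₂.trans (h₁.trans hW'')) s c).symm.trans h0
  rw [combination_succAbove 𝓕 _ s _ i] at h0'
  have hg' : restrictFunction (h₂.trans h₁) g * restrictFunction (h₂.trans (h₁.trans hW'')) (c i) =
      1 := by
    have := congrArg (restrictFunction (h₂.trans h₁)) hg
    refine function_ext fun y hy => ?_
    exact congrArg (evalAt hy) this
  -- solve the relation for the section whose coefficient is invertible
  have h1 := congrArg (fun t => (d i * restrictFunction (h₂.trans h₁) g) • t) h0'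
  simp only [smul_add, smul_zero, smul_smul] at h1
  rw [mul_assoc, hg', mul_one] at h1
  rw [eq_neg_of_add_eq_zero_left h1]
  simp only [combination, sub_smul, Finset.sum_sub_distrib, Finset.smul_sum, mul_smul]
  abel

lemma IsFreeOn.restrict {W W' : Opens (TopCat.of V)} {r : ℕ} (h : IsFreeOn 𝓕 W r) (hW : W' ≤ W) :
    IsFreeOn 𝓕 W' r := by
  obtain ⟨s, hs⟩ := h
  refine ⟨fun i => restrictSection 𝓕 hW (s i), fun W'' h'' => ?_⟩
  have : combination 𝓕 h'' (fun i => restrictSection 𝓕 hW (s i)) = combination 𝓕 (h''.trans hW) s :=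
    funext fun c => combination_restrictSection 𝓕 hW h'' s c
  rw [this]
  exact hs W'' _

/-- The coordinates with respect to a basis. -/
lemma IsFreeOn.nonempty_linearEquiv {W : Opens (TopCat.of V)} {r : ℕ} (h : IsFreeOn 𝓕 W r) :
    Nonempty ((Fin r → (structureSheaf V).obj.obj (op W)) ≃ₗ[(structureSheaf V).obj.obj (op W)]
      𝓕.val.obj (op W)) := by
  obtain ⟨s, hs⟩ := h
  exact ⟨LinearEquiv.ofBijective (combinationLinear 𝓕 le_rfl s) (hs W le_rfl)⟩

lemma IsFreeOn.le_of_surjective {W : Opens (TopCat.of V)} (hW : (W : Set V).Nonempty) {n m : ℕ}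
    (h𝓔 : IsFreeOn 𝓔 W n) (h𝓠 : IsFreeOn 𝓠 W m) {q : 𝓔 ⟶ 𝓠}
    (hq : Function.Surjective (sectionMap q W)) : m ≤ n := by
  obtain ⟨e⟩ := h𝓔.nonempty_linearEquiv
  obtain ⟨e'⟩ := h𝓠.nonempty_linearEquiv
  exact ZStability.le_of_surjective hW (e'.symm.toLinearMap ∘ₗ sectionMap q W ∘ₗ e.toLinearMap)
    (e'.symm.surjective.comp (hq.comp e.surjective))

lemma IsFreeOn.injective_of_surjective {W : Opens (TopCat.of V)} {n : ℕ}
    (h𝓔 : IsFreeOn 𝓔 W n) (h𝓠 : IsFreeOn 𝓠 W n) {q : 𝓔 ⟶ 𝓠}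
    (hq : Function.Surjective (sectionMap q W)) : Function.Injective (sectionMap q W) := by
  obtain ⟨e⟩ := h𝓔.nonempty_linearEquiv
  obtain ⟨e'⟩ := h𝓠.nonempty_linearEquiv
  have := ZStability.injective_of_surjective
    (e'.symm.toLinearMap ∘ₗ sectionMap q W ∘ₗ e.toLinearMap)
    (e'.symm.surjective.comp (hq.comp e.surjective))
  have h2 : Function.Injective (sectionMap q W ∘ e) :=
    Function.Injective.of_comp (f := e'.symm) this
  exact (Function.Injective.of_comp_iff' _ e.bijective).1 h2

lemma IsFreeOn.unique {W : Opens (TopCat.of V)} (hW : (W : Set V).Nonempty) {n m : ℕ}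
    (hn : IsFreeOn 𝓕 W n) (hm : IsFreeOn 𝓕 W m) : n = m :=
  le_antisymm (hm.le_of_surjective hW hn (q := 𝟙 𝓕) Function.surjective_id)
    (hn.le_of_surjective hW hm (q := 𝟙 𝓕) Function.surjective_id)

lemma exists_isFreeOn_rank (h𝓕 : IsFiniteType 𝓕) (hV : V.Nonempty) :
    ∃ W : Opens (TopCat.of V), (W : Set V).Nonempty ∧ IsFreeOn 𝓕 W (rank 𝓕) :=
  Nat.sInf_mem (s := {r | ∃ W : Opens (TopCat.of V), (W : Set V).Nonempty ∧ IsFreeOn 𝓕 W r})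
    (exists_isFreeOn h𝓕 hV)

lemma rank_eq_of_locally_free (hV : V.Nonempty) {R : ℕ}
    (h : ∀ p : V, ∃ W : Opens (TopCat.of V), p ∈ W ∧ IsFreeOn 𝓕 W R) : rank 𝓕 = R := by
  have : {r | ∃ W : Opens (TopCat.of V), (W : Set V).Nonempty ∧ IsFreeOn 𝓕 W r} = {R} := by
    ext r
    constructor
    · rintro ⟨W, ⟨p, hp⟩, hr⟩
      obtain ⟨W', hp', hR⟩ := h p
      have hne : ((W ⊓ W' : Opens (TopCat.of V)) : Set V).Nonempty := ⟨p, hp, hp'⟩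
      exact (hr.restrict inf_le_left).unique hne (hR.restrict inf_le_right)
    · rintro rfl
      obtain ⟨p, hp⟩ := hV
      obtain ⟨W, hpW, hW⟩ := h ⟨p, hp⟩
      exact ⟨W, ⟨_, hpW⟩, hW⟩
  rw [rank, this, csInf_singleton]

lemma rank_eq_zero_of_isZero (hV : V.Nonempty) (h : IsZero 𝓕) : rank 𝓕 = 0 := by
  rw [isZero_iff_forall_section_eq_zero] at h
  refine rank_eq_of_locally_free (R := 0) hV fun p =>
    ⟨⊤, TopologicalSpace.Opens.mem_top p, Fin.elim0, fun W' _ => ?_⟩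
  exact ⟨fun a b _ => Subsingleton.elim a b, fun t => ⟨Fin.elim0, (h _ _).trans (h _ t).symm⟩⟩

lemma rank_eq_of_isIso (q : 𝓔 ⟶ 𝓠) [IsIso q] : rank 𝓔 = rank 𝓠 := by
  have key : ∀ {𝓔 𝓠 : SheafOfModules.{u} (structureSheaf V)} (q : 𝓔 ⟶ 𝓠) [IsIso q]
      {W : Opens (TopCat.of V)} {r : ℕ}, IsFreeOn 𝓔 W r → IsFreeOn 𝓠 W r := by
    rintro 𝓔 𝓠 q _ W r ⟨s, hs⟩
    refine ⟨fun i => sectionMap q W (s i), fun W' h => ?_⟩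
    have hb : Function.Bijective (sectionMap q W') := by
      refine Function.bijective_iff_has_inverse.2 ⟨sectionMap (inv q) W', fun s => ?_, fun s => ?_⟩
      · exact congrArg (fun f : 𝓔 ⟶ 𝓔 => sectionMap f W' s) (IsIso.hom_inv_id q)
      · exact congrArg (fun f : 𝓠 ⟶ 𝓠 => sectionMap f W' s) (IsIso.inv_hom_id q)
    have : combination 𝓠 h (fun i => sectionMap q W (s i)) = sectionMap q W' ∘ combination 𝓔 h s :=
      funext fun c => (sectionMap_combination q h s c).symm
    rw [this]
    exact hb.comp (hs W' h)
  rw [rank, rank]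
  congr 1
  ext r
  exact ⟨fun ⟨W, hW, h⟩ => ⟨W, hW, key q h⟩, fun ⟨W, hW, h⟩ => ⟨W, hW, key (inv q) h⟩⟩

end Rank

end ZStability

namespace ZStability

/-! ### Local frames of the restricted bundle -/

section Frames

variable {X : Type u} [TopologicalSpace X] [ChartedSpace C2 X] {V : Set X}
  (F : Type*) [NormedAddCommGroup F] [NormedSpace ℂ F]
  (E : X → Type u) [TopologicalSpace (Bundle.TotalSpace F E)] [∀ x, AddCommGroup (E x)]
  [∀ x, Module ℂ (E x)] [∀ x, TopologicalSpace (E x)] [FiberBundle F E] [VectorBundle ℂ F E]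

/-- The value of a section of `E|_V` at a point. -/
noncomputable def sectionAt {W : Opens (TopCat.of V)} {x : V} (hx : x ∈ W) :
    (restrictBundle F E V).val.obj (op W) →+ E x.1 :=
  (Pi.evalAddMonoidHom (fun p : W => E p.1.1) ⟨x, hx⟩).comp (holSections F E V W).subtype

variable {F E}

lemma sectionAt_restrictSection {W W' : Opens (TopCat.of V)} (h : W' ≤ W) {x : V} (hx : x ∈ W')
    (s : (restrictBundle F E V).val.obj (op W)) :
    sectionAt F E hx (restrictSection _ h s) = sectionAt F E (h hx) s := rfl

lemma sectionAt_smul {W : Opens (TopCat.of V)} {x : V} (hx : x ∈ W)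
    (f : (structureSheaf V).obj.obj (op W)) (s : (restrictBundle F E V).val.obj (op W)) :
    sectionAt F E hx (f • s) = evalAt hx f • sectionAt F E hx s := rfl

lemma sectionAt_ext {W : Opens (TopCat.of V)} {s t : (restrictBundle F E V).val.obj (op W)}
    (h : ∀ (x : V) (hx : x ∈ W), sectionAt F E hx s = sectionAt F E hx t) : s = t :=
  Subtype.ext (funext fun x => h x.1 x.2)

lemma sectionAt_combination {W W' : Opens (TopCat.of V)} (h : W' ≤ W) {n : ℕ}
    (s : Fin n → (restrictBundle F E V).val.obj (op W))
    (c : Fin n → (structureSheaf V).obj.obj (op W')) {x : V} (hx : x ∈ W') :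
    sectionAt F E hx (combination _ h s c) =
      ∑ i, evalAt hx (c i) • sectionAt F E (h hx) (s i) := by
  rw [combination, map_sum]
  exact Finset.sum_congr rfl fun i _ => by rw [sectionAt_smul, sectionAt_restrictSection]

lemma exists_section_extension {W : Opens (TopCat.of V)}
    (s : (restrictBundle F E V).val.obj (op W)) {x : V} (hx : x ∈ W) :
    ∃ (U : Set X), IsOpen U ∧ x.1 ∈ U ∧ ∃ t : (x : X) → E x,
      MDifferentiableOn 𝓘(ℂ, C2) (𝓘(ℂ, C2).prod 𝓘(ℂ, F))
        (fun x => Bundle.TotalSpace.mk' F x (t x)) U ∧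
      ∀ (y : V) (hy : y ∈ W), y.1 ∈ U → sectionAt F E hy s = t y.1 := by
  obtain ⟨U, hU, hxU, t, ht, hst⟩ := s.2 ⟨x, hx⟩
  exact ⟨U, hU, hxU, t, ht, fun y hy hyU => hst ⟨y, hy⟩ hyU⟩

variable (F E)

/-- A local trivialization of `E` restricts to a frame of `E|_V`. -/
theorem exists_frame [IsManifold 𝓘(ℂ, C2) ω X] [FiniteDimensional ℂ F]
    [ContMDiffVectorBundle ω F E 𝓘(ℂ, C2)] (p : V) :
    ∃ W : Opens (TopCat.of V), p ∈ W ∧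
      ∃ s : Fin (Module.finrank ℂ F) → (restrictBundle F E V).val.obj (op W),
        (∀ (W' : Opens (TopCat.of V)) (h : W' ≤ W), Function.Bijective (combination _ h s)) ∧
        ∀ (x : V) (hx : x ∈ W), LinearIndependent ℂ fun i => sectionAt F E hx (s i) := by
  have : ContMDiffVectorBundle 1 F E 𝓘(ℂ, C2) := ContMDiffVectorBundle.of_le (n := ω) le_top
  let e := trivializationAt F E p.1
  let b := Module.finBasis ℂ F
  have hframe := e.isLocalFrameOn_localFrame_baseSet 𝓘(ℂ, C2) 1 b
  have hsec : ∀ i, ∃ s : (restrictBundle F E V).val.obj (op (openTrace V e.open_baseSet)),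
      ∀ (x : V) (hx : x ∈ openTrace V e.open_baseSet), sectionAt F E hx s = e.localFrame b i x.1 :=
    fun i => ⟨(⟨fun x => e.localFrame b i x.1.1, fun x => ⟨e.baseSet, e.open_baseSet, x.2,
      e.localFrame b i, (hframe.contMDiffOn i).mdifferentiableOn one_ne_zero, fun _ _ => rfl⟩⟩ :
      holSections F E V _), fun _ _ => rfl⟩
  choose s hs using hsec
  have hli : ∀ (x : V) (hx : x ∈ openTrace V e.open_baseSet),
      LinearIndependent ℂ fun i => sectionAt F E hx (s i) := fun x hx => by
    simp only [hs]
    exact hframe.linearIndependent hx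
  refine ⟨openTrace V e.open_baseSet, FiberBundle.mem_baseSet_trivializationAt F E p.1, s,
    fun W' h => ⟨?_, fun t => ?_⟩, hli⟩
  · refine (injective_iff_map_eq_zero (combinationLinear _ h s)).2 fun c hc => ?_
    ext1 i
    refine function_ext fun x hx => ?_
    have h0 := congrArg (sectionAt F E hx) hc
    rw [map_zero] at h0
    have h1 := (sectionAt_combination h s c hx).symm.trans h0
    exact (Fintype.linearIndependent_iff.1 (hli x (h hx)) _ h1 i).trans (map_zero (evalAt hx)).symm
  · classical
    have hc : ∀ i, ∃ f : (structureSheaf V).obj.obj (op W'), ∀ (y : V) (hy : y ∈ W'),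
        evalAt hy f = if h : y ∈ W' then
          e.localFrameCoeff 𝓘(ℂ, C2) b i y.1 (sectionAt F E h t) else 0 := by
      refine fun i => exists_function_of_locally _ fun x hx => ?_
      obtain ⟨U, hU, hxU, T, hT, hTt⟩ := exists_section_extension t hx
      have hcoef := mdifferentiableOn_localFrameCoeff (I := 𝓘(ℂ, C2)) (e := e)
        b (hU.inter e.open_baseSet) Set.inter_subset_right (hT.mono Set.inter_subset_left) i
      obtain ⟨g, hg⟩ := exists_function_of_mdifferentiableOn (W := W' ⊓ openTrace V hU)
        (hU.inter e.open_baseSet) hcoef fun y hy => ⟨hy.2, h hy.1⟩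
      refine ⟨W' ⊓ openTrace V hU, inf_le_left, ⟨hx, hxU⟩, g, fun y hy => ?_⟩
      rw [hg, dif_pos (show y ∈ W' from hy.1), hTt y hy.1 hy.2]
      rfl
    choose c hc using hc
    refine ⟨c, sectionAt_ext fun x hx => ?_⟩
    rw [sectionAt_combination]
    simp only [hc, dif_pos hx, hs]
    obtain ⟨U, -, hxU, T, -, hTt⟩ := exists_section_extension t hx
    rw [hTt x hx hxU]
    exact (hframe.coeff_sum_eq T (h hx)).symm

end Frames

end ZStability

namespace ZStability

/-! ### Quotients of the restricted bundle -/

section Quotients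

open CategoryTheory.Limits

variable {X : Type u} [TopologicalSpace X] [ChartedSpace C2 X] {V : Set X}

/-- Finitely many functions on an open set extend simultaneously to a neighbourhood in the
surface. -/
lemma exists_extension_finite {ι : Type*} [Finite ι] {W : Opens (TopCat.of V)}
    (f : ι → (structureSheaf V).obj.obj (op W)) {x : V} (hx : x ∈ W) :
    ∃ (U : Set X) (hU : IsOpen U), x.1 ∈ U ∧ openTrace V hU ≤ W ∧ ∃ g : ι → X → ℂ,
      (∀ i, MDifferentiableOn 𝓘(ℂ, C2) 𝓘(ℂ, ℂ) (g i) U) ∧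
      ∀ i (y : V) (hy : y ∈ W), y.1 ∈ U → evalAt hy (f i) = g i y.1 := by
  choose U hU hxU g hg hfg using fun i => exists_extension (f i) hx
  obtain ⟨U₀, hU₀, hxU₀, hle⟩ := exists_openTrace_le hx
  have hUo : IsOpen (U₀ ∩ ⋂ i, U i) := hU₀.inter (isOpen_iInter_of_finite hU)
  exact ⟨U₀ ∩ ⋂ i, U i, hUo, ⟨hxU₀, Set.mem_iInter.2 hxU⟩, fun y hy => hle hy.1, g,
    fun i => (hg i).mono fun y hy => Set.mem_iInter.1 hy.2 i,
    fun i y hy hyU => hfg i y hy (Set.mem_iInter.1 hyU.2 i)⟩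

/-- A subset of an analytic set which is locally cut out by holomorphic functions is analytic. -/
lemma isAnalyticSubset_of_locally (hV : IsAnalyticSubset V) {A : Set X} (hAV : A ⊆ V)
    (h : ∀ p ∈ V, ∃ U : Set X, IsOpen U ∧ p ∈ U ∧ ∃ (ι : Type) (_ : Finite ι) (g : ι → X → ℂ),
      (∀ i, MDifferentiableOn 𝓘(ℂ, C2) 𝓘(ℂ, ℂ) (g i) U) ∧
      ∀ y ∈ U, y ∈ V → (y ∈ A ↔ ∀ i, g i y = 0)) : IsAnalyticSubset A := by
  refine ⟨?_, fun p hp => ?_⟩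
  · rw [← isOpen_compl_iff, isOpen_iff_mem_nhds]
    intro p hpA
    by_cases hpV : p ∈ V
    · obtain ⟨U, hU, hpU, ι, _, g, hg, hA⟩ := h p hpV
      obtain ⟨i, hi⟩ : ∃ i, g i p ≠ 0 := by
        by_contra! hcon
        exact hpA ((hA p hpU hpV).2 hcon)
      have hO : IsOpen (U ∩ g i ⁻¹' {0}ᶜ) :=
        (hg i).continuousOn.isOpen_inter_preimage hU isOpen_compl_singleton
      filter_upwards [hO.mem_nhds ⟨hpU, hi⟩] with y hy hyA
      exact hy.2 ((hA y hy.1 (hAV hyA)).1 hyA i)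
    · filter_upwards [hV.1.isOpen_compl.mem_nhds hpV] with y hy hyA
      exact hy (hAV hyA)
  · obtain ⟨U, hU, hpU, ι, _, g, hg, hA⟩ := h p (hAV hp)
    obtain ⟨U', hU', hpU', n, f, hf, hVf⟩ := hV.2 p (hAV hp)
    obtain ⟨m, ⟨e⟩⟩ := Finite.exists_equiv_fin ι
    refine ⟨U ∩ U', hU.inter hU', ⟨hpU, hpU'⟩, n + m, Fin.append f fun j => g (e.symm j),
      fun i => ?_, ?_⟩
    · refine Fin.addCases (fun j => ?_) (fun j => ?_) i
      · rw [Fin.append_left]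
        exact (hf j).mono Set.inter_subset_right
      · rw [Fin.append_right]
        exact (hg _).mono Set.inter_subset_left
    · ext y
      have hyV : y ∈ U' → (y ∈ V ↔ ∀ i, f i y = 0) := fun hy => by
        have : y ∈ V ∩ U' ↔ y ∈ {x ∈ U' | ∀ i, f i x = 0} := by rw [hVf]
        simpa [hy] using this
      constructor
      · rintro ⟨hyA, hyU, hyU'⟩
        refine ⟨⟨hyU, hyU'⟩, fun i => Fin.addCases (fun j => ?_) (fun j => ?_) i⟩
        · rw [Fin.append_left]
          exact (hyV hyU').1 (hAV hyA) j
        · rw [Fin.append_right]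
          exact (hA y hyU (hAV hyA)).1 hyA _
      · rintro ⟨⟨hyU, hyU'⟩, h0⟩
        refine ⟨?_, hyU, hyU'⟩
        have h1 : y ∈ V := (hyV hyU').2 fun j => by
          have := h0 (Fin.castAdd m j)
          rwa [Fin.append_left] at this
        refine (hA y hyU h1).2 fun i => ?_
        have := h0 (Fin.natAdd n (e i))
        rwa [Fin.append_right, e.symm_apply_apply] at this

variable {F : Type*} [NormedAddCommGroup F] [NormedSpace ℂ F]
  {E : X → Type u} [TopologicalSpace (Bundle.TotalSpace F E)] [∀ x, AddCommGroup (E x)]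
  [∀ x, Module ℂ (E x)] [∀ x, TopologicalSpace (E x)] [FiberBundle F E] [VectorBundle ℂ F E]
  {𝓠 : SheafOfModules.{u} (structureSheaf V)}

/-- A presentation over `W` of a quotient of `E|_V`: a frame `s` of `E|_V` and generators `r` of the
relations between the images of the frame. -/
structure IsPresentation (q : restrictBundle F E V ⟶ 𝓠) {W : Opens (TopCat.of V)} {R m : ℕ}
    (s : Fin R → (restrictBundle F E V).val.obj (op W))
    (r : Fin m → Fin R → (structureSheaf V).obj.obj (op W)) : Prop where
  bijective : ∀ (W' : Opens (TopCat.of V)) (h : W' ≤ W),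
    Function.Bijective (combination (restrictBundle F E V) h s)
  linearIndependent : ∀ (x : V) (hx : x ∈ W), LinearIndependent ℂ fun i => sectionAt F E hx (s i)
  generates : Generates 𝓠 fun i => sectionMap q W (s i)
  relation : ∀ j, combination 𝓠 le_rfl (fun i => sectionMap q W (s i)) (r j) = 0
  exists_eq_sum : ∀ (W₁ : Opens (TopCat.of V)) (h₁ : W₁ ≤ W)
    (c : Fin R → (structureSheaf V).obj.obj (op W₁)),
    combination 𝓠 h₁ (fun i => sectionMap q W (s i)) c = 0 → ∀ x ∈ W₁,
    ∃ (W₂ : Opens (TopCat.of V)) (h₂ : W₂ ≤ W₁), x ∈ W₂ ∧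
      ∃ d : Fin m → (structureSheaf V).obj.obj (op W₂),
        ∀ i, restrictFunction h₂ (c i) = ∑ j, d j * restrictFunction (h₂.trans h₁) (r j i)

/-- A frame of the restricted bundle generates the quotient; its relations are generated by finitely
many, by coherence. -/
theorem exists_isPresentation [IsManifold 𝓘(ℂ, C2) ω X] [FiniteDimensional ℂ F]
    [ContMDiffVectorBundle ω F E 𝓘(ℂ, C2)] (q : restrictBundle F E V ⟶ 𝓠) [Epi q]
    (h𝓠 : IsCoherent 𝓠) (p : V) : ∃ W : Opens (TopCat.of V), p ∈ W ∧
      ∃ (s : Fin (Module.finrank ℂ F) → (restrictBundle F E V).val.obj (op W)) (m : ℕ)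
        (r : Fin m → Fin (Module.finrank ℂ F) → (structureSheaf V).obj.obj (op W)),
        IsPresentation q s r := by
  obtain ⟨W, hp, s, hs, hli⟩ := exists_frame F E p
  obtain ⟨W₀, h₀, hp₀, m, r, hr, hgen⟩ := h𝓠.2 W _ (fun i => sectionMap q W (s i)) p hp
  have hcomb : ∀ (W' : Opens (TopCat.of V)) (h : W' ≤ W₀)
      (c : Fin (Module.finrank ℂ F) → (structureSheaf V).obj.obj (op W')),
      combination 𝓠 h (fun i => sectionMap q W₀ (restrictSection _ h₀ (s i))) c =
        combination 𝓠 (h.trans h₀) (fun i => sectionMap q W (s i)) c := fun W' h c => by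
    have h1 : (fun i => sectionMap q W₀ (restrictSection _ h₀ (s i))) =
        fun i => restrictSection 𝓠 h₀ (sectionMap q W (s i)) :=
      funext fun i => sectionMap_restrictSection q h₀ (s i)
    rw [h1]
    exact combination_restrictSection 𝓠 h₀ h _ c
  have hcombE : ∀ (W' : Opens (TopCat.of V)) (h : W' ≤ W₀),
      combination (restrictBundle F E V) h (fun i => restrictSection _ h₀ (s i)) =
        combination _ (h.trans h₀) s := fun W' h =>
    funext fun c => combination_restrictSection _ h₀ h s c
  refine ⟨W₀, hp₀, fun i => restrictSection _ h₀ (s i), m, r, ?_, ?_, ?_, ?_, ?_⟩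
  · intro W' h
    rw [hcombE]
    exact hs W' _
  · intro x hx
    exact hli x (h₀ hx)
  · intro W₁ h₁ t x hx
    obtain ⟨W₂, h₂, hx₂, u, hu⟩ := exists_sectionMap_eq_of_epi q t hx
    obtain ⟨c, rfl⟩ := (hs W₂ (h₂.trans (h₁.trans h₀))).2 u
    refine ⟨W₂, h₂, hx₂, c, ?_⟩
    rw [hcomb, ← hu, sectionMap_combination]
  · intro j
    rw [hcomb]
    exact hr j
  · intro W₁ h₁ c hc x hx
    rw [hcomb] at hc
    exact hgen W₁ h₁ c hc x hx

lemma rank_restrictBundle [IsManifold 𝓘(ℂ, C2) ω X] [FiniteDimensional ℂ F]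
    [ContMDiffVectorBundle ω F E 𝓘(ℂ, C2)] (hV : V.Nonempty) :
    rank (restrictBundle F E V) = Module.finrank ℂ F :=
  rank_eq_of_locally_free hV fun p => by
    obtain ⟨W, hp, s, hs, -⟩ := exists_frame F E p
    exact ⟨W, hp, s, hs⟩

lemma exists_isFreeOn_restrictBundle [IsManifold 𝓘(ℂ, C2) ω X] [FiniteDimensional ℂ F]
    [ContMDiffVectorBundle ω F E 𝓘(ℂ, C2)] (p : V) :
    ∃ W : Opens (TopCat.of V), p ∈ W ∧
      IsFreeOn (restrictBundle F E V) W (Module.finrank ℂ F) := by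
  obtain ⟨W, hp, s, hs, -⟩ := exists_frame F E p
  exact ⟨W, hp, s, hs⟩

/-- Where the quotient is free, the quotient map is surjective on sections over small open sets. -/
lemma exists_surjective_of_isFreeOn {𝓔 : SheafOfModules.{u} (structureSheaf V)} (q : 𝓔 ⟶ 𝓠)
    [Epi q] {W : Opens (TopCat.of V)} {r : ℕ} (h : IsFreeOn 𝓠 W r) {p : V} (hp : p ∈ W) :
    ∃ W' ≤ W, p ∈ W' ∧ ∀ W'' ≤ W', Function.Surjective (sectionMap q W'') := by
  obtain ⟨t, ht⟩ := h
  choose N hN hpN u hu using fun i => exists_sectionMap_eq_of_epi q (t i) hp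
  let W' : Opens (TopCat.of V) := ⟨W ∩ ⋂ i, (N i : Set V),
    W.isOpen.inter (isOpen_iInter_of_finite fun i => (N i).isOpen)⟩
  have hW' : ∀ i, W' ≤ N i := fun i y hy => Set.mem_iInter.1 hy.2 i
  refine ⟨W', fun y hy => hy.1, ⟨hp, Set.mem_iInter.2 hpN⟩, fun W'' h'' v => ?_⟩
  obtain ⟨c, rfl⟩ := (ht W'' (h''.trans fun y hy => hy.1)).2 v
  refine ⟨∑ i, c i • restrictSection 𝓔 (h''.trans (hW' i)) (u i), ?_⟩
  rw [map_sum, combination]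
  refine Finset.sum_congr rfl fun i _ => ?_
  rw [map_smul, sectionMap_restrictSection, hu, restrictSection_restrictSection]

/-- On a nonempty open set, a quotient is free of its rank and the quotient map is surjective on
sections. -/
lemma exists_isFreeOn_of_epi [IsManifold 𝓘(ℂ, C2) ω X] [FiniteDimensional ℂ F]
    [ContMDiffVectorBundle ω F E 𝓘(ℂ, C2)] (hV : V.Nonempty) (q : restrictBundle F E V ⟶ 𝓠) [Epi q]
    (h𝓠 : IsCoherent 𝓠) : ∃ W : Opens (TopCat.of V), (W : Set V).Nonempty ∧
      IsFreeOn (restrictBundle F E V) W (Module.finrank ℂ F) ∧ IsFreeOn 𝓠 W (rank 𝓠) ∧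
      ∀ W' ≤ W, Function.Surjective (sectionMap q W') := by
  obtain ⟨W₀, ⟨p, hp⟩, hfree⟩ := exists_isFreeOn_rank h𝓠.1 hV
  obtain ⟨W₁, h₁, hp₁, hsurj⟩ := exists_surjective_of_isFreeOn q hfree hp
  obtain ⟨W₂, hp₂, hfree₂⟩ := exists_isFreeOn_restrictBundle (F := F) (E := E) p
  exact ⟨W₁ ⊓ W₂, ⟨p, hp₁, hp₂⟩, hfree₂.restrict inf_le_right,
    hfree.restrict (inf_le_left.trans h₁), fun W' h => hsurj W' (h.trans inf_le_left)⟩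

lemma rank_le_of_epi [IsManifold 𝓘(ℂ, C2) ω X] [FiniteDimensional ℂ F]
    [ContMDiffVectorBundle ω F E 𝓘(ℂ, C2)] (hV : V.Nonempty) (q : restrictBundle F E V ⟶ 𝓠) [Epi q]
    (h𝓠 : IsCoherent 𝓠) : rank 𝓠 ≤ rank (restrictBundle F E V) := by
  obtain ⟨W, hW, h1, h2, h3⟩ := exists_isFreeOn_of_epi hV q h𝓠
  rw [rank_restrictBundle hV]
  exact h1.le_of_surjective hW h2 (h3 W le_rfl)

/-- A quotient of `E|_V` of full rank is `E|_V`: the common zeros of the sections of the kernel form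
an analytic subset with interior, hence the whole curve. -/
theorem eq_zero_of_rank_eq [IsManifold 𝓘(ℂ, C2) ω X] [FiniteDimensional ℂ F]
    [ContMDiffVectorBundle ω F E 𝓘(ℂ, C2)] (hV : IsCurve V) (q : restrictBundle F E V ⟶ 𝓠) [Epi q]
    (h𝓠 : IsCoherent 𝓠) (hr : rank 𝓠 = rank (restrictBundle F E V)) (W : Opens (TopCat.of V))
    (s : (restrictBundle F E V).val.obj (op W)) (hs : sectionMap q W s = 0) : s = 0 := by
  have hne := hV.1.2.1
  let A : Set X := {x | ∃ hx : x ∈ V, ∀ (W : Opens (TopCat.of V)) (hW : (⟨x, hx⟩ : V) ∈ W)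
    (s : (restrictBundle F E V).val.obj (op W)), sectionMap q W s = 0 → sectionAt F E hW s = 0}
  have hAV : A ⊆ V := fun x hx => hx.1
  have hA : IsAnalyticSubset A := by
    refine isAnalyticSubset_of_locally hV.1.1 hAV fun p hp => ?_
    obtain ⟨W, hpW, s, m, r, hP⟩ := exists_isPresentation q h𝓠 ⟨p, hp⟩
    obtain ⟨U, hU, hpU, hUW, g, hg, hgr⟩ :=
      exists_extension_finite (fun x : Fin m × Fin (Module.finrank ℂ F) => r x.1 x.2) hpW
    refine ⟨U, hU, hpU, Fin m × Fin (Module.finrank ℂ F), inferInstance, g, hg, fun y hyU hyV => ?_⟩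
    have hyW : (⟨y, hyV⟩ : V) ∈ W := hUW hyU
    constructor
    · rintro ⟨_, hy⟩ ⟨j, i⟩
      have h1 := hy W hyW (combination _ le_rfl s (r j)) (by
        rw [sectionMap_combination]; exact hP.relation j)
      rw [sectionAt_combination] at h1
      rw [← hgr (j, i) ⟨y, hyV⟩ hyW hyU]
      exact Fintype.linearIndependent_iff.1 (hP.linearIndependent _ hyW) _ h1 i
    · refine fun h0 => ⟨hyV, fun W' hW' s' hs' => ?_⟩
      obtain ⟨c, hc⟩ := (hP.bijective (W' ⊓ W) inf_le_right).2
        (restrictSection _ (inf_le_left : W' ⊓ W ≤ W') s')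
      have h1 : combination 𝓠 inf_le_right (fun i => sectionMap q W (s i)) c = 0 := by
        rw [← sectionMap_combination, hc, sectionMap_restrictSection, hs', restrictSection_zero]
      obtain ⟨W₂, h₂, hy₂, d, hd⟩ := hP.exists_eq_sum _ _ c h1 ⟨y, hyV⟩ ⟨hW', hyW⟩
      have h2 := congrArg (sectionAt F E (show (⟨y, hyV⟩ : V) ∈ W' ⊓ W from ⟨hW', hyW⟩)) hc
      rw [sectionAt_combination, sectionAt_restrictSection] at h2
      rw [← h2]
      refine Finset.sum_eq_zero fun i _ => ?_
      have h3 := congrArg (evalAt hy₂) (hd i)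
      rw [evalAt_restrictFunction, map_sum] at h3
      have h4 : ∀ j, evalAt hy₂ (d j * restrictFunction (h₂.trans inf_le_right) (r j i)) = 0 :=
        fun j => by
          rw [map_mul, evalAt_restrictFunction, hgr (j, i) ⟨y, hyV⟩ hyW hyU, h0, mul_zero]
      have h5 := h3.trans (Finset.sum_eq_zero fun j _ => h4 j)
      rw [h5, zero_smul]
  obtain ⟨W₀, ⟨p, hp⟩, hfE, hfQ, hsurj⟩ := exists_isFreeOn_of_epi hne q h𝓠
  rw [hr, rank_restrictBundle hne] at hfQ
  have hinj : ∀ W' ≤ W₀, Function.Injective (sectionMap q W') := fun W' h =>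
    (hfE.restrict h).injective_of_surjective (hfQ.restrict h) (hsurj W' h)
  obtain ⟨U, hU, hpU, hle⟩ := exists_openTrace_le hp
  have hAeq : A = V := by
    refine PlaneCurve.eq_of_isAnalyticSubset_of_interior hV hA hAV hU ⟨p.1, p.2, hpU⟩ ?_
    rintro y ⟨hyV, hyU⟩
    refine ⟨hyV, fun W' hW' s' hs' => ?_⟩
    have h1 : restrictSection _ (inf_le_left : W' ⊓ W₀ ≤ W') s' = 0 := by
      refine (injective_iff_map_eq_zero _).1 (hinj _ inf_le_right) _ ?_
      rw [sectionMap_restrictSection, hs', restrictSection_zero]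
    have h2 := congrArg (sectionAt F E (show (⟨y, hyV⟩ : V) ∈ W' ⊓ W₀ from ⟨hW', hle hyU⟩)) h1
    rwa [sectionAt_restrictSection, map_zero] at h2
  refine sectionAt_ext fun x hx => ?_
  have hxA : x.1 ∈ A := by rw [hAeq]; exact x.2
  rw [map_zero]
  exact hxA.2 W hx s hs

end Quotients

end ZStability

namespace ZStability

/-! ### Cohomology of flasque sheaves of modules -/

section Cohomology

open CategoryTheory.Limits

/-- The first cohomology of a flasque sheaf vanishes: sections of a quotient by a flasque sheaf lift
globally, so the connecting map out of an injective resolution is zero. -/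
theorem subsingleton_H_one_of_isFlasque {T : TopCat.{u}}
    (𝓕 : Sheaf (Opens.grothendieckTopology T) AddCommGrpCat.{u})
    (h𝓕 : TopCat.Sheaf.IsFlasque (X := T) 𝓕) : Subsingleton (Sheaf.H 𝓕 1) := by
  have hT : IsTerminal (⊤ : Opens T) := isTerminalTop
  let S : ShortComplex (Sheaf (Opens.grothendieckTopology T) AddCommGrpCat.{u}) :=
    ShortComplex.mk (Injective.ι 𝓕) (cokernel.π (Injective.ι 𝓕)) (cokernel.condition _)
  have hS : S.ShortExact :=
    { exact := ShortComplex.exact_cokernel _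
      mono_f := inferInstanceAs (Mono (Injective.ι 𝓕))
      epi_g := inferInstanceAs (Epi (cokernel.π (Injective.ι 𝓕))) }
  refine subsingleton_of_forall_eq 0 fun x => ?_
  have : Injective S.X₂ := inferInstanceAs (Injective (Injective.under 𝓕))
  have h0 : x.comp (Abelian.Ext.mk₀ S.f) (add_zero 1) = 0 :=
    Abelian.Ext.eq_zero_of_injective _
  obtain ⟨y, hy⟩ := Abelian.Ext.covariant_sequence_exact₁ _ hS x h0 (zero_add 1)
  have : Epi (S.g.1.app (op (⊤ : Opens T))) :=
    TopCat.Sheaf.IsFlasque.epi_of_shortExact (X := T) (S := S) hS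
  obtain ⟨t, ht⟩ := (AddCommGrpCat.epi_iff_surjective _).1 this (Sheaf.H.equiv₀ _ hT y)
  have h1 : y = Sheaf.H.map S.g 0 ((Sheaf.H.equiv₀ _ hT).symm t) := by
    rw [Sheaf.H.equiv₀_symm_naturality]
    exact ((AddEquiv.symm_apply_eq _).2 ht).symm
  rw [← hy, h1, Sheaf.H.map_apply, Abelian.Ext.comp_assoc_of_second_deg_zero,
    hS.comp_extClass, Abelian.Ext.comp_zero]

variable {X : Type u} [TopologicalSpace X] [ChartedSpace C2 X] {V : Set X}

/-- A sheaf whose sections extend from open subsets is acyclic. -/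
lemma hdim_one_eq_zero_of_isFlasque (𝓕 : SheafOfModules.{u} (structureSheaf V))
    (h : ∀ (W₁ W₂ : Opens (TopCat.of V)) (h : W₁ ≤ W₂) (t : 𝓕.val.obj (op W₁)),
      ∃ t' : 𝓕.val.obj (op W₂), restrictSection 𝓕 h t' = t) : hdim 𝓕 1 = 0 := by
  have h1 : TopCat.Sheaf.IsFlasque (X := TopCat.of V) ((SheafOfModules.toSheaf _).obj 𝓕) :=
    { epi := fun {U W} i => by
        rw [AddCommGrpCat.epi_iff_surjective]
        exact h W.unop U.unop i.unop.le }
  have : Subsingleton (Cohomology 𝓕 1) := subsingleton_H_one_of_isFlasque _ h1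
  let := cohomologyModule 𝓕 1
  exact Module.finrank_zero_of_subsingleton

/-- The homomorphism from the complex numbers to the functions over `W`. -/
noncomputable def constHom (V : Set X) (W : Opens (TopCat.of V)) :
    ℂ →+* (structureSheaf V).obj.obj (op W) where
  toFun c := constFunction V c (op W)
  map_one' := rfl
  map_mul' _ _ := rfl
  map_zero' := rfl
  map_add' _ _ := rfl

lemma evalAt_constHom {W : Opens (TopCat.of V)} {x : V} (hx : x ∈ W) (c : ℂ) :
    evalAt hx (constHom V W c) = c := rfl

/-- `h⁰` is the dimension of the space of global sections. -/
lemma hdim_zero_eq (𝓕 : SheafOfModules.{u} (structureSheaf V)) :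
    hdim 𝓕 0 = @Module.finrank ℂ (𝓕.val.obj (op ⊤)) _ _
      (Module.compHom (𝓕.val.obj (op ⊤)) (constHom V ⊤)) := by
  let := cohomologyModule 𝓕 0
  let : Module ℂ (𝓕.val.obj (op (⊤ : Opens (TopCat.of V)))) :=
    Module.compHom (𝓕.val.obj (op ⊤)) (constHom V ⊤)
  have hT : IsTerminal (⊤ : Opens (TopCat.of V)) := isTerminalTop
  let e : Cohomology 𝓕 0 ≃+ 𝓕.val.obj (op (⊤ : Opens (TopCat.of V))) :=
    Sheaf.H.equiv₀ ((SheafOfModules.toSheaf _).obj 𝓕) hT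
  let e' : Cohomology 𝓕 0 ≃ₗ[ℂ] 𝓕.val.obj (op (⊤ : Opens (TopCat.of V))) :=
    { e with map_smul' := fun c x => (Sheaf.H.equiv₀_naturality hT (scalarEnd 𝓕 c) x).symm }
  exact e'.finrank_eq

end Cohomology

end ZStability

namespace ZStability

/-! ### The support of a quotient of rank zero -/

section Support

open CategoryTheory.Limits

/-- If a matrix annihilates a vector of module elements, so does its determinant. -/
lemma det_smul_eq_zero {A N : Type*} [CommRing A] [AddCommGroup N] [Module A N] {n : ℕ}
    (M : Matrix (Fin n) (Fin n) A) (t : Fin n → N) (h : ∀ a, ∑ b, M a b • t b = 0) (b : Fin n) :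
    M.det • t b = 0 := by
  have h1 : ∑ c, (M.adjugate * M) b c • t c = M.det • t b := by
    rw [Matrix.adjugate_mul, Finset.sum_eq_single b]
    · simp
    · intro c _ hc
      simp [Matrix.one_apply_ne' hc]
    · simp
  rw [← h1]
  simp only [Matrix.mul_apply, Finset.sum_smul, mul_smul]
  rw [Finset.sum_comm]
  refine Finset.sum_eq_zero fun a _ => ?_
  rw [← Finset.smul_sum, h, smul_zero]

/-- A matrix with a left inverse has a nonzero maximal minor. -/
lemma exists_det_ne_zero {m n : ℕ} {D : Matrix (Fin n) (Fin m) ℂ} {M : Matrix (Fin m) (Fin n) ℂ}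
    (h : D * M = 1) : ∃ I : Fin n → Fin m, (Matrix.of fun a b => M (I a) b).det ≠ 0 := by
  by_contra! hcon
  have h1 : (D * M).det = 1 := by rw [h, Matrix.det_one]
  have h2 : (D * M).det = Matrix.detRowAlternating (R := ℂ) fun a => ∑ j, D a j • M j := by
    congr 1
    ext a b
    simp [Matrix.mul_apply]
  have h3 := (Matrix.detRowAlternating (R := ℂ) (n := Fin n)).toMultilinearMap.map_sum
    fun a j => D a j • M j
  have h4 : ∀ I : Fin n → Fin m, (Matrix.detRowAlternating (R := ℂ) (n := Fin n)).toMultilinearMap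
      (fun a => D a (I a) • M (I a)) = 0 := fun I => by
    rw [MultilinearMap.map_smul_univ]
    have : (Matrix.detRowAlternating (R := ℂ) (n := Fin n)).toMultilinearMap
        (fun a => M (I a)) = 0 :=
      hcon I
    rw [this, smul_zero]
  have h5 : (D * M).det = 0 := by
    rw [h2]
    refine h3.trans (Finset.sum_eq_zero fun I _ => h4 I)
  exact one_ne_zero (h1.symm.trans h5)

variable {X : Type u} [TopologicalSpace X] [ChartedSpace C2 X] {V : Set X}
  {𝓠 : SheafOfModules.{u} (structureSheaf V)}

/-- The determinant of the relations with indices `I`. -/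
noncomputable def relationMinor {W : Opens (TopCat.of V)} {R m : ℕ}
    (r : Fin m → Fin R → (structureSheaf V).obj.obj (op W)) (I : Fin R → Fin m) :
    (structureSheaf V).obj.obj (op W) :=
  Matrix.det (R := holFunctions V W) (Matrix.of fun a b => r (I a) b)

lemma evalAt_relationMinor {W : Opens (TopCat.of V)} {R m : ℕ}
    (r : Fin m → Fin R → (structureSheaf V).obj.obj (op W)) (I : Fin R → Fin m) {x : V}
    (hx : x ∈ W) : evalAt hx (relationMinor r I) =
      (Matrix.of fun a b => evalAt hx (r (I a) b)).det := by
  let φ : holFunctions V W →+* ℂ := evalAt hx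
  exact RingHom.map_det φ _

variable (𝓠) in
/-- The support of a sheaf of modules: the points without a neighbourhood over which all sections
vanish. -/
def support : Set V :=
  {x | ¬ ∃ W : Opens (TopCat.of V), x ∈ W ∧ ∀ W' ≤ W, ∀ t : 𝓠.val.obj (op W'), t = 0}

lemma section_eq_zero_of_support {W : Opens (TopCat.of V)} (hW : ∀ x ∈ W, x ∉ support 𝓠)
    (t : 𝓠.val.obj (op W)) : t = 0 :=
  section_eq_zero 𝓠 fun p hp => by
    obtain ⟨W', hpW', h⟩ := not_not.1 (hW p hp)
    exact ⟨W' ⊓ W, inf_le_right, ⟨hpW', hp⟩, h _ inf_le_left _⟩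

/-- Extension by zero: if the support is finite, sections extend from open subsets, without
acquiring new points of support. -/
lemma exists_extension_by_zero [T2Space X] (h : (support 𝓠).Finite) {W₁ W₂ : Opens (TopCat.of V)}
    (hW : W₁ ≤ W₂) (t : 𝓠.val.obj (op W₁)) : ∃ t' : 𝓠.val.obj (op W₂),
      restrictSection 𝓠 hW t' = t ∧ ∀ (W₃ : Opens (TopCat.of V)) (h₃ : W₃ ≤ W₂),
        (∀ x ∈ W₃, x ∈ support 𝓠 → x ∉ W₁) → restrictSection 𝓠 h₃ t' = 0 := by
  let C : Opens (TopCat.of V) := ⟨(W₂ : Set V) \ (support 𝓠 ∩ W₁),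
    W₂.isOpen.sdiff (h.subset Set.inter_subset_left).isClosed⟩
  have hC : C ≤ W₂ := fun x hx => hx.1
  have h0 : ∀ s : 𝓠.val.obj (op (W₁ ⊓ C)), s = 0 :=
    section_eq_zero_of_support fun x hx hxs => hx.2.2 ⟨hxs, hx.1⟩
  obtain ⟨t', ht', ht'0⟩ := exists_glue 𝓠 t (0 : 𝓠.val.obj (op C)) ((h0 _).trans (h0 _).symm) hW hC
    fun x hx => by
      by_cases hx1 : x ∈ W₁
      · exact Or.inl hx1
      · exact Or.inr ⟨hx, fun h => hx1 h.2⟩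
  refine ⟨t', ht', fun W₃ h₃ h₃' => ?_⟩
  have h₃C : W₃ ≤ C := fun x hx => ⟨h₃ hx, fun hx' => h₃' x hx hx'.1 hx'.2⟩
  rw [← restrictSection_restrictSection 𝓠 hC h₃C, ht'0, restrictSection_zero]

lemma support_image_ne (hV : V.Nonempty) (h𝓠 : IsCoherent 𝓠) (hr : rank 𝓠 = 0) :
    Subtype.val '' support 𝓠 ≠ V := by
  obtain ⟨W, ⟨p, hp⟩, t, ht⟩ := exists_isFreeOn_rank h𝓠.1 hV
  have : IsEmpty (Fin (rank 𝓠)) := by rw [hr]; infer_instance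
  intro h
  obtain ⟨x, hx, hxp⟩ : p.1 ∈ Subtype.val '' support 𝓠 := by rw [h]; exact p.2
  rw [Subtype.ext hxp] at hx
  refine hx ⟨W, hp, fun W' h' t' => ?_⟩
  obtain ⟨c, rfl⟩ := (ht W' h').2 t'
  exact Fintype.sum_empty _

variable {F : Type*} [NormedAddCommGroup F] [NormedSpace ℂ F]
  {E : X → Type u} [TopologicalSpace (Bundle.TotalSpace F E)] [∀ x, AddCommGroup (E x)]
  [∀ x, Module ℂ (E x)] [∀ x, TopologicalSpace (E x)] [FiberBundle F E] [VectorBundle ℂ F E]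

section Presentation

variable {q : restrictBundle F E V ⟶ 𝓠} {W : Opens (TopCat.of V)} {R m : ℕ}
  {s : Fin R → (restrictBundle F E V).val.obj (op W)}
  {r : Fin m → Fin R → (structureSheaf V).obj.obj (op W)}

/-- By Cramer's rule the maximal minors of the relation matrix annihilate the quotient. -/
lemma IsPresentation.relationMinor_smul (h : IsPresentation q s r) (I : Fin R → Fin m)
    (b : Fin R) : relationMinor r I • sectionMap q W (s b) = 0 := by
  let : Module (holFunctions V W) (𝓠.val.obj (op W)) :=
    inferInstanceAs (Module ((structureSheaf V).obj.obj (op W)) (𝓠.val.obj (op W)))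
  refine det_smul_eq_zero (A := holFunctions V W) _ (fun b => sectionMap q W (s b)) (fun a => ?_) b
  have := h.relation (I a)
  simp only [combination, restrictSection_self] at this
  exact this

/-- The support of a quotient is the common zero set of the maximal minors of its relations. -/
lemma IsPresentation.mem_support_iff (h : IsPresentation q s r) {y : V} (hy : y ∈ W) :
    y ∈ support 𝓠 ↔ ∀ I : Fin R → Fin m, evalAt hy (relationMinor r I) = 0 := by
  constructor
  · intro hys I
    by_contra hI
    obtain ⟨W₁, h₁, hy₁, g, hg⟩ := exists_mul_eq_one (relationMinor r I) hy hI
    have h0 : ∀ b, restrictSection 𝓠 h₁ (sectionMap q W (s b)) = 0 := fun b => by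
      have e : restrictFunction h₁ (relationMinor r I) •
          restrictSection 𝓠 h₁ (sectionMap q W (s b)) = 0 :=
        (restrictSection_smul 𝓠 h₁ _ _).symm.trans
          ((congrArg _ (h.relationMinor_smul I b)).trans (restrictSection_zero 𝓠 h₁))
      have e1 := congrArg (fun t => g • t) e
      have e2 := mul_smul g (restrictFunction h₁ (relationMinor r I))
        (restrictSection 𝓠 h₁ (sectionMap q W (s b)))
      rw [hg] at e2
      exact (one_smul _ _).symm.trans (e2.trans (e1.trans (smul_zero g)))
    refine hys ⟨W₁, hy₁, fun W' h' t => section_eq_zero 𝓠 fun p hp => ?_⟩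
    obtain ⟨W₂, h₂, hp₂, c, hc⟩ := h.generates W' (h'.trans h₁) t p hp
    refine ⟨W₂, h₂, hp₂, hc.trans (Finset.sum_eq_zero fun b _ => ?_)⟩
    rw [← restrictSection_restrictSection 𝓠 h₁ (h₂.trans h'), h0, restrictSection_zero]
    exact smul_zero (c b)
  · rintro hI ⟨W₁, hy₁, h0⟩
    choose W₂ h₂ hy₂ d hd using fun b : Fin R =>
      h.exists_eq_sum (W₁ ⊓ W) inf_le_right (Pi.single b 1) (h0 _ inf_le_left _) y ⟨hy₁, hy⟩
    obtain ⟨I, hne⟩ := exists_det_ne_zero (D := Matrix.of fun b j => evalAt (hy₂ b) (d b j))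
      (M := Matrix.of fun j b => evalAt hy (r j b)) (by
        ext b i
        have e := congrArg (evalAt (hy₂ b)) (hd b i)
        rw [evalAt_restrictFunction, map_sum] at e
        have e1 : evalAt (⟨hy₁, hy⟩ : y ∈ W₁ ⊓ W)
            ((Pi.single b 1 : Fin R → (structureSheaf V).obj.obj (op (W₁ ⊓ W))) i) =
            (1 : Matrix (Fin R) (Fin R) ℂ) b i := by
          by_cases hbi : b = i
          · subst hbi
            rw [Pi.single_eq_same, map_one, Matrix.one_apply_eq]
          · rw [Pi.single_eq_of_ne (Ne.symm hbi), map_zero, Matrix.one_apply_ne hbi]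
        rw [Matrix.mul_apply, ← e1]
        refine Eq.trans (Finset.sum_congr rfl fun j _ => ?_) e.symm
        rw [map_mul, evalAt_restrictFunction]
        rfl)
    exact hne ((evalAt_relationMinor r I hy).symm.trans (hI I))

end Presentation

variable [IsManifold 𝓘(ℂ, C2) ω X] [FiniteDimensional ℂ F] [ContMDiffVectorBundle ω F E 𝓘(ℂ, C2)]

lemma isAnalyticSubset_support (hV : IsAnalyticSubset V) (q : restrictBundle F E V ⟶ 𝓠) [Epi q]
    (h𝓠 : IsCoherent 𝓠) : IsAnalyticSubset (Subtype.val '' support 𝓠) := by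
  refine isAnalyticSubset_of_locally hV (by rintro _ ⟨x, -, rfl⟩; exact x.2) fun p hp => ?_
  obtain ⟨W, hpW, s, m, r, hP⟩ := exists_isPresentation q h𝓠 ⟨p, hp⟩
  obtain ⟨U, hU, hpU, hUW, g, hg, hgr⟩ := exists_extension_finite (relationMinor r) hpW
  refine ⟨U, hU, hpU, _, inferInstance, g, hg, fun y hyU hyV => ?_⟩
  have hyW : (⟨y, hyV⟩ : V) ∈ W := hUW hyU
  have h1 : y ∈ Subtype.val '' support 𝓠 ↔ (⟨y, hyV⟩ : V) ∈ support 𝓠 := by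
    constructor
    · rintro ⟨x, hx, rfl⟩
      exact hx
    · exact fun h => ⟨_, h, rfl⟩
  rw [h1, hP.mem_support_iff hyW]
  exact forall_congr' fun I => by rw [hgr I ⟨y, hyV⟩ hyW hyU]

/-- The support is cut out by the maximal minors of the relations, and is not the whole curve
because the rank vanishes: it is a proper analytic subset. -/
theorem support_finite [CompactSpace X] (hV : IsCurve V) (q : restrictBundle F E V ⟶ 𝓠) [Epi q]
    (h𝓠 : IsCoherent 𝓠) (hr : rank 𝓠 = 0) : (support 𝓠).Finite := by
  refine Set.Finite.of_finite_image ?_ Subtype.val_injective.injOn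
  refine PlaneCurve.finite_of_isAnalyticSubset hV (isAnalyticSubset_support hV.1.1 q h𝓠) ?_
    (support_image_ne hV.1.2.1 h𝓠 hr)
  rintro _ ⟨x, -, rfl⟩
  exact x.2

end Support

end ZStability

namespace ZStability

/-! ### Finite dimensionality of the sections of a quotient of rank zero -/

section FiniteDimension

open CategoryTheory.Limits Metric

variable {X : Type u} [TopologicalSpace X] [ChartedSpace C2 X] [IsManifold 𝓘(ℂ, C2) ω X] {V : Set X}
  {𝓠 : SheafOfModules.{u} (structureSheaf V)}

/-- Near each point of a curve, functions modulo an ideal with a proper zero set form a finite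
dimensional space. -/
theorem exists_function_mod (hV : IsCurve V) {A : Set X} (hA : IsAnalyticSubset A) (hAV : A ⊆ V)
    (hne : A ≠ V) {W : Opens (TopCat.of V)} {l : ℕ}
    (f : Fin l → (structureSheaf V).obj.obj (op W))
    (hf : ∀ (x : V) (hx : x ∈ W), (∀ i, evalAt hx (f i) = 0) → x.1 ∈ A) {p : V} (hp : p ∈ W) :
    ∃ (W₀ : Opens (TopCat.of V)) (h₀ : W₀ ≤ W), p ∈ W₀ ∧
      ∃ (K M : ℕ) (u : Fin K × Fin M → (structureSheaf V).obj.obj (op W₀)),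
        ∀ (W₁ : Opens (TopCat.of V)), p ∈ W₁ → ∀ c : (structureSheaf V).obj.obj (op W₁),
          ∃ (W₂ : Opens (TopCat.of V)) (h₂ : W₂ ≤ W₁) (h₂' : W₂ ≤ W₀), p ∈ W₂ ∧
            ∃ (a : Fin K × Fin M → ℂ) (γ : Fin l → (structureSheaf V).obj.obj (op W₂)),
              restrictFunction h₂ c = ∑ k, constHom V W₂ (a k) * restrictFunction h₂' (u k) +
                ∑ i, γ i * restrictFunction (h₂'.trans h₀) (f i) := by
  obtain ⟨U, hU, hpU, hUW, h, hh, hfh⟩ := exists_extension_finite f hp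
  obtain ⟨Φ, O, f₀, r, r', hc⟩ := PlaneCurve.exists_adaptedChart hV p.2 hU hpU
  obtain ⟨δ, hδ, hδO, -, K, M, hKM⟩ := hc.isLocalCurve.exists_polynomial_mod hc.isOpen hc.box_subset
    (fun i => hc.differentiableOn_comp_symm (hh i)) (fun z hz w hw =>
      hc.not_eventually_eq_zero hV hA hAV hne (fun x hxU hxV hx =>
        hf ⟨x, hxV⟩ (hUW hxU) fun i => by rw [hfh i ⟨x, hxV⟩ (hUW hxU) hxU, hx])
        hw.2 (hc.ball_subset ⟨hz.1, hw.1⟩))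
  -- the neighbourhoods of `p` corresponding to boxes
  have hbox : ∀ s > 0, IsOpen (Φ.source ∩ Φ ⁻¹' (ball (0 : ℂ) s ×ˢ ball (0 : ℂ) s)) ∧
      p.1 ∈ Φ.source ∩ Φ ⁻¹' (ball (0 : ℂ) s ×ˢ ball (0 : ℂ) s) := fun s hs =>
    hc.isOpen_preimage (isOpen_ball.prod isOpen_ball) ⟨mem_ball_self hs, mem_ball_self hs⟩
  have hmemU : ∀ s ≤ δ, ∀ y ∈ Φ.source ∩ Φ ⁻¹' (ball (0 : ℂ) s ×ˢ ball (0 : ℂ) s), y ∈ U := by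
    rintro s hs y ⟨hys, hy⟩
    have := (hc.subset (hδO (Set.prod_mono (ball_subset_ball hs) (ball_subset_ball hs) hy))).2
    rwa [Set.mem_preimage, Φ.left_inv hys] at this
  have hm : ∀ k : Fin K × Fin M, ∃ u : (structureSheaf V).obj.obj (op (openTrace V (hbox δ hδ).1)),
      ∀ (y : V) (hy : y ∈ openTrace V (hbox δ hδ).1),
        evalAt hy u = (Φ y.1).1 ^ k.1.1 * (Φ y.1).2 ^ k.2.1 := fun k =>
    exists_function_of_mdifferentiableOn (hbox δ hδ).1
      (hc.chart.mdifferentiableOn_comp (g := fun z => z.1 ^ k.1.1 * z.2 ^ k.2.1) (by fun_prop))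
      fun y hy => hy
  choose u hu using hm
  refine ⟨openTrace V (hbox δ hδ).1, fun y hy => hUW (hmemU δ le_rfl y.1 hy),
    (hbox δ hδ).2, K, M, u,
    fun W₁ hp₁ c => ?_⟩
  obtain ⟨U₁, hU₁, hpU₁, c', hc', hcc'⟩ := exists_extension c hp₁
  obtain ⟨U₂, hU₂, hpU₂, hUW₂⟩ := exists_openTrace_le hp₁
  -- a small box on which the extension of `c` is defined
  have hO₁ : IsOpen (Φ.target ∩ Φ.symm ⁻¹' (U₁ ∩ U₂)) :=
    Φ.isOpen_inter_preimage_symm (hU₁.inter hU₂)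
  have h0 : (0 : ℂ × ℂ) ∈ Φ.target ∩ Φ.symm ⁻¹' (U₁ ∩ U₂) := by
    refine ⟨(hc.subset hc.zero_mem).1, ?_⟩
    rw [Set.mem_preimage, hc.symm_zero]
    exact ⟨hpU₁, hpU₂⟩
  obtain ⟨ε, hε, hεO⟩ := Metric.isOpen_iff.1 hO₁ 0 h0
  obtain ⟨s, hs, hsδ, hsε⟩ : ∃ s > 0, s ≤ δ ∧ s ≤ ε := ⟨min δ ε, lt_min hδ hε, min_le_left _ _,
    min_le_right _ _⟩
  have hsO : ball (0 : ℂ) s ×ˢ ball (0 : ℂ) s ⊆ Φ.target ∩ Φ.symm ⁻¹' (U₁ ∩ U₂) := by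
    rw [ball_prod_same]
    exact (ball_subset_ball hsε).trans hεO
  have hmemU₁ : ∀ y ∈ Φ.source ∩ Φ ⁻¹' (ball (0 : ℂ) s ×ˢ ball (0 : ℂ) s), y ∈ U₁ ∩ U₂ := by
    rintro y ⟨hys, hy⟩
    have := (hsO hy).2
    rwa [Set.mem_preimage, Φ.left_inv hys] at this
  obtain ⟨a, g, hg, hag⟩ := hKM s hsδ (c' ∘ Φ.symm)
    ((hc.chart.differentiableOn_comp_symm hc').mono fun z hz => ⟨(hsO hz).1, (hsO hz).2.1⟩)
  have hγ : ∀ i, ∃ γ : (structureSheaf V).obj.obj (op (openTrace V (hbox s hs).1)),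
      ∀ (y : V) (hy : y ∈ openTrace V (hbox s hs).1), evalAt hy γ = g i (Φ y.1) := fun i =>
    exists_function_of_mdifferentiableOn (hbox s hs).1 (hc.chart.mdifferentiableOn_comp (hg i))
      fun y hy => hy
  choose γ hγ using hγ
  refine ⟨openTrace V (hbox s hs).1, fun y hy => hUW₂ (hmemU₁ y.1 hy).2, fun y hy =>
    ⟨hy.1, Set.prod_mono (ball_subset_ball hsδ) (ball_subset_ball hsδ) hy.2⟩, (hbox s hs).2,
    fun k => a k.1 k.2, γ, function_ext fun y hy => ?_⟩
  have hyU := hmemU s hsδ y.1 hy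
  have e := hag (Φ y.1) ⟨Φ.map_source hy.1, by rw [Set.mem_preimage, Φ.left_inv hy.1]; exact y.2⟩
    hy.2
  simp only [Function.comp_apply, Φ.left_inv hy.1] at e
  rw [evalAt_restrictFunction, hcc' y _ (hmemU₁ y.1 hy).1, e, map_add, map_sum, map_sum]
  congr 1
  · rw [Fintype.sum_prod_type, Finset.sum_range]
    refine Finset.sum_congr rfl fun i _ => ?_
    rw [Finset.sum_range]
    refine Finset.sum_congr rfl fun j _ => ?_
    rw [map_mul, evalAt_constHom]
    exact congrArg (a i j * ·) (hu (i, j) y _).symm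
  · refine Finset.sum_congr rfl fun i _ => ?_
    rw [map_mul, evalAt_restrictFunction, hγ, hfh i y _ hyU]

variable {F : Type*} [NormedAddCommGroup F] [NormedSpace ℂ F] [FiniteDimensional ℂ F]
  {E : X → Type u} [TopologicalSpace (Bundle.TotalSpace F E)] [∀ x, AddCommGroup (E x)]
  [∀ x, Module ℂ (E x)] [∀ x, TopologicalSpace (E x)] [FiberBundle F E] [VectorBundle ℂ F E]
  [ContMDiffVectorBundle ω F E 𝓘(ℂ, C2)]

/-- Near each point, the sections of a quotient of rank zero are spanned by finitely many. -/
lemma exists_local_span (hV : IsCurve V) (q : restrictBundle F E V ⟶ 𝓠) [Epi q]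
    (h𝓠 : IsCoherent 𝓠) (hr : rank 𝓠 = 0) (p : V) :
    ∃ W₀ : Opens (TopCat.of V), p ∈ W₀ ∧ ∃ (ι : Type) (_ : Fintype ι) (v : ι → 𝓠.val.obj (op W₀)),
      ∀ t : 𝓠.val.obj (op ⊤), ∃ (W₂ : Opens (TopCat.of V)) (h₂ : W₂ ≤ W₀), p ∈ W₂ ∧
        ∃ a : ι → ℂ, restrictSection 𝓠 le_top t =
          ∑ k, constHom V W₂ (a k) • restrictSection 𝓠 h₂ (v k) := by
  obtain ⟨W, hpW, s, m, r, hP⟩ := exists_isPresentation q h𝓠 p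
  let ε := Fintype.equivFin (Fin (Module.finrank ℂ F) → Fin m)
  obtain ⟨W₀, h₀, hp₀, K, M, u, hu⟩ := exists_function_mod hV
    (isAnalyticSubset_support hV.1.1 q h𝓠) (by rintro _ ⟨x, -, rfl⟩; exact x.2)
    (support_image_ne hV.1.2.1 h𝓠 hr) (fun i => relationMinor r (ε.symm i))
    (fun x hx h => ⟨x, (hP.mem_support_iff hx).2 fun I => by
      have := h (ε I)
      rwa [ε.symm_apply_apply] at this, rfl⟩) hpW
  refine ⟨W₀, hp₀, Fin (Module.finrank ℂ F) × (Fin K × Fin M), inferInstance,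
    fun k => u k.2 • restrictSection 𝓠 h₀ (sectionMap q W (s k.1)), fun t => ?_⟩
  obtain ⟨W₁, h₁, hp₁, c, hc⟩ := hP.generates W le_rfl (restrictSection 𝓠 le_top t) p hpW
  choose N hN hN' hpN a γ hac using fun b => hu W₁ hp₁ (c b)
  let W₂ : Opens (TopCat.of V) := ⟨(W₀ ⊓ W₁ : Opens (TopCat.of V)) ∩ ⋂ b, (N b : Set V),
    (W₀ ⊓ W₁).isOpen.inter (isOpen_iInter_of_finite fun b => (N b).isOpen)⟩
  have hWN : ∀ b, W₂ ≤ N b := fun b y hy => Set.mem_iInter.1 hy.2 b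
  have h₂₀ : W₂ ≤ W₀ := fun y hy => hy.1.1
  have hc₂ : ∀ b, restrictFunction ((hWN b).trans (hN b)) (c b) =
      ∑ k, constHom V W₂ (a b k) * restrictFunction h₂₀ (u k) +
        ∑ i, restrictFunction (hWN b) (γ b i) *
          restrictFunction (h₂₀.trans h₀) (relationMinor r (ε.symm i)) := fun b => by
    let φ := ((structureSheaf V).obj.map (homOfLE (hWN b)).op).hom
    refine (congrArg φ (hac b)).trans ?_
    rw [map_add, map_sum, map_sum]
    simp only [map_mul]
    rfl
  have h0 : ∀ I b, restrictFunction (h₂₀.trans h₀) (relationMinor r I) •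
      restrictSection 𝓠 (h₂₀.trans h₀) (sectionMap q W (s b)) = 0 := fun I b =>
    (restrictSection_smul 𝓠 (h₂₀.trans h₀) _ _).symm.trans
      ((congrArg _ (hP.relationMinor_smul I b)).trans (restrictSection_zero 𝓠 _))
  have hle : W₂ ≤ W₁ := fun y hy => hy.1.2
  refine ⟨W₂, h₂₀, ⟨⟨hp₀, hp₁⟩, Set.mem_iInter.2 hpN⟩, fun k => a k.1 k.2, ?_⟩
  have e := congrArg (restrictSection 𝓠 hle) hc
  rw [restrictSection_restrictSection, restrictSection_restrictSection,
    restrictSection_combination] at e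
  rw [e, combination, Fintype.sum_prod_type]
  refine Finset.sum_congr rfl fun b _ => ?_
  let B := (structureSheaf V).obj.obj (op W₂)
  let v : 𝓠.val.obj (op W₂) := restrictSection 𝓠 (h₂₀.trans h₀) (sectionMap q W (s b))
  have e1 := congrArg (fun d : B => d • v) (hc₂ b)
  refine Eq.trans e1 ((add_smul (R := B) _ _ v).trans ?_)
  have e2 : (∑ i, restrictFunction (hWN b) (γ b i) *
      restrictFunction (h₂₀.trans h₀) (relationMinor r (ε.symm i))) • v = 0 :=
    (Finset.sum_smul (R := B)).trans (Finset.sum_eq_zero fun i _ =>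
      (mul_smul (α := B) _ _ v).trans ((congrArg _ (h0 (ε.symm i) b)).trans (smul_zero _)))
  refine (congrArg _ e2).trans ((add_zero _).trans ((Finset.sum_smul (R := B)).trans ?_))
  refine Finset.sum_congr rfl fun k _ => (mul_smul (α := B) _ _ v).trans ?_
  rw [restrictSection_smul, restrictSection_restrictSection]

end FiniteDimension

end ZStability

namespace ZStability

/-! ### Degrees and stability -/

section Degree

open CategoryTheory.Limits

variable {X : Type u} [TopologicalSpace X] [ChartedSpace C2 X] [IsManifold 𝓘(ℂ, C2) ω X] {V : Set X}
  {𝓠 : SheafOfModules.{u} (structureSheaf V)}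
  {F : Type*} [NormedAddCommGroup F] [NormedSpace ℂ F] [FiniteDimensional ℂ F]
  {E : X → Type u} [TopologicalSpace (Bundle.TotalSpace F E)] [∀ x, AddCommGroup (E x)]
  [∀ x, Module ℂ (E x)] [∀ x, TopologicalSpace (E x)] [FiberBundle F E] [VectorBundle ℂ F E]
  [ContMDiffVectorBundle ω F E 𝓘(ℂ, C2)]

/-- The global sections of a quotient of rank zero form a finite dimensional space: they are sums of
extensions by zero of sections near the points of the support. -/
theorem finite_globalSections [T2Space X] [CompactSpace X] (hV : IsCurve V)
    (q : restrictBundle F E V ⟶ 𝓠) [Epi q] (h𝓠 : IsCoherent 𝓠) (hr : rank 𝓠 = 0) :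
    @Module.Finite ℂ (𝓠.val.obj (op ⊤)) _ _
      (Module.compHom (𝓠.val.obj (op ⊤)) (constHom V ⊤)) := by
  let : Module ℂ (𝓠.val.obj (op (⊤ : Opens (TopCat.of V)))) :=
    Module.compHom (𝓠.val.obj (op ⊤)) (constHom V ⊤)
  have hfin := support_finite hV q h𝓠 hr
  have := hfin.fintype
  -- the complement of the other points of the support
  let C : support 𝓠 → Opens (TopCat.of V) := fun p =>
    ⟨(support 𝓠 \ {p.1})ᶜ, (hfin.subset Set.sdiff_subset).isClosed.isOpen_compl⟩
  have hpC : ∀ p, p.1 ∈ C p := fun p h => h.2 rfl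
  have hC : ∀ p x, x ∈ C p → x ∈ support 𝓠 → x = p.1 := fun p x hx hxs => by
    by_contra hne
    exact hx ⟨hxs, hne⟩
  choose W₀ hp₀ ι hι v hv using fun p : support 𝓠 => exists_local_span hV q h𝓠 hr p.1
  choose v' hv' hv'0 using fun (p : support 𝓠) (k : ι p) =>
    exists_extension_by_zero hfin (le_top : W₀ p ⊓ C p ≤ ⊤)
      (restrictSection 𝓠 inf_le_left (v p k))
  refine Module.Finite.of_surjective
    (Fintype.linearCombination ℂ fun k : Σ p, ι p => v' k.1 k.2) fun t => ?_
  choose W₂ h₂ hp₂ a ha using fun p => hv p t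
  refine ⟨fun k => a k.1 k.2, ?_⟩
  rw [Fintype.linearCombination_apply, Fintype.sum_sigma]
  change ∑ p, ∑ k, constHom V ⊤ (a p k) • v' p k = t
  refine section_ext 𝓠 fun x _ => ?_
  by_cases hx : x ∈ support 𝓠
  · let p : support 𝓠 := ⟨x, hx⟩
    refine ⟨W₂ p ⊓ C p, le_top, ⟨hp₂ p, hpC p⟩, ?_⟩
    have e := congrArg (restrictSection 𝓠 (inf_le_left : W₂ p ⊓ C p ≤ W₂ p)) (ha p)
    rw [restrictSection_restrictSection] at e
    rw [e, restrictSection_sum, restrictSection_sum]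
    rw [Finset.sum_eq_single p]
    · rw [restrictSection_sum]
      refine Finset.sum_congr rfl fun k _ => ?_
      have h1 : W₂ p ⊓ C p ≤ W₀ p ⊓ C p := inf_le_inf_right _ (h₂ p)
      have e1 : restrictSection 𝓠 (le_top : W₂ p ⊓ C p ≤ ⊤) (v' p k) =
          restrictSection 𝓠 (inf_le_left.trans (h₂ p)) (v p k) := by
        rw [← restrictSection_restrictSection 𝓠 le_top h1, hv' p k, restrictSection_restrictSection]
      rw [restrictSection_smul, restrictSection_smul, restrictSection_restrictSection, e1]
      rfl
    · intro p' _ hp'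
      rw [restrictSection_sum]
      refine Finset.sum_eq_zero fun k _ => ?_
      have e1 : restrictSection 𝓠 (le_top : W₂ p ⊓ C p ≤ ⊤) (v' p' k) = 0 :=
        hv'0 p' k _ _ fun y hy hys hy' =>
          hp' (Subtype.ext ((hC p' y hy'.2 hys).symm.trans (hC p y hy.2 hys)))
      rw [restrictSection_smul, e1]
      exact smul_zero _
    · simp
  · obtain ⟨W, hxW, h0⟩ := not_not.1 hx
    exact ⟨W, le_top, hxW, (h0 W le_rfl _).trans (h0 W le_rfl _).symm⟩

/-- A nonzero quotient of rank zero has positive degree: its degree is the dimension of its space of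
sections, because sheaves with finite support are flasque. -/
theorem degree_pos_of_rank_eq_zero [T2Space X] [CompactSpace X] (hV : IsCurve V)
    (q : restrictBundle F E V ⟶ 𝓠) [Epi q] (h𝓠 : IsCoherent 𝓠) (hr : rank 𝓠 = 0)
    (h0 : ¬ IsZero 𝓠) : 0 < degree 𝓠 := by
  have hfin := support_finite hV q h𝓠 hr
  have h1 : hdim 𝓠 1 = 0 := hdim_one_eq_zero_of_isFlasque 𝓠 fun W₁ W₂ h t => by
    obtain ⟨t', ht', -⟩ := exists_extension_by_zero hfin h t
    exact ⟨t', ht'⟩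
  have h2 : 0 < hdim 𝓠 0 := by
    rw [hdim_zero_eq]
    let : Module ℂ (𝓠.val.obj (op (⊤ : Opens (TopCat.of V)))) :=
      Module.compHom (𝓠.val.obj (op ⊤)) (constHom V ⊤)
    have := finite_globalSections hV q h𝓠 hr
    have : Nontrivial (𝓠.val.obj (op (⊤ : Opens (TopCat.of V)))) := by
      rw [isZero_iff_forall_section_eq_zero] at h0
      push Not at h0
      obtain ⟨W, s, hs⟩ := h0
      obtain ⟨t, ht, -⟩ := exists_extension_by_zero hfin (le_top : W ≤ ⊤) s
      refine ⟨t, 0, fun h => hs ?_⟩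
      rw [← ht, h, restrictSection_zero]
    exact Module.finrank_pos
  rw [degree, hr, eulerChar, h1]
  simpa using h2

end Degree

section Charge

/-- Comparison of central charges: the classes `U₁.V` contribute the same slope to both sheaves and
cancel. -/
lemma im_charge_div_pos_iff {ρ₀ ρ₁ : ℂ} (h : 0 < (ρ₀ / ρ₁).im) {A B r d R D : ℝ} (hA : 0 < A)
    (hR : 0 < R) :
    0 < ((ρ₁ * A * r + ρ₀ * B * r + ρ₀ * d) / (ρ₁ * A * R + ρ₀ * B * R + ρ₀ * D)).im ↔
      0 < d * R - r * D := by
  have hρ₁ : ρ₁ ≠ 0 := by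
    rintro rfl
    simp at h
  set τ := ρ₀ / ρ₁ with hτ
  have hρ₀ : ρ₀ = ρ₁ * τ := by rw [hτ]; field_simp
  have e : ∀ s e : ℝ, ρ₁ * A * s + ρ₀ * B * s + ρ₀ * e = ρ₁ * (A * s + τ * (B * s + e)) :=
    fun s e => by rw [hρ₀]; ring
  have hne : (A * R + τ * (B * R + D) : ℂ) ≠ 0 := fun h0 => by
    have h1 := congrArg Complex.im h0
    have h2 := congrArg Complex.re h0
    simp [Complex.mul_re, Complex.mul_im, h.ne'] at h1 h2
    rw [h1] at h2
    have := mul_pos hA hR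
    simp at h2
    grind
  rw [e, e, mul_div_mul_left _ _ hρ₁, Complex.div_im]
  have hn : 0 < Complex.normSq (A * R + τ * (B * R + D)) :=
    Complex.normSq_pos.2 hne
  rw [← sub_div, div_pos_iff_of_pos_right hn]
  have key : (A * r + τ * (B * r + d) : ℂ).im * (A * R + τ * (B * R + D) : ℂ).re -
      (A * r + τ * (B * r + d) : ℂ).re * (A * R + τ * (B * R + D) : ℂ).im =
      τ.im * A * (d * R - r * D) := by
    simp [Complex.mul_re, Complex.mul_im]
    ring
  rw [key]
  exact mul_pos_iff_of_pos_left (mul_pos h hA)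

variable {X : Type u} [TopologicalSpace X] [ChartedSpace C2 X] [IsManifold 𝓘(ℂ, C2) ω X]
  [CompactSpace X] {V : Set X}

/-- The stability inequality for central charges, in terms of ranks and degrees. -/
lemma im_charge_div_charge_pos_iff {κ : ClosedForm X 2} (hκ : κ.IsKahler) (Z : CentralCharge X)
    (hV : IsCurve V) {𝓔 𝓠 : SheafOfModules.{u} (structureSheaf V)} (hE : 0 < rank 𝓔) :
    0 < (charge κ Z 𝓠 / charge κ Z 𝓔).im ↔
      0 < (degree 𝓠 * rank 𝓔 - rank 𝓠 * degree 𝓔 : ℝ) := by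
  rw [← im_charge_div_pos_iff (Z.im_pos 0) (B := integralOver Z.u₁ V)
    (PlaneCurve.integralOver_pos hV hκ) (Nat.cast_pos.2 hE)]
  simp only [charge, Complex.ofReal_natCast, Complex.ofReal_intCast]
  rfl

end Charge

section Stability

open CategoryTheory.Limits

variable {X : Type u} [TopologicalSpace X] [ChartedSpace C2 X] [IsManifold 𝓘(ℂ, C2) ω X]
  {F : Type*} [NormedAddCommGroup F] [NormedSpace ℂ F]
  {E : X → Type u} [TopologicalSpace (Bundle.TotalSpace F E)] [∀ x, AddCommGroup (E x)]
  [∀ x, Module ℂ (E x)] [∀ x, TopologicalSpace (E x)] [FiberBundle F E] [VectorBundle ℂ F E]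

/-- For a short exact sequence with nonzero kernel, the quotient has smaller rank. -/
lemma rank_lt_of_shortExact [FiniteDimensional ℂ F] [ContMDiffVectorBundle ω F E 𝓘(ℂ, C2)]
    {V : Set X} (hV : IsCurve V)
    {𝓢 𝓠 : SheafOfModules.{u} (structureSheaf V)} {i : 𝓢 ⟶ restrictBundle F E V}
    {q : restrictBundle F E V ⟶ 𝓠} {w : i ≫ q = 0} (h : (ShortComplex.mk i q w).ShortExact)
    (h𝓠 : IsCoherent 𝓠) (h𝓢 : ¬ IsZero 𝓢) : rank 𝓠 < rank (restrictBundle F E V) := by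
  have : Epi q := h.epi_g
  have : Mono i := h.mono_f
  refine (rank_le_of_epi hV.1.2.1 q h𝓠).lt_of_ne fun hr => h𝓢 ?_
  rw [isZero_iff_forall_section_eq_zero]
  intro W s
  refine sectionMap_injective i W ((eq_zero_of_rank_eq hV q h𝓠 hr W _ ?_).trans (map_zero _).symm)
  exact congrArg (fun f : 𝓢 ⟶ 𝓠 => sectionMap f W s) w

/-- A quotient of smaller rank has a nonzero kernel, so it is tested by the central charge. -/
theorem isMumfordStable_of_isZStable [CompactSpace X] {κ : ClosedForm X 2} (hκ : κ.IsKahler)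
    (Z : CentralCharge X)
    (h : IsZStableOverSubvarieties F E κ Z) {V : Set X} (hV : IsCurve V) :
    IsMumfordStable (restrictBundle F E V) := by
  intro 𝓠 q _ h𝓠 hr hrR
  have hS : ¬ IsZero (kernel q) := fun h0 => by
    have := isIso_of_isZero_kernel q h0
    exact hrR.ne (rank_eq_of_isIso q).symm
  have h1 := h V hV _ 𝓠 _ q _ (shortExact_kernel q) h𝓠 hS
    fun h0 => hr.ne' (rank_eq_zero_of_isZero hV.1.2.1 h0)
  rw [im_charge_div_charge_pos_iff hκ Z hV (hr.trans hrR)] at h1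
  rw [slope, slope, div_lt_div_iff₀ (Nat.cast_pos.2 (hr.trans hrR)) (Nat.cast_pos.2 hr)]
  linarith

/-- The quotients not tested by Mumford stability have rank zero, where the degree is positive, or
full rank, where the subsheaf vanishes. -/
theorem isZStable_of_isMumfordStable [T2Space X] [CompactSpace X] [FiniteDimensional ℂ F]
    [ContMDiffVectorBundle ω F E 𝓘(ℂ, C2)] {κ : ClosedForm X 2} (hκ : κ.IsKahler)
    (Z : CentralCharge X)
    (h : ∀ V : Set X, IsCurve V → IsMumfordStable (restrictBundle F E V)) :
    IsZStableOverSubvarieties F E κ Z := by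
  intro V hV 𝓢 𝓠 i q w hses h𝓠 h𝓢 h𝓠0
  have : Epi q := hses.epi_g
  have hrR := rank_lt_of_shortExact hV hses h𝓠 h𝓢
  rw [im_charge_div_charge_pos_iff hκ Z hV (by lia)]
  have hR : (0 : ℝ) < rank (restrictBundle F E V) := Nat.cast_pos.2 (by lia)
  rcases Nat.eq_zero_or_pos (rank 𝓠) with hr | hr
  · have hd : (0 : ℝ) < degree 𝓠 := Int.cast_pos.2 (degree_pos_of_rank_eq_zero hV q h𝓠 hr h𝓠0)
    rw [hr, Nat.cast_zero, zero_mul, sub_zero]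
    exact mul_pos hd hR
  · have h1 := h V hV 𝓠 q this h𝓠 hr hrR
    rw [slope, slope, div_lt_div_iff₀ hR (Nat.cast_pos.2 hr)] at h1
    linarith

end Stability

end ZStability

theorem mainTheorem10 {X : Type u} [TopologicalSpace X] [ChartedSpace ZStability.C2 X]
    [IsManifold 𝓘(ℂ, ZStability.C2) ω X] [T2Space X] [CompactSpace X]
    (κ : ZStability.ClosedForm X 2) (hκ : κ.IsKahler) (Z : ZStability.CentralCharge X)
    {F : Type*} [NormedAddCommGroup F] [NormedSpace ℂ F] [FiniteDimensional ℂ F]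
    (E : X → Type u) [TopologicalSpace (Bundle.TotalSpace F E)] [∀ x, AddCommGroup (E x)]
    [∀ x, Module ℂ (E x)] [∀ x, TopologicalSpace (E x)] [FiberBundle F E] [VectorBundle ℂ F E]
    [ContMDiffVectorBundle ω F E 𝓘(ℂ, ZStability.C2)] :
    ZStability.IsZStableOverSubvarieties F E κ Z ↔
      ∀ V : Set X, ZStability.IsCurve V →
        ZStability.IsMumfordStable (ZStability.restrictBundle F E V) :=
  ⟨fun h _ hV => ZStability.isMumfordStable_of_isZStable hκ Z h hV,
    ZStability.isZStable_of_isMumfordStable hκ Z⟩
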